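/- Setting. Let $\mathcal T^H$ be a finite conforming coarse mesh of closed axis-parallel rectangles, $\Omega\subset\mathbb R^2$ the interior of its union, and $\mathcal T^h$ a conforming refinement into fine rectangles $\tau$ with mesh size $h=\max_\tau \operatorname{diam}\tau$. Let $\kappa>0$ be constant on each fine block, $\gamma>0$. Functions may be discontinuous across coarse edges; on an interior coarse edge $E$ between $K^\pm$, with unit normal $n_E$ pointing from $K^+$ to $K^-$, put $\{G\}=\frac12(G^++G^-)$, $[\![G]\!]=G^+-G^-$, $\overline\kappa=\frac12(\max_{K^+}\kappa+\max_{K^-}\kappa)$, and on $E\subset\partial\Omega\cap\partial K$ put $\{G\}=[\![G]\!]=G$, $\overline\kappa=\max_K\kappa$, $n_E$ outward. Let $$a_{DG}(v,w)=\sum_{K}\int_K\kappa\nabla v\cdot\nabla w-\sum_E\int_E\{\kappa\nabla v\cdot n_E\}[\![w]\!]-\sum_E\int_E\{\kappa\nabla w\cdot n_E\}[\![v]\!]+\frac{\gamma}{h}\sum_E\int_E\overline\kappa[\![v]\!][\![w]\!],$$ $\|w\|_a^2=a_{DG}(w,w)$ and $\|w\|_{DG}^2=\sum_K\int_K\kappa|\nabla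 w|^2+\frac\gamma h\sum_E\int_E\overline\kappa[\![w]\!]^2$. Let $V_h(K)$ be the continuous functions on $K$ that are bilinear on each fine block of $K$ and vanish on $\partial\Omega\cap K$, and $V_h=\bigoplus_K V_h(K)$. For each coarse node $z$ let $\chi_z$ be the multiscale finite element basis function computed on the fine grid: on each coarse block it is continuous and bilinear on fine blocks, equals on the block's boundary the bilinear hat function of $z$, and satisfies $\int_K\kappa\nabla\chi_z\cdot\nabla w=0$ for all continuous, fine-blockwise bilinear $w$ on $K$ with $w=0$ on $\partial K$. Assume $\chi_z\ge 0$ for all $z$. Put $\Theta=\sum_z|\nabla\chi_z|^2$, $\widetilde\kappa=\kappa\Theta$, $a_i(v,w)=\int_{K_i}\kappa\nabla v\cdot\nabla w$, $s_i(v,w)=\int_{K_i}\widetilde\kappa vw$, $s=\sum_i s_i$, $\|v\|_{s(K_i)}^2=s_i(v,v)$. For each $i$ let $(\lambda^{(i)}_j,\phi^{(i)}_j)$, $1\le j\le\dim V_h(K_i)$, be the eigenvalues in ascending order and $s_i$-orthonormal eigenfunctions in $V_h(K_i)$ of $a_i(\phi,w)=\lambda s_i(\phi,w)$ for all $w\in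 V_h(K_i)$. Fix $1\le L_i<\dim V_h(K_i)$ and put $V_{aux}=\operatorname{span}\{\phi^{(i)}_j:1\le j\le L_i\}$, $\Lambda=\min_i\lambda^{(i)}_{L_i+1}$, $\lambda_{\max}=\max_i\lambda^{(i)}_{L_i}$. Constants. Let $C_{\mathcal T}$ be the maximal number of vertices of a coarse block. Let $C_0\ge1$ satisfy $C_0^{-1}\|w\|_a\le\|w\|_{DG}\le C_0\|w\|_a$ for all $w$ that are continuous in each coarse block and bicubic on each fine block. Let $C_I\ge1$ satisfy $$\|\widetilde\kappa^{1/2}(u-I_hu)\|_{L^2(\tau)}+h\|\kappa^{1/2}\nabla(u-I_hu)\|_{L^2(\tau)}\le C_Ih\|\kappa^{1/2}\nabla u\|_{L^2(\tau)}$$ for every fine block $\tau$ and every polynomial $u$ of degree at most $5$ in each variable that vanishes on $\tau\cap\partial\Omega$, where $I_hu$ is the bilinear interpolant of $u$ at the vertices of $\tau$. With $B$ the product on each coarse block $K$ of the $\chi_z$ over the vertices $z$ of $K$, let $C_\pi=\sup_{K,\ \mu\in V_{aux}}\int_K\widetilde\kappa\mu^2\big/\int_K\widetilde\kappa B\mu^2$,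 assumed finite. For the coarse block $K_i$ under consideration let $$D=\max\left\{\left(\frac{2C_\pi(1+C_I^2)(C_{\mathcal T}^2+\lambda_{\max})}{1-C_\pi C_I(C_{\mathcal T}^2+\lambda_{\max})\|\Theta\|_{L^\infty(K_i)}^{1/2}h}\right)^2,\ C_0^2(1+C_I^2)\right\}.$$ Statement. Assume $C_\pi C_I(C_{\mathcal T}^2+\lambda_{\max})\|\Theta\|_{L^\infty(\Omega)}^{1/2}h<1$ and $m>2$. Let $K_{i,m}$ be obtained from $K_i$ by adding $m$ times all coarse blocks touching the current region, and let $V_h(K_{i,m})=\bigoplus_{K\subset K_{i,m}}V_h(K)$, extended by zero. Let $1\le j\le L_i$, and let $\psi_j^{(i)}$ and $\psi_{j,ms}^{(i)}$ be minimizers of $a_{DG}(\psi,\psi)$ over $\psi\in V_h$ and over $\psi\in V_h(K_{i,m})$, respectively, subject to $s(\psi,\phi^{(i')}_{j'})=\delta_{ii'}\delta_{jj'}$ for all $i'$ and all $1\le j'\le L_{i'}$. Then $$\|\psi_j^{(i)}-\psi_{j,ms}^{(i)}\|_a^2\le E\,\|\phi_j^{(i)}\|_{s(K_i)}^2,\qquad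 E=40D^3(1+\Lambda^{-1})\left(1+6D^{-2}(1+\Lambda^{-1/2})^{-1}\right)^{1-m}.$$ -/

import Mathlib

open MeasureTheory

namespace CEM

noncomputable section

/-- Points of the plane (Lebesgue measure is the product measure). -/
abbrev Pt := Fin 2 → ℝ

/-- Bivariate real polynomials; `MvPolynomial.restrictDegree (Fin 2) ℝ k` is the space `Q^k`
of polynomials of degree at most `k` in each of the two variables. -/
abbrev Poly := MvPolynomial (Fin 2) ℝ

/-- A nondegenerate axis-parallel rectangle `[lo 0, hi 0] × [lo 1, hi 1]`. -/
@[ext]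
structure Rect where
  lo : Pt
  hi : Pt
  lt : ∀ d, lo d < hi d

namespace Rect

/-- The closed rectangle as a set. -/
def carrier (R : Rect) : Set Pt := Set.Icc R.lo R.hi

/-- The four vertices. -/
def vertices (R : Rect) : Finset Pt := Fintype.piFinset fun d => {R.lo d, R.hi d}

/-- The Euclidean diameter. -/
def diam (R : Rect) : ℝ := √(∑ d, (R.hi d - R.lo d) ^ 2)

/-- `R` and `S` share a full edge with unit normal `e_d`, and `e_d` points from `R` to `S`. -/
def Precedes (d : Fin 2) (R S : Rect) : Prop :=
  R.hi d = S.lo d ∧ ∀ e, e ≠ d → R.lo e = S.lo e ∧ R.hi e = S.hi e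

/-- `∫_R p dx`. -/
def integral (R : Rect) (p : Poly) : ℝ := ∫ x in R.carrier, MvPolynomial.eval x p

/-- The integral of `p` over the segment `{x | x d = c}` between the two sides of `R` that are
orthogonal to the other coordinate axis; `c = R.lo d` and `c = R.hi d` give the two edges
of `R` with normal direction `d`. -/
def edgeIntegral (R : Rect) (d : Fin 2) (c : ℝ) (p : Poly) : ℝ :=
  ∫ t in (R.lo (d + 1))..(R.hi (d + 1)),
    MvPolynomial.eval (fun e => if e = d then c else t) p

/-- The bilinear hat function on `R` of the point `z`: if `z` is a vertex of `R`, it is linear on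
each edge of `R`, equal to `1` at `z` and to `0` at the other vertices; otherwise it is `0`. -/
def hat (R : Rect) (z x : Pt) : ℝ :=
  if z ∈ R.vertices then ∏ d, (1 - |x d - z d| / (R.hi d - R.lo d)) else 0

end Rect

/-- A family of rectangles without overlaps and without hanging nodes: two members are disjoint,
or share exactly a vertex, or share exactly a whole edge, or coincide. -/
def Conforming (T : Finset Rect) : Prop :=
  ∀ R ∈ T, ∀ S ∈ T, Disjoint R.carrier S.carrier ∨
    ∀ d, (R.lo d = S.lo d ∧ R.hi d = S.hi d) ∨ R.hi d = S.lo d ∨ S.hi d = R.lo d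

/-- `∇p · ∇q`. -/
def gradDot (p q : Poly) : Poly :=
  ∑ d : Fin 2, MvPolynomial.pderiv d p * MvPolynomial.pderiv d q

/-- A conforming coarse mesh of rectangles with a conforming refinement into fine rectangles;
`parent τ` is the coarse block containing the fine block `τ`. -/
structure Mesh where
  coarse : Finset Rect
  fine : Finset Rect
  coarse_conforming : Conforming coarse
  fine_conforming : Conforming fine
  parent : fine → coarse
  parent_sub : ∀ τ : fine, τ.1.carrier ⊆ (parent τ).1.carrier
  parent_cover : ∀ K : coarse, ∀ x ∈ K.1.carrier, ∃ τ : fine, parent τ = K ∧ x ∈ τ.1.carrier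

namespace Mesh

variable (M : Mesh)

/-- The computational domain. -/
def Ω : Set Pt := interior (⋃ K : M.coarse, K.1.carrier)

/-- The fine mesh size. -/
def h : ℝ := ⨆ τ : M.fine, τ.1.diam

/-- The coarse grid nodes. -/
def nodes : Finset Pt := M.coarse.biUnion Rect.vertices

/-- The maximum number of vertices of a coarse element. -/
def CT : ℝ := ((M.coarse.sup fun K => K.vertices.card : ℕ) : ℝ)

/-- Piecewise polynomials on the fine grid. A function is given by one polynomial for every fine
block, which provides the one-sided traces of the function and of its gradient on the edges. -/
abbrev Fun := M.fine → Poly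

/-- The functions that are `Q^k` on every fine block and continuous in every (closed) coarse
block. -/
def broken (k : ℕ) : Submodule ℝ M.Fun where
  carrier := {v | (∀ τ, v τ ∈ MvPolynomial.restrictDegree (Fin 2) ℝ k) ∧
    ∀ τ σ, M.parent τ = M.parent σ → ∀ x ∈ τ.1.carrier ∩ σ.1.carrier,
      MvPolynomial.eval x (v τ) = MvPolynomial.eval x (v σ)}
  add_mem' := fun {v w} hv hw =>
    ⟨fun τ => Submodule.add_mem _ (hv.1 τ) (hw.1 τ), fun τ σ e x hx => by
      simp [hv.2 τ σ e x hx, hw.2 τ σ e x hx]⟩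
  zero_mem' := ⟨fun _ => Submodule.zero_mem _, fun _ _ _ _ _ => by simp⟩
  smul_mem' := fun c v hv =>
    ⟨fun τ => Submodule.smul_mem _ c (hv.1 τ), fun τ σ e x hx => by
      simp [MvPolynomial.smul_eval, hv.2 τ σ e x hx]⟩

/-- `⊕_{K ∈ S} V_h(K)`, extended by zero: the functions in `broken 1` that vanish on `∂Ω` and
are supported in the coarse blocks of `S`. -/
def VhOn (S : Set M.coarse) : Submodule ℝ M.Fun where
  carrier := {v | v ∈ M.broken 1 ∧
    (∀ τ, ∀ x ∈ τ.1.carrier ∩ frontier M.Ω, MvPolynomial.eval x (v τ) = 0) ∧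
    ∀ τ, M.parent τ ∉ S → v τ = 0}
  add_mem' := fun {v w} hv hw =>
    ⟨Submodule.add_mem _ hv.1 hw.1, fun τ x hx => by simp [hv.2.1 τ x hx, hw.2.1 τ x hx],
      fun τ hτ => by simp [hv.2.2 τ hτ, hw.2.2 τ hτ]⟩
  zero_mem' := ⟨Submodule.zero_mem _, fun _ _ _ => by simp, fun _ _ => rfl⟩
  smul_mem' := fun c v hv =>
    ⟨Submodule.smul_mem _ c hv.1, fun τ x hx => by
      simp [MvPolynomial.smul_eval, hv.2.1 τ x hx], fun τ hτ => by simp [hv.2.2 τ hτ]⟩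

/-- The DG space `V_h = ⊕_K V_h(K)`. -/
def Vh : Submodule ℝ M.Fun := M.VhOn Set.univ

/-- The local space `V_h(K)`. -/
def VhLoc (K : M.coarse) : Submodule ℝ M.Fun := M.VhOn {K}

/-- The blocks of the oversampled domain `K_{i,m}`: `m` times, all coarse blocks which
touch the present region are added. -/
def oversample (K : M.coarse) : ℕ → Set M.coarse
  | 0 => {K}
  | m + 1 => {K' | ∃ K'' ∈ oversample K m, (K'.1.carrier ∩ K''.1.carrier).Nonempty}

open Classical in
/-- `a_K(v,w) = ∫_K κ ∇v · ∇w dx`. -/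
def aLoc (κ : M.fine → ℝ) (K : M.coarse) (v w : M.Fun) : ℝ :=
  ∑ τ : M.fine, if M.parent τ = K then κ τ * τ.1.integral (gradDot (v τ) (w τ)) else 0

/-- The maximum of `κ` over the coarse block `K`. -/
def kMax (κ : M.fine → ℝ) (K : M.coarse) : ℝ :=
  ⨆ τ : {τ : M.fine // M.parent τ = K}, κ τ.1

open Classical in
/-- The sum over all coarse edges `E` of the integrals over `E`. A coarse edge is the union of the
fine edges contained in it, and the sum runs over these.
An edge inside `Ω` with normal direction `d` between fine blocks `τ` and `σ` of different coarse
blocks, with `n_E = e_d` pointing from `τ` (the `+` side) to `σ` (the `-` side), contributes the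
integral of `F d τ σ`. An edge of `τ` on `∂Ω` with outer normal `n_E = s e_d`, `s = 1` or
`s = -1`, contributes the integral of `G d s τ`. -/
def skeleton (F : Fin 2 → M.fine → M.fine → Poly) (G : Fin 2 → ℝ → M.fine → Poly) : ℝ :=
  (∑ d : Fin 2, ∑ τ : M.fine, ∑ σ : M.fine,
    if τ.1.Precedes d σ.1 ∧ M.parent τ ≠ M.parent σ then
      τ.1.edgeIntegral d (τ.1.hi d) (F d τ σ) else 0) +
  (∑ d : Fin 2, ∑ τ : M.fine,
    if ∀ σ : M.fine, ¬ τ.1.Precedes d σ.1 then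
      τ.1.edgeIntegral d (τ.1.hi d) (G d 1 τ) else 0) +
  (∑ d : Fin 2, ∑ τ : M.fine,
    if ∀ σ : M.fine, ¬ σ.1.Precedes d τ.1 then
      τ.1.edgeIntegral d (τ.1.lo d) (G d (-1) τ) else 0)

/-- `∑_E ∫_E {κ ∇v · n_E} ⟦w⟧ dσ`. -/
def flux (κ : M.fine → ℝ) (v w : M.Fun) : ℝ :=
  M.skeleton
    (fun d τ σ => MvPolynomial.C (1 / 2) *
      (MvPolynomial.C (κ τ) * MvPolynomial.pderiv d (v τ) +
        MvPolynomial.C (κ σ) * MvPolynomial.pderiv d (v σ)) * (w τ - w σ))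
    (fun d s τ => MvPolynomial.C (κ τ * s) * MvPolynomial.pderiv d (v τ) * w τ)

/-- `∑_E ∫_E κ̄ ⟦v⟧ ⟦w⟧ dσ`. -/
def penalty (κ : M.fine → ℝ) (v w : M.Fun) : ℝ :=
  M.skeleton
    (fun _ τ σ => MvPolynomial.C ((M.kMax κ (M.parent τ) + M.kMax κ (M.parent σ)) / 2) *
      (v τ - v σ) * (w τ - w σ))
    (fun _ _ τ => MvPolynomial.C (M.kMax κ (M.parent τ)) * v τ * w τ)

/-- The interior penalty bilinear form `a_DG`; the energy norm is `‖w‖_a² = a_DG(w,w)`. -/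
def aDG (κ : M.fine → ℝ) (γ : ℝ) (v w : M.Fun) : ℝ :=
  (∑ K : M.coarse, M.aLoc κ K v w) - M.flux κ v w - M.flux κ w v + γ / M.h * M.penalty κ v w

/-- The squared DG norm. -/
def normDGsq (κ : M.fine → ℝ) (γ : ℝ) (w : M.Fun) : ℝ :=
  (∑ K : M.coarse, M.aLoc κ K w w) + γ / M.h * M.penalty κ w w

/-- `χ` is the family of multiscale finite element basis functions, computed on the fine grid:
on each coarse block, `χ z` is a continuous piecewise bilinear function that agrees on the boundary
of the block with the bilinear hat function of the coarse node `z`, and that solves there the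
discrete problem `-div(κ ∇ χ_z) = 0`. -/
def IsMsBasis (κ : M.fine → ℝ) (χ : Pt → M.Fun) : Prop :=
  ∀ z ∈ M.nodes, χ z ∈ M.broken 1 ∧
    (∀ τ : M.fine, ∀ x ∈ τ.1.carrier ∩ frontier (M.parent τ).1.carrier,
      MvPolynomial.eval x (χ z τ) = (M.parent τ).1.hat z x) ∧
    ∀ K : M.coarse, ∀ w ∈ M.broken 1,
      (∀ τ : M.fine, ∀ x ∈ τ.1.carrier ∩ frontier (M.parent τ).1.carrier,
        MvPolynomial.eval x (w τ) = 0) →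
      M.aLoc κ K (χ z) w = 0

/-- `Θ = ∑_z |∇χ_z|²`. -/
def Θ (χ : Pt → M.Fun) (τ : M.fine) : Poly := ∑ z ∈ M.nodes, gradDot (χ z τ) (χ z τ)

/-- `κ̃ = ∑_z κ |∇χ_z|²`. -/
def kTilde (κ : M.fine → ℝ) (χ : Pt → M.Fun) (τ : M.fine) : Poly :=
  MvPolynomial.C (κ τ) * M.Θ χ τ

/-- `‖Θ‖_{L^∞}` over the union of the coarse blocks in `S`; `Θ` is a polynomial on each closed
fine block, so the essential supremum is the maximum of these polynomials. -/
def ΘSup (χ : Pt → M.Fun) (S : Set M.coarse) : ℝ :=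
  sSup {t | ∃ τ : M.fine, M.parent τ ∈ S ∧ ∃ x ∈ τ.1.carrier,
    t = MvPolynomial.eval x (M.Θ χ τ)}

open Classical in
/-- `s_K(v,w) = ∫_K κ̃ v w dx`. -/
def sLoc (κ : M.fine → ℝ) (χ : Pt → M.Fun) (K : M.coarse) (v w : M.Fun) : ℝ :=
  ∑ τ : M.fine, if M.parent τ = K then τ.1.integral (M.kTilde κ χ τ * v τ * w τ) else 0

/-- `s(v,w) = ∑_K s_K(v,w)`. -/
def s (κ : M.fine → ℝ) (χ : Pt → M.Fun) (v w : M.Fun) : ℝ :=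
  ∑ K : M.coarse, M.sLoc κ χ K v w

/-- `lam K j` and `φ K j`, `1 ≤ j ≤ dim V_h(K)`, are the eigenvalues in ascending order and
`s_K`-orthonormal eigenfunctions of the local spectral problems
`a_K(φ,w) = λ s_K(φ,w)` for all `w ∈ V_h(K)`. -/
def IsEigensystem (κ : M.fine → ℝ) (χ : Pt → M.Fun)
    (lam : M.coarse → ℕ → ℝ) (φ : M.coarse → ℕ → M.Fun) : Prop :=
  ∀ K : M.coarse, ∀ j ∈ Finset.Icc 1 (Module.finrank ℝ (M.VhLoc K)),
    φ K j ∈ M.VhLoc K ∧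
    (∀ w ∈ M.VhLoc K, M.aLoc κ K (φ K j) w = lam K j * M.sLoc κ χ K (φ K j) w) ∧
    ∀ l ∈ Finset.Icc 1 (Module.finrank ℝ (M.VhLoc K)),
      M.sLoc κ χ K (φ K j) (φ K l) = (if j = l then 1 else 0) ∧ (j ≤ l → lam K j ≤ lam K l)

/-- The global auxiliary space `V_aux`. -/
def Vaux (φ : M.coarse → ℕ → M.Fun) (L : M.coarse → ℕ) : Submodule ℝ M.Fun :=
  Submodule.span ℝ {v | ∃ K, ∃ j ∈ Finset.Icc 1 (L K), v = φ K j}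

/-- `Λ = min_K λ_{L_K+1}^{(K)}`. -/
def Λ (lam : M.coarse → ℕ → ℝ) (L : M.coarse → ℕ) : ℝ := ⨅ K : M.coarse, lam K (L K + 1)

/-- `λ_max = max_K λ_{L_K}^{(K)}`. -/
def lamMax (lam : M.coarse → ℕ → ℝ) (L : M.coarse → ℕ) : ℝ := ⨆ K : M.coarse, lam K (L K)

/-- The constraint in the minimization problems: `s(ψ, φ_{j'}^{(i')}) = δ_{i,i'} δ_{j,j'}`. -/
def IsPhiOrthogonal (κ : M.fine → ℝ) (χ : Pt → M.Fun) (φ : M.coarse → ℕ → M.Fun)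
    (L : M.coarse → ℕ) (i : M.coarse) (j : ℕ) (ψ : M.Fun) : Prop :=
  ∀ i' : M.coarse, ∀ j' ∈ Finset.Icc 1 (L i'),
    (i' = i ∧ j' = j → M.s κ χ ψ (φ i' j') = 1) ∧
    (¬ (i' = i ∧ j' = j) → M.s κ χ ψ (φ i' j') = 0)

/-- `ψ` minimizes `a_DG(ψ,ψ)` among the `φ_j^{(i)}`-orthogonal elements of `V`. -/
def IsCEMBasis (κ : M.fine → ℝ) (γ : ℝ) (χ : Pt → M.Fun) (φ : M.coarse → ℕ → M.Fun)
    (L : M.coarse → ℕ) (V : Submodule ℝ M.Fun) (i : M.coarse) (j : ℕ) (ψ : M.Fun) : Prop :=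
  ψ ∈ V ∧ M.IsPhiOrthogonal κ χ φ L i j ψ ∧
    ∀ w ∈ V, M.IsPhiOrthogonal κ χ φ L i j w → M.aDG κ γ ψ ψ ≤ M.aDG κ γ w w

/-- `C0` is a constant of equivalence between the energy norm and the DG norm on the piecewise
bicubic functions: `C0⁻¹ ‖w‖_a ≤ ‖w‖_DG ≤ C0 ‖w‖_a` (written with squares). -/
def IsNormEquivConst (κ : M.fine → ℝ) (γ C0 : ℝ) : Prop :=
  1 ≤ C0 ∧ ∀ w ∈ M.broken 3,
    M.aDG κ γ w w ≤ C0 ^ 2 * M.normDGsq κ γ w ∧ M.normDGsq κ γ w ≤ C0 ^ 2 * M.aDG κ γ w w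

/-- `CI` is a constant in the approximation estimate for the vertex interpolant `I_h u`
(the bilinear function `q` which agrees with `u` at the vertices of the fine block), for
polynomials `u ∈ Q^5` that vanish on `∂Ω`:
`‖κ̃^{1/2} (u - I_h u)‖_{L²(τ)} + h ‖κ^{1/2} ∇(u - I_h u)‖_{L²(τ)} ≤ CI h ‖κ^{1/2} ∇u‖_{L²(τ)}`. -/
def IsInterpConst (κ : M.fine → ℝ) (χ : Pt → M.Fun) (CI : ℝ) : Prop :=
  1 ≤ CI ∧ ∀ τ : M.fine, ∀ u ∈ MvPolynomial.restrictDegree (Fin 2) ℝ 5,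
    (∀ x ∈ τ.1.carrier ∩ frontier M.Ω, MvPolynomial.eval x u = 0) →
    ∀ q ∈ MvPolynomial.restrictDegree (Fin 2) ℝ 1,
      (∀ x ∈ τ.1.vertices, MvPolynomial.eval x q = MvPolynomial.eval x u) →
      √(τ.1.integral (M.kTilde κ χ τ * (u - q) ^ 2)) +
          M.h * √(κ τ * τ.1.integral (gradDot (u - q) (u - q))) ≤
        CI * M.h * √(κ τ * τ.1.integral (gradDot u u))

/-- The bubble function of a coarse block: the product of the multiscale basis functions of its
vertices. -/
def bubble (χ : Pt → M.Fun) (τ : M.fine) : Poly := ∏ z ∈ (M.parent τ).1.vertices, χ z τ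

open Classical in
/-- `∫_K κ̃ B μ² dx`. -/
def sBubble (κ : M.fine → ℝ) (χ : Pt → M.Fun) (K : M.coarse) (μ : M.Fun) : ℝ :=
  ∑ τ : M.fine,
    if M.parent τ = K then τ.1.integral (M.kTilde κ χ τ * M.bubble χ τ * μ τ ^ 2) else 0

/-- `Cπ = sup_{K, μ} (∫_K κ̃ μ²) / (∫_K κ̃ B μ²)`, as a finite number: the least constant with
`∫_K κ̃ μ² ≤ Cπ ∫_K κ̃ B μ²` for all coarse blocks `K` and all `μ ∈ V_aux`. -/
def IsBubbleConst (κ : M.fine → ℝ) (χ : Pt → M.Fun) (φ : M.coarse → ℕ → M.Fun)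
    (L : M.coarse → ℕ) (Cπ : ℝ) : Prop :=
  IsLeast {C : ℝ | ∀ K : M.coarse, ∀ μ ∈ M.Vaux φ L,
    M.sLoc κ χ K μ μ ≤ C * M.sBubble κ χ K μ} Cπ

/-- The smallness criterion on the fine mesh size:
`Cπ CI (C_T² + λ_max) ‖Θ‖_{L^∞(Ω)}^{1/2} h < 1`. -/
def FineSmall (χ : Pt → M.Fun) (lam : M.coarse → ℕ → ℝ) (L : M.coarse → ℕ)
    (CI Cπ : ℝ) : Prop :=
  Cπ * CI * (M.CT ^ 2 + M.lamMax lam L) * √(M.ΘSup χ Set.univ) * M.h < 1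

/-- The constant `D` (for the coarse block `i`), which is taken to be at least `C0² (1 + CI²)`. -/
def D (χ : Pt → M.Fun) (lam : M.coarse → ℕ → ℝ) (L : M.coarse → ℕ)
    (C0 CI Cπ : ℝ) (i : M.coarse) : ℝ :=
  max ((2 * Cπ * (1 + CI ^ 2) * (M.CT ^ 2 + M.lamMax lam L) /
      (1 - Cπ * CI * (M.CT ^ 2 + M.lamMax lam L) * √(M.ΘSup χ {i}) * M.h)) ^ 2)
    (C0 ^ 2 * (1 + CI ^ 2))

end Mesh

/-- `E = 40 D³ (1 + Λ⁻¹) (1 + 6 D⁻² (1 + Λ^{-1/2})⁻¹)^{1-m}`. -/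
def E (D Λ : ℝ) (m : ℕ) : ℝ :=
  40 * D ^ 3 * (1 + Λ⁻¹) * (1 + 6 * (D ^ 2)⁻¹ * (1 + (√Λ)⁻¹)⁻¹) ^ (1 - (m : ℤ))

end

end CEM

/-! Let `W` (`auxOrtho`) be the space of functions in `Vh` that are `s`-orthogonal to all
eigenfunctions in use. The minimizer ψ is `aDG`-orthogonal to `W` (`IsCEMBasis.orthogonal`). Choose
a function v supported in the single block `i` that satisfies the same constraints. Then u = v - ψ
lies in `W` and is the energy projection of v onto `W`. If x ∈ `W` is supported in the oversampled
domain, v - x is a competitor for ψms. By Pythagoras the error is therefore at most ‖u - x‖_a², and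
it remains to approximate the projection of a local function by local functions.

This is done by an additive Schwarz iteration. Cover the mesh by node patches, let W_z be the part
of `W` supported in the patch of the node z, and let T be the sum of the local projections onto the
W_z, with the DG form as local form. If every w ∈ `W` splits into pieces in W_z with total DG energy
at most C ‖w‖_a², and sums of pieces satisfy the converse bound with constant N, then T is
self-adjoint for `aDG` with spectrum in [1/C, N]. Each application of T enlarges supports by two
layers. A polynomial p with p(0) = 1 and degree at most m/2 thus gives an admissible x = u - p(T)u,
and the Chebyshev choice of p gives the exponential rate (`exists_small_polynomial`,
`exists_localized_approximation`).

The converse bound is a count of overlaps (`normDGsq_overlap_le`). The stable splitting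
(`exists_decomposition`) starts from the interpolants I_h(χ_z w), which add up to w because the χ_z
are a partition of unity. The energy cost of the cut-off is `s`(w,w), which the spectral gap bounds
on `W` by Λ⁻¹ times the energy. These pieces leave `W`, so a linear corrector c (`exists_corrector`)
is subtracted from each. It has the form c v = I_h(B μ), with B the bubble function and μ ∈ `Vaux`
fixed by the moments of v. It creates no jumps, does not enlarge supports, and vanishes on `W`, so
the corrected pieces still add up to w. Its existence and bound rest on the coercivity of μ ↦
`s`(I_h(B μ), μ) on `Vaux` (`sLoc_le_sLoc_Ih_bubble_mul`): the finite bubble constant gives it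
without I_h, and the smallness of `h` absorbs the interpolation error. The same corrector applied to
the eigenfunction supplies v. -/

namespace CEM

/-! ### Localized approximation by additive Schwarz and Chebyshev polynomials. -/

/-- A form that is nondegenerate on a finite-dimensional subspace `U` represents the functionals
`a x` on `U`, linearly in `x`. -/
lemma exists_linear_representative {V X : Type*} [AddCommGroup V] [Module ℝ V]
    [AddCommGroup X] [Module ℝ X] (U : Submodule ℝ V) [FiniteDimensional ℝ U]
    (b : V →ₗ[ℝ] V →ₗ[ℝ] ℝ) (hb : ∀ x ∈ U, (∀ y ∈ U, b x y = 0) → x = 0)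
    (a : X →ₗ[ℝ] V →ₗ[ℝ] ℝ) :
    ∃ P : X →ₗ[ℝ] V, (∀ x, P x ∈ U) ∧ ∀ x, ∀ y ∈ U, b (P x) y = a x y := by
  let F : U →ₗ[ℝ] Module.Dual ℝ U := (b.compl₁₂ U.subtype U.subtype)
  have hF : Function.Injective F := by
    rw [← LinearMap.ker_eq_bot, LinearMap.ker_eq_bot']
    intro x hx
    refine Subtype.ext (hb x x.2 fun y hy => ?_)
    simpa [F] using LinearMap.congr_fun hx ⟨y, hy⟩
  let e : U ≃ₗ[ℝ] Module.Dual ℝ U :=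
    LinearEquiv.ofInjectiveOfFinrankEq F hF Subspace.dual_finrank_eq.symm
  have he : ∀ x y : U, e x y = b x y := fun x y => rfl
  refine ⟨U.subtype ∘ₗ e.symm.toLinearMap ∘ₗ (a.compl₁₂ LinearMap.id U.subtype),
    fun x => (e.symm _).2, fun x y hy => ?_⟩
  have := he (e.symm ((a.compl₁₂ LinearMap.id U.subtype) x)) ⟨y, hy⟩
  rw [LinearEquiv.apply_symm_apply] at this
  simpa using this.symm

lemma form_cauchySchwarz {V : Type*} [AddCommGroup V] [Module ℝ V]
    (a : V →ₗ[ℝ] V →ₗ[ℝ] ℝ) (hs : ∀ x y, a x y = a y x) (hp : ∀ x, 0 ≤ a x x) (x y : V) :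
    a x y ^ 2 ≤ a x x * a y y := by
  have := LinearMap.BilinForm.apply_mul_apply_le_of_forall_zero_le a hp x y
  rw [hs y x] at this
  nlinarith

/-- The spectral theorem for the inner product `a`; the inner product structure is built from the
form inside the proof, because the ambient space carries none. -/
lemma exists_eigenbasis {V : Type*} [AddCommGroup V] [Module ℝ V] [FiniteDimensional ℝ V]
    (a : V →ₗ[ℝ] V →ₗ[ℝ] ℝ) (hs : ∀ x y, a x y = a y x) (hp : ∀ x, x ≠ 0 → 0 < a x x)
    (T : V →ₗ[ℝ] V) (hT : ∀ x y, a (T x) y = a x (T y)) :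
    ∃ (n : ℕ) (b : Module.Basis (Fin n) ℝ V) (μ : Fin n → ℝ),
      (∀ i j, a (b i) (b j) = if i = j then 1 else 0) ∧ ∀ i, T (b i) = μ i • b i := by
  let core : InnerProductSpace.Core ℝ V :=
    { inner := fun x y => a x y
      conj_inner_symm := fun x y => by simpa using hs y x
      re_inner_nonneg := fun x => by
        rcases eq_or_ne x 0 with rfl | h
        · simp
        · simpa using (hp x h).le
      add_left := fun x y z => by simp
      smul_left := fun x y r => by simp
      definite := fun x hx => by
        by_contra h
        exact (hp x h).ne' hx }
  let _ : NormedAddCommGroup V := core.toNormedAddCommGroup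
  let _ : InnerProductSpace ℝ V := InnerProductSpace.ofCore core.toCore
  have hsym : T.IsSymmetric := fun x y => hT x y
  refine ⟨_, (hsym.eigenvectorBasis rfl).toBasis, hsym.eigenvalues rfl, fun i j => ?_,
    fun i => ?_⟩
  · have := orthonormal_iff_ite.1 (hsym.eigenvectorBasis rfl).orthonormal i j
    rw [OrthonormalBasis.coe_toBasis]
    exact this
  · simp [hsym.apply_eigenvectorBasis rfl i]

open Polynomial in
/-- Chebyshev polynomials, normalized at the origin, are small on an interval away from it. -/
lemma exists_small_polynomial {c N y : ℝ} (hc : 0 < c) (hN : c ≤ N) (hy : 1 < y)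
    (h : N * (y - 1) ^ 2 ≤ c * (y + 1) ^ 2) (n : ℕ) :
    ∃ p : ℝ[X], p.natDegree ≤ n ∧ p.eval 0 = 1 ∧
      ∀ t ∈ Set.Icc c N, p.eval t ^ 2 ≤ 4 * (y ^ (2 * n))⁻¹ := by
  have hN0 : 0 < N := hc.trans_le hN
  have hy0 : 0 < y := by linarith
  -- With x0 = cosh(log y), the n-th Chebyshev polynomial takes the value cosh(n log y) ≥ yⁿ/2 at
  -- x0.
  set x0 : ℝ := (y + y⁻¹) / 2 with hx0
  have hx1 : x0 - 1 = (y - 1) ^ 2 / (2 * y) := by rw [hx0]; field_simp; ring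
  have hx2 : x0 + 1 = (y + 1) ^ 2 / (2 * y) := by rw [hx0]; field_simp; ring
  have hcosh : x0 = Real.cosh (Real.log y) := by
    rw [Real.cosh_eq, Real.exp_neg, Real.exp_log hy0]
  -- This affine map sends 0 to x0 and N to -1. The hypothesis on y says exactly that it sends c to
  -- at most 1, so [c, N] is mapped into [-1, 1].
  set q : ℝ[X] := C x0 - C ((x0 + 1) / N) * X with hq
  set t0 : ℝ := (Chebyshev.T ℝ (n : ℤ)).eval x0 with ht0
  have ht : y ^ n / 2 ≤ t0 := by
    rw [ht0, hcosh, Chebyshev.T_real_cosh, Real.cosh_eq]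
    have : Real.exp ((n : ℤ) * Real.log y) = y ^ n := by
      rw [Int.cast_natCast, ← Real.log_pow, Real.exp_log (by positivity)]
    rw [this]
    have := Real.exp_pos (-((n : ℤ) * Real.log y))
    linarith
  have hyn : 0 < y ^ n := by positivity
  have ht0p : 0 < t0 := by linarith
  refine ⟨C t0⁻¹ * (Chebyshev.T ℝ (n : ℤ)).comp q, ?_, ?_, ?_⟩
  · refine (natDegree_C_mul_le _ _).trans (natDegree_comp_le.trans ?_)
    rw [Chebyshev.natDegree_T]
    have : q.natDegree ≤ 1 := by
      rw [hq]; compute_degree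
    simpa using Nat.mul_le_mul_left n this
  · simp [hq, ← ht0, ht0p.ne']
  · intro t ⟨hct, htN⟩
    have habs : |q.eval t| ≤ 1 := by
      have he : q.eval t = x0 - (x0 + 1) / N * t := by simp [hq]
      have hxp : 0 ≤ (x0 + 1) / N := by rw [hx2]; positivity
      have hup : (x0 + 1) / N * t ≤ x0 + 1 := by
        calc (x0 + 1) / N * t ≤ (x0 + 1) / N * N := by gcongr
          _ = x0 + 1 := by field_simp
      have hlo : x0 - 1 ≤ (x0 + 1) / N * t := by
        calc x0 - 1 ≤ (x0 + 1) / N * c := by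
              rw [hx1, hx2, div_div, div_mul_eq_mul_div, div_le_div_iff₀ (by positivity)
                (by positivity)]
              nlinarith
          _ ≤ _ := by gcongr
      rw [he, abs_le]; constructor <;> linarith
    have hT := Chebyshev.abs_eval_T_real_le_one (n : ℤ) habs
    rw [eval_mul, eval_C, eval_comp, mul_pow]
    have h1 : ((Chebyshev.T ℝ (n : ℤ)).eval (q.eval t)) ^ 2 ≤ 1 := by
      rw [← sq_abs]; exact pow_le_one₀ (abs_nonneg _) hT
    have h2 : (t0⁻¹) ^ 2 ≤ 4 * (y ^ (2 * n))⁻¹ := by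
      rw [inv_pow, pow_mul', ← inv_inv (4 : ℝ), ← mul_inv]
      refine inv_anti₀ (by positivity) ?_
      nlinarith
    calc _ ≤ (t0⁻¹) ^ 2 * 1 := by gcongr
      _ ≤ _ := by rwa [mul_one]

open Polynomial in
-- In an eigenbasis of `T`, `p(T)` multiplies each coefficient by the value of `p` at an eigenvalue,
-- and the form bounds place all eigenvalues in [c, N].
lemma aeval_energy_le {V : Type*} [AddCommGroup V] [Module ℝ V] [FiniteDimensional ℝ V]
    (a : V →ₗ[ℝ] V →ₗ[ℝ] ℝ) (hs : ∀ x y, a x y = a y x) (hp : ∀ x, x ≠ 0 → 0 < a x x)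
    (T : V →ₗ[ℝ] V) (hT : ∀ x y, a (T x) y = a x (T y)) {c N : ℝ}
    (hc : ∀ x, c * a x x ≤ a (T x) x) (hN : ∀ x, a (T x) x ≤ N * a x x)
    (p : ℝ[X]) {δ : ℝ} (hpδ : ∀ t ∈ Set.Icc c N, p.eval t ^ 2 ≤ δ) (u : V) :
    a (aeval T p u) (aeval T p u) ≤ δ * a u u := by
  obtain ⟨n, b, μ, hb, hμ⟩ := exists_eigenbasis a hs hp T hT
  have hmem : ∀ i, μ i ∈ Set.Icc c N := fun i => by
    have h1 := hc (b i)
    have h2 := hN (b i)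
    simp only [hμ, map_smul, LinearMap.smul_apply, hb, if_true, smul_eq_mul, mul_one] at h1 h2
    exact ⟨h1, h2⟩
  have hpb : ∀ i, aeval T p (b i) = p.eval (μ i) • b i := fun i =>
    Module.End.aeval_apply_of_hasEigenvector
      ⟨Module.End.mem_eigenspace_iff.2 (hμ i), b.ne_zero i⟩
  have hexp : ∀ f : Fin n → ℝ, a (∑ i, f i • b i) (∑ i, f i • b i) = ∑ i, f i ^ 2 := fun f => by
    simp [hb, sq]
  have hu : u = ∑ i, b.repr u i • b i := (b.sum_repr u).symm
  have hTu : aeval T p u = ∑ i, (b.repr u i * p.eval (μ i)) • b i := by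
    conv_lhs => rw [hu, map_sum]
    exact Finset.sum_congr rfl fun i _ => by rw [map_smul, hpb, smul_smul]
  rw [hTu, hexp]
  conv_rhs => rw [hu, hexp, Finset.mul_sum]
  refine Finset.sum_le_sum fun i _ => ?_
  rw [mul_pow, mul_comm]
  gcongr
  exact hpδ _ (hmem i)

open Polynomial in
/-- Localized approximation by the additive Schwarz method with Chebyshev acceleration: `a` is the
energy form, `d` the form of the local problems in the subspaces `Wz`, `X` an increasing family of
supports that grows by one step in each iteration. -/
theorem exists_localized_approximation {V ι : Type*} [AddCommGroup V] [Module ℝ V]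
    [FiniteDimensional ℝ V] [Fintype ι]
    (a d : V →ₗ[ℝ] V →ₗ[ℝ] ℝ) (has : ∀ x y, a x y = a y x) (hap : ∀ x, x ≠ 0 → 0 < a x x)
    (hds : ∀ x y, d x y = d y x) (hdp : ∀ x, x ≠ 0 → 0 < d x x)
    (Wz : ι → Submodule ℝ V) {C N y : ℝ} (hC : 0 < C) (hy : 1 < y)
    (hdec : ∀ w, ∃ f : ι → V, (∀ z, f z ∈ Wz z) ∧ ∑ z, f z = w ∧
      ∑ z, d (f z) (f z) ≤ C * a w w)
    (hover : ∀ f : ι → V, (∀ z, f z ∈ Wz z) →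
      a (∑ z, f z) (∑ z, f z) ≤ N * ∑ z, d (f z) (f z))
    (hCN : C * N * (y - 1) ^ 2 ≤ (y + 1) ^ 2)
    (X : ℕ → Submodule ℝ V) (hX : Monotone X)
    (hstep : ∀ k, ∀ x ∈ X k, ∀ z, (∀ v ∈ Wz z, a x v = 0) ∨ Wz z ≤ X (k + 1))
    (u : V) (hu : ∀ z, (∀ v ∈ Wz z, a u v = 0) ∨ Wz z ≤ X 1) (n : ℕ) :
    ∃ x ∈ X n, a (u - x) (u - x) ≤ 4 * (y ^ (2 * n))⁻¹ * a u u := by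
  rcases eq_or_ne u 0 with rfl | hu0
  · exact ⟨0, zero_mem _, by simp⟩
  have hap' : ∀ x, 0 ≤ a x x := fun x => by
    rcases eq_or_ne x 0 with rfl | h
    · simp
    · exact (hap x h).le
  have hdp' : ∀ x, 0 ≤ d x x := fun x => by
    rcases eq_or_ne x 0 with rfl | h
    · simp
    · exact (hdp x h).le
  have hP : ∀ z, ∃ P : V →ₗ[ℝ] V, (∀ x, P x ∈ Wz z) ∧ ∀ x, ∀ v ∈ Wz z, d (P x) v = a x v :=
    fun z => exists_linear_representative (Wz z) d (fun x hx h => by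
      by_contra hne
      exact (hdp x hne).ne' (h x hx)) a
  choose P hPmem hPd using hP
  -- The additive Schwarz operator. The identity `hTa` shows at once that it is symmetric and
  -- nonnegative for `a`.
  set T : V →ₗ[ℝ] V := ∑ z, P z with hTdef
  have hTa : ∀ x v, a (T x) v = ∑ z, d (P z x) (P z v) := fun x v => by
    rw [hTdef, LinearMap.sum_apply, map_sum, LinearMap.sum_apply]
    refine Finset.sum_congr rfl fun z _ => ?_
    rw [has, ← hPd z v _ (hPmem z x), hds]
  have hT : ∀ x v, a (T x) v = a x (T v) := fun x v => by
    rw [hTa, has x, hTa]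
    exact Finset.sum_congr rfl fun z _ => hds _ _
  have hTN : ∀ x, a (T x) (T x) ≤ N * a (T x) x := fun x => by
    rw [hTa x x]
    have := hover (fun z => P z x) (fun z => hPmem z x)
    simpa [hTdef, LinearMap.sum_apply] using this
  have hlow : ∀ x, C⁻¹ * a x x ≤ a (T x) x := fun x => by
    rcases eq_or_ne x 0 with rfl | hx0
    · simp
    obtain ⟨f, hf, hfs, hfd⟩ := hdec x
    have h1 : a x x = ∑ z, d (P z x) (f z) := by
      have : a x x = a x (∑ z, f z) := by rw [hfs]
      rw [this, map_sum]
      exact Finset.sum_congr rfl fun z _ => (hPd z x _ (hf z)).symm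
    -- Cauchy–Schwarz for the local forms; with the energy bound of the decomposition, one factor `a
    -- x x` cancels and the lower spectral bound 1/C remains.
    have h2 : a x x ^ 2 ≤ (∑ z, d (P z x) (P z x)) * ∑ z, d (f z) (f z) := by
      rw [h1]
      refine Finset.sum_sq_le_sum_mul_sum_of_sq_le_mul _ (fun z _ => hdp' _) (fun z _ => hdp' _)
        fun z _ => form_cauchySchwarz d hds hdp' _ _
    rw [← hTa] at h2
    have hTnn : 0 ≤ a (T x) x := by rw [hTa]; exact Finset.sum_nonneg fun z _ => hdp' _
    have hpos := hap x hx0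
    rw [inv_mul_le_iff₀ hC]
    have : a x x * a x x ≤ (C * a (T x) x) * a x x := by nlinarith
    exact le_of_mul_le_mul_right this hpos
  have hup : ∀ x, a (T x) x ≤ N * a x x := fun x => by
    have h1 := form_cauchySchwarz a has hap' (T x) x
    have h2 := hTN x
    have hTnn : 0 ≤ a (T x) x := by rw [hTa]; exact Finset.sum_nonneg fun z _ => hdp' _
    rcases hTnn.eq_or_lt with h0 | h0
    · have h3 := hlow x
      rw [← h0] at h3
      have : a x x = 0 := le_antisymm (by
        by_contra hh
        push Not at hh
        have := mul_pos (inv_pos.2 hC) hh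
        linarith) (hap' x)
      rw [← h0, this, mul_zero]
    · have : a (T x) x * a (T x) x ≤ (N * a x x) * a (T x) x := by
        nlinarith [hap' x]
      exact le_of_mul_le_mul_right this h0
  have hCN1 : C⁻¹ ≤ N := by
    have := (hlow u).trans (hup u)
    exact le_of_mul_le_mul_right this (hap u hu0)
  obtain ⟨p, hpdeg, hp0, hpsmall⟩ := exists_small_polynomial (inv_pos.2 hC) hCN1 hy (by
    rw [← mul_le_mul_iff_right₀ hC]
    calc C * (N * (y - 1) ^ 2) = C * N * (y - 1) ^ 2 := by ring
      _ ≤ (y + 1) ^ 2 := hCN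
      _ = _ := by field_simp) n
  -- A local projection vanishes as soon as its argument is `a`-orthogonal to the local space, so
  -- only subspaces contained in the next member of the family contribute.
  have hTX : ∀ k, ∀ x ∈ X k, T x ∈ X (k + 1) := fun k x hx => by
    rw [hTdef, LinearMap.sum_apply]
    refine Submodule.sum_mem _ fun z _ => ?_
    rcases hstep k x hx z with h | h
    · have : P z x = 0 := by
        by_contra hne
        exact (hdp _ hne).ne' ((hPd z x _ (hPmem z x)).trans (h _ (hPmem z x)))
      rw [this]; exact zero_mem _
    · exact h (hPmem z x)
  have hTu : T u ∈ X 1 := by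
    rw [hTdef, LinearMap.sum_apply]
    refine Submodule.sum_mem _ fun z _ => ?_
    rcases hu z with h | h
    · have : P z u = 0 := by
        by_contra hne
        exact (hdp _ hne).ne' ((hPd z u _ (hPmem z u)).trans (h _ (hPmem z u)))
      rw [this]; exact zero_mem _
    · exact h (hPmem z u)
  have hpow : ∀ k, (T ^ (k + 1)) u ∈ X (k + 1) := fun k => by
    induction k with
    | zero => simpa using hTu
    | succ k ih =>
      rw [pow_succ', Module.End.mul_apply]
      exact hTX _ _ ih
  -- Since p(0) = 1, the nonlocal term u cancels and only multiples of T^k u with 1 ≤ k ≤ n remain.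
  refine ⟨u - aeval T p u, ?_, ?_⟩
  · have hsum : aeval T p u = ∑ k ∈ Finset.range (n + 1), p.coeff k • (T ^ k) u := by
      rw [aeval_eq_sum_range' (Nat.lt_succ_of_le hpdeg), LinearMap.sum_apply]
      rfl
    rw [hsum, Finset.sum_range_succ']
    have : p.coeff 0 = 1 := by rw [coeff_zero_eq_eval_zero, hp0]
    rw [this, pow_zero, one_smul, Module.End.one_apply, sub_add_cancel_right, ← Finset.sum_neg_distrib]
    refine Submodule.sum_mem _ fun k hk => Submodule.neg_mem _ (Submodule.smul_mem _ _ ?_)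
    exact hX (Finset.mem_range.1 hk) (hpow k)
  · rw [sub_sub_cancel]
    exact aeval_energy_le a has hap T hT hlow hup p hpsmall u

end CEM

namespace CEM

/-! ### Inequalities for polynomials in one variable. -/

section OneDim

open Polynomial

lemma poly_intervalIntegrable (q : ℝ[X]) (a b : ℝ) :
    IntervalIntegrable (fun x => q.eval x) volume a b :=
  q.continuous.intervalIntegrable a b

/-- Cauchy–Schwarz for the integral of the derivative, read off from the nonnegative integral of (q'
- m)², where m is the mean slope. -/
lemma sq_sub_eval_le (q : ℝ[X]) {a x : ℝ} (hax : a ≤ x) :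
    (q.eval x - q.eval a) ^ 2 ≤ (x - a) * ∫ t in a..x, (q.derivative.eval t) ^ 2 := by
  rcases hax.eq_or_lt with rfl | h
  · simp
  set m := (q.eval x - q.eval a) / (x - a) with hm
  have hxa : 0 < x - a := sub_pos.2 h
  have hma : m * (x - a) = q.eval x - q.eval a := by rw [hm]; field_simp
  have hftc : ∫ t in a..x, q.derivative.eval t = q.eval x - q.eval a :=
    intervalIntegral.integral_eq_sub_of_hasDerivAt (fun t _ => q.hasDerivAt t)
      (poly_intervalIntegrable _ _ _)
  have h0 : 0 ≤ ∫ t in a..x, (q.derivative.eval t - m) ^ 2 :=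
    intervalIntegral.integral_nonneg hax fun t _ => sq_nonneg _
  have h1 : ∫ t in a..x, (q.derivative.eval t - m) ^ 2 =
      (∫ t in a..x, (q.derivative.eval t) ^ 2) - 2 * m * (q.eval x - q.eval a) +
        m ^ 2 * (x - a) := by
    rw [← hftc, ← intervalIntegral.integral_const_mul]
    have : m ^ 2 * (x - a) = ∫ t in a..x, m ^ 2 := by simp [mul_comm]
    rw [this, ← intervalIntegral.integral_sub, ← intervalIntegral.integral_add]
    · exact intervalIntegral.integral_congr fun t _ => by ring
    · exact Continuous.intervalIntegrable (by fun_prop) _ _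
    · exact Continuous.intervalIntegrable (by fun_prop) _ _
    · exact Continuous.intervalIntegrable (by fun_prop) _ _
    · exact Continuous.intervalIntegrable (by fun_prop) _ _
  rw [h1] at h0
  nlinarith

lemma integral_sq_sub_eval_le (q : ℝ[X]) {a b : ℝ} (hab : a ≤ b) :
    ∫ t in a..b, (q.eval t - q.eval a) ^ 2 ≤
      (b - a) ^ 2 / 2 * ∫ t in a..b, (q.derivative.eval t) ^ 2 := by
  set S := ∫ t in a..b, (q.derivative.eval t) ^ 2 with hS
  have h : ∀ x ∈ Set.Icc a b, (q.eval x - q.eval a) ^ 2 ≤ (x - a) * S := fun x hx => by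
    refine (sq_sub_eval_le q hx.1).trans ?_
    refine mul_le_mul_of_nonneg_left ?_ (sub_nonneg.2 hx.1)
    refine intervalIntegral.integral_mono_interval le_rfl hx.1 hx.2
      (Filter.Eventually.of_forall fun t => sq_nonneg _) ?_
    exact Continuous.intervalIntegrable (by fun_prop) _ _
  have h2 := intervalIntegral.integral_mono_on hab
    (Continuous.intervalIntegrable (by fun_prop) _ _)
    (Continuous.intervalIntegrable (by fun_prop) _ _) h (μ := volume)
  refine h2.trans (le_of_eq ?_)
  rw [intervalIntegral.integral_mul_const]
  congr 1
  rw [intervalIntegral.integral_sub (Continuous.intervalIntegrable (by fun_prop) _ _)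
    (Continuous.intervalIntegrable (by fun_prop) _ _)]
  simp
  ring

/-- The representer of point evaluation at `0` in the polynomials of degree at most `5` in
`L²(0,1)`. -/
def traceKernel (k : Fin 6) : ℝ := ![36, -630, 3360, -7560, 7560, -2772] k

lemma integral_mul_traceKernel (j : Fin 6) :
    ∫ t in (0:ℝ)..1, t ^ (j : ℕ) * ∑ k : Fin 6, traceKernel k * t ^ (k : ℕ) =
      if j = 0 then 1 else 0 := by
  have : ∀ t : ℝ, t ^ (j : ℕ) * ∑ k : Fin 6, traceKernel k * t ^ (k : ℕ) =
      ∑ k : Fin 6, traceKernel k * t ^ ((j : ℕ) + k) := fun t => by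
    rw [Finset.mul_sum]
    exact Finset.sum_congr rfl fun k _ => by ring
  simp_rw [this]
  rw [intervalIntegral.integral_finsetSum
    (fun k _ => Continuous.intervalIntegrable (by fun_prop) _ _)]
  simp_rw [intervalIntegral.integral_const_mul, integral_pow]
  have h2 : traceKernel 2 = 3360 := rfl
  have h3 : traceKernel 3 = -7560 := rfl
  have h4 : traceKernel 4 = 7560 := rfl
  have h5 : traceKernel 5 = -2772 := rfl
  rw [Fin.sum_univ_six, h2, h3, h4, h5]
  fin_cases j <;> norm_num [traceKernel]

lemma integral_sum_mul_traceKernel (c : Fin 6 → ℝ) :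
    ∫ t in (0:ℝ)..1, (∑ j : Fin 6, c j * t ^ (j : ℕ)) *
      ∑ k : Fin 6, traceKernel k * t ^ (k : ℕ) = c 0 := by
  simp_rw [Finset.sum_mul _ _ (∑ k : Fin 6, traceKernel k * _ ^ (k : ℕ)), mul_assoc]
  rw [intervalIntegral.integral_finsetSum
    (fun k _ => Continuous.intervalIntegrable (by fun_prop) _ _)]
  simp_rw [intervalIntegral.integral_const_mul, integral_mul_traceKernel]
  simp

/-- Cauchy–Schwarz against the representer g of evaluation at 0. As g also has degree 5, ∫ g² = g(0)
= 36 = (5 + 1)². -/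
lemma sq_eval_zero_le {q : ℝ[X]} (hq : q.natDegree ≤ 5) :
    q.eval 0 ^ 2 ≤ 36 * ∫ t in (0:ℝ)..1, q.eval t ^ 2 := by
  have hev : ∀ t, q.eval t = ∑ j : Fin 6, q.coeff j * t ^ (j : ℕ) := fun t => by
    rw [eval_eq_sum_range' (Nat.lt_succ_of_le hq), Finset.sum_range]
  set g : ℝ → ℝ := fun t => ∑ k : Fin 6, traceKernel k * t ^ (k : ℕ) with hg
  have hgc : Continuous g := by rw [hg]; fun_prop
  have h1 : ∫ t in (0:ℝ)..1, q.eval t * g t = q.eval 0 := by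
    rw [← coeff_zero_eq_eval_zero]
    simp_rw [hev]
    exact integral_sum_mul_traceKernel _
  have h2 : ∫ t in (0:ℝ)..1, g t * g t = 36 := integral_sum_mul_traceKernel _
  have h0 : 0 ≤ ∫ t in (0:ℝ)..1, (q.eval t - q.eval 0 / 36 * g t) ^ 2 :=
    intervalIntegral.integral_nonneg zero_le_one fun t _ => sq_nonneg _
  have h3 : ∫ t in (0:ℝ)..1, (q.eval t - q.eval 0 / 36 * g t) ^ 2 =
      (∫ t in (0:ℝ)..1, q.eval t ^ 2) - 2 * (q.eval 0 / 36) * (∫ t in (0:ℝ)..1, q.eval t * g t) +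
        (q.eval 0 / 36) ^ 2 * ∫ t in (0:ℝ)..1, g t * g t := by
    rw [← intervalIntegral.integral_const_mul, ← intervalIntegral.integral_const_mul,
      ← intervalIntegral.integral_sub, ← intervalIntegral.integral_add]
    · exact intervalIntegral.integral_congr fun t _ => by ring
    all_goals exact Continuous.intervalIntegrable (by fun_prop) _ _
  rw [h3, h1, h2] at h0
  nlinarith

lemma sq_eval_left_le {q : ℝ[X]} (hq : q.natDegree ≤ 5) {a b : ℝ} (hab : a < b) :
    (b - a) * q.eval a ^ 2 ≤ 36 * ∫ t in a..b, q.eval t ^ 2 := by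
  have hd : (q.comp (C (b - a) * X + C a)).natDegree ≤ 5 := by
    refine natDegree_comp_le.trans ?_
    have : (C (b - a) * X + C a).natDegree ≤ 1 := by compute_degree
    calc q.natDegree * _ ≤ 5 * 1 := Nat.mul_le_mul hq this
      _ = 5 := rfl
  have h := sq_eval_zero_le hd
  simp only [eval_comp, eval_add, eval_mul, eval_C, eval_X, mul_zero, zero_add] at h
  have hc := intervalIntegral.integral_comp_mul_add (a := 0) (b := 1) (fun t => q.eval t ^ 2)
    (sub_pos.2 hab).ne' a
  simp only [mul_zero, zero_add, mul_one, sub_add_cancel, smul_eq_mul] at hc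
  rw [hc] at h
  have hba : 0 < b - a := sub_pos.2 hab
  calc (b - a) * q.eval a ^ 2 ≤ (b - a) * (36 * ((b - a)⁻¹ * ∫ t in a..b, q.eval t ^ 2)) := by
        gcongr
    _ = _ := by field_simp

lemma integral_linear_sq {a b : ℝ} (hab : a < b) (A B : ℝ) :
    ∫ t in a..b, (((b - t) * A + (t - a) * B) / (b - a)) ^ 2 =
      (b - a) / 3 * (A ^ 2 + A * B + B ^ 2) := by
  have hba : b - a ≠ 0 := (sub_pos.2 hab).ne'
  have hc := intervalIntegral.integral_comp_mul_add (a := 0) (b := 1)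
    (fun t => (((b - t) * A + (t - a) * B) / (b - a)) ^ 2) hba a
  simp only [mul_zero, zero_add, mul_one, sub_add_cancel, smul_eq_mul] at hc
  have h2 : ∀ x : ℝ, (((b - ((b - a) * x + a)) * A + ((b - a) * x + a - a) * B) / (b - a)) ^ 2 =
      A ^ 2 + (2 * A * (B - A)) * x + (B - A) ^ 2 * x ^ 2 := fun x => by
    field_simp; ring
  simp_rw [h2] at hc
  rw [intervalIntegral.integral_add (Continuous.intervalIntegrable (by fun_prop) _ _)
    (Continuous.intervalIntegrable (by fun_prop) _ _),
    intervalIntegral.integral_add (Continuous.intervalIntegrable (by fun_prop) _ _)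
    (Continuous.intervalIntegrable (by fun_prop) _ _)] at hc
  simp only [intervalIntegral.integral_const_mul, integral_pow, intervalIntegral.integral_const] at hc
  have : (b - a) * ((b - a)⁻¹ * ∫ t in a..b, (((b - t) * A + (t - a) * B) / (b - a)) ^ 2) =
      ∫ t in a..b, (((b - t) * A + (t - a) * B) / (b - a)) ^ 2 :=
    mul_inv_cancel_left₀ hba _
  rw [← this, ← hc]
  have hlin : ∫ x in (0:ℝ)..1, 2 * A * (B - A) * x = A * (B - A) := by
    rw [intervalIntegral.integral_const_mul (2 * A * (B - A)) (fun x => x), integral_id]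
    ring
  rw [hlin, smul_eq_mul]
  norm_num
  ring

end OneDim

/-! ### Restriction of bivariate polynomials to lines, and degree bounds. -/

section Slice

open MvPolynomial

/-- The restriction of a bivariate polynomial to the line on which all coordinates but the one of
index `d` are equal to `t`. -/
noncomputable def slice (d : Fin 2) (t : ℝ) : Poly →ₐ[ℝ] Polynomial ℝ :=
  MvPolynomial.aeval fun e => if e = d then Polynomial.X else Polynomial.C t

lemma eval_slice (d : Fin 2) (s t : ℝ) (p : Poly) :
    (slice d t p).eval s = MvPolynomial.eval (fun e => if e = d then s else t) p := by
  induction p using MvPolynomial.induction_on with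
  | C a => simp [slice]
  | add p q hp hq => simp [hp, hq]
  | mul_X p i hp =>
    rw [map_mul, Polynomial.eval_mul, hp, map_mul]
    congr 1
    simp only [slice, aeval_X, eval_X]
    split_ifs <;> simp

lemma derivative_slice (d : Fin 2) (t : ℝ) (p : Poly) :
    (slice d t p).derivative = slice d t (pderiv d p) := by
  induction p using MvPolynomial.induction_on with
  | C a => simp [slice]
  | add p q hp hq => simp [hp, hq]
  | mul_X p i hp =>
    rw [map_mul, Polynomial.derivative_mul, hp, pderiv_mul, map_add, map_mul, map_mul, pderiv_X]
    congr 2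
    by_cases h : i = d
    · subst h; simp [slice]
    · simp [slice, h]

lemma natDegree_slice_le {k : ℕ} {p : Poly} (hp : p ∈ restrictDegree (Fin 2) ℝ k) (d : Fin 2)
    (t : ℝ) : (slice d t p).natDegree ≤ k := by
  rw [mem_restrictDegree] at hp
  conv_lhs => rw [p.as_sum, map_sum]
  refine Polynomial.natDegree_sum_le_of_forall_le _ _ fun s hs => ?_
  have h1 : slice d t (monomial s (coeff s p)) =
      Polynomial.C (coeff s p * t ^ (s (d + 1))) * Polynomial.X ^ (s d) := by
    rw [slice, aeval_monomial, Finsupp.prod_fintype _ _ (by simp), Fin.prod_univ_two]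
    have h11 : (1 : Fin 2) + 1 = 0 := rfl
    obtain rfl | rfl : d = 0 ∨ d = 1 := by fin_cases d <;> simp
    · simp only [if_true, one_ne_zero, if_false, zero_add, Polynomial.C_mul, Polynomial.C_pow,
        Polynomial.algebraMap_eq]
      ring
    · rw [h11]
      simp [mul_assoc]
  rw [h1]
  exact (Polynomial.natDegree_C_mul_X_pow_le _ _).trans (hp s hs d)

lemma pderiv_mem_restrictDegree {k : ℕ} {p : Poly} (hp : p ∈ restrictDegree (Fin 2) ℝ k)
    (d : Fin 2) : pderiv d p ∈ restrictDegree (Fin 2) ℝ k := by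
  have hp' := hp
  rw [mem_restrictDegree] at hp
  rw [p.as_sum, map_sum]
  refine Submodule.sum_mem _ fun s hs => ?_
  rw [pderiv_monomial, mem_restrictDegree]
  intro r hr i
  have := Finset.mem_singleton.1 (support_monomial_subset hr)
  rw [this]
  exact (Finsupp.tsub_apply _ _ _).le.trans ((Nat.sub_le _ _).trans (hp s hs i))

lemma mul_mem_restrictDegree {k l : ℕ} {p q : Poly} (hp : p ∈ restrictDegree (Fin 2) ℝ k)
    (hq : q ∈ restrictDegree (Fin 2) ℝ l) : p * q ∈ restrictDegree (Fin 2) ℝ (k + l) := by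
  rw [mem_restrictDegree] at *
  intro s hs i
  obtain ⟨u, hu, v, hv, rfl⟩ := Finset.mem_add.1 (support_mul p q hs)
  exact Nat.add_le_add (hp u hu i) (hq v hv i)

lemma restrictDegree_mono {k l : ℕ} (h : k ≤ l) :
    restrictDegree (Fin 2) ℝ k ≤ restrictDegree (Fin 2) ℝ l := by
  intro p hp
  rw [mem_restrictDegree] at *
  exact fun s hs i => (hp s hs i).trans h

lemma C_mem_restrictDegree (c : ℝ) (k : ℕ) : (C c : Poly) ∈ restrictDegree (Fin 2) ℝ k := by
  rw [mem_restrictDegree]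
  intro s hs i
  rw [← monomial_zero'] at hs
  rw [Finset.mem_singleton.1 (support_monomial_subset hs)]
  simp

lemma prod_mem_restrictDegree {ι : Type*} (s : Finset ι) (f : ι → Poly)
    (hf : ∀ i ∈ s, f i ∈ restrictDegree (Fin 2) ℝ 1) :
    ∏ i ∈ s, f i ∈ restrictDegree (Fin 2) ℝ s.card := by
  classical
  induction s using Finset.induction_on with
  | empty => simpa using C_mem_restrictDegree 1 0
  | insert i s hi ih =>
    rw [Finset.prod_insert hi, Finset.card_insert_of_notMem hi, add_comm]
    exact mul_mem_restrictDegree (hf i (Finset.mem_insert_self _ _))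
      (ih fun j hj => hf j (Finset.mem_insert_of_mem hj))

end Slice

/-! ### Integration over a rectangle and a discrete Poincaré inequality. -/

namespace Rect

open MvPolynomial

variable (R : Rect)

lemma integrableOn (p : Poly) : IntegrableOn (fun x => eval x p) R.carrier :=
  (MvPolynomial.continuous_eval p).continuousOn.integrableOn_compact isCompact_Icc

/-- `∫_R p dx` as a linear functional of `p`. -/
noncomputable def integralHom : Poly →ₗ[ℝ] ℝ where
  toFun := R.integral
  map_add' p q := by
    simp only [integral, map_add]
    exact integral_add (R.integrableOn p) (R.integrableOn q)
  map_smul' c p := by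
    simp only [integral, smul_eval, RingHom.id_apply, smul_eq_mul]
    exact integral_const_mul _ _

lemma integralHom_apply (p : Poly) : R.integralHom p = R.integral p := rfl

lemma integral_add' (p q : Poly) : R.integral (p + q) = R.integral p + R.integral q :=
  R.integralHom.map_add p q

lemma integral_sum' {ι : Type*} (s : Finset ι) (f : ι → Poly) :
    R.integral (∑ i ∈ s, f i) = ∑ i ∈ s, R.integral (f i) :=
  map_sum R.integralHom f s

lemma integral_C_mul (c : ℝ) (p : Poly) : R.integral (C c * p) = c * R.integral p := by
  rw [C_mul']
  exact R.integralHom.map_smul c p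

@[simp] lemma integral_zero' : R.integral 0 = 0 := R.integralHom.map_zero

lemma integral_mono' {p q : Poly} (h : ∀ x ∈ R.carrier, eval x p ≤ eval x q) :
    R.integral p ≤ R.integral q :=
  setIntegral_mono_on (R.integrableOn p) (R.integrableOn q) measurableSet_Icc h

lemma integral_nonneg' {p : Poly} (h : ∀ x ∈ R.carrier, 0 ≤ eval x p) : 0 ≤ R.integral p := by
  have := R.integral_mono' (p := 0) (q := p) (by simpa using h)
  simpa using this

lemma lo_le_hi : R.lo ≤ R.hi := fun d => (R.lt d).le

lemma subset_closure_interior : R.carrier ⊆ closure (interior R.carrier) := by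
  have h : R.carrier = Set.pi Set.univ fun d => Set.Icc (R.lo d) (R.hi d) :=
    (Set.pi_univ_Icc _ _).symm
  have hi : interior R.carrier = Set.pi Set.univ fun d => Set.Ioo (R.lo d) (R.hi d) := by
    rw [h, interior_pi_set Set.finite_univ]
    simp
  rw [hi, closure_pi_set, h]
  exact Set.pi_mono fun d _ => by rw [closure_Ioo (R.lt d).ne]

lemma eq_zero_of_eval {p : Poly} (h : ∀ x ∈ R.carrier, eval x p = 0) : p = 0 := by
  refine MvPolynomial.funext_set (fun d => Set.Icc (R.lo d) (R.hi d))
    (fun d => Set.Icc_infinite (R.lt d)) fun x hx => ?_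
  rw [Set.pi_univ_Icc] at hx
  simpa using h x hx

lemma eq_zero_of_integral_sq {p : Poly} (h : R.integral (p ^ 2) = 0) : p = 0 := by
  refine R.eq_zero_of_eval ?_
  have h0 : (fun x => eval x (p ^ 2)) =ᵐ[volume.restrict R.carrier] 0 :=
    (setIntegral_eq_zero_iff_of_nonneg_ae (Filter.Eventually.of_forall fun x => by
      simpa using sq_nonneg (eval x p)) (R.integrableOn _)).1 h
  have h1 := MeasureTheory.Measure.eqOn_of_ae_eq h0
    (MvPolynomial.continuous_eval _).continuousOn continuousOn_const R.subset_closure_interior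
  intro x hx
  simpa using h1 hx

lemma integral_eq_iterated (p : Poly) :
    R.integral p = ∫ t in (R.lo 1)..(R.hi 1), ∫ s in (R.lo 0)..(R.hi 0),
      eval (fun e => if e = 0 then s else t) p := by
  have hmp := (volume_preserving_finTwoArrow ℝ).symm
  have hpre : (MeasurableEquiv.finTwoArrow (α := ℝ)).symm ⁻¹' R.carrier =
      Set.Icc (R.lo 0) (R.hi 0) ×ˢ Set.Icc (R.lo 1) (R.hi 1) := by
    ext ⟨s, t⟩
    simp [carrier, Pi.le_def, Fin.forall_fin_two, MeasurableEquiv.finTwoArrow]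
  have hcont : Continuous fun z : ℝ × ℝ =>
      eval (fun e : Fin 2 => if e = 0 then z.1 else z.2) p := by
    refine (MvPolynomial.continuous_eval p).comp (continuous_pi fun e => ?_)
    split_ifs <;> fun_prop
  have hfun : ∀ z : ℝ × ℝ, eval ((MeasurableEquiv.finTwoArrow (α := ℝ)).symm z) p =
      eval (fun e : Fin 2 => if e = 0 then z.1 else z.2) p := fun z => by
    congr 2
    funext e
    fin_cases e <;> simp [MeasurableEquiv.finTwoArrow]
  rw [integral, ← hmp.setIntegral_preimage_emb (MeasurableEquiv.measurableEmbedding _), hpre]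
  simp_rw [hfun]
  rw [Measure.volume_eq_prod, ← Measure.prod_restrict, integral_prod_symm]
  · rw [intervalIntegral.integral_of_le (R.lt 1).le, integral_Icc_eq_integral_Ioc]
    refine setIntegral_congr_fun measurableSet_Ioc fun t _ => ?_
    simp only
    rw [intervalIntegral.integral_of_le (R.lt 0).le, integral_Icc_eq_integral_Ioc]
  · rw [Measure.prod_restrict]
    exact hcont.continuousOn.integrableOn_compact (isCompact_Icc.prod isCompact_Icc)

lemma side_sq_le (d : Fin 2) : (R.hi d - R.lo d) ^ 2 ≤ R.diam ^ 2 := by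
  rw [diam, Real.sq_sqrt (Finset.sum_nonneg fun _ _ => sq_nonneg _)]
  exact Finset.single_le_sum (f := fun d => (R.hi d - R.lo d) ^ 2) (fun _ _ => sq_nonneg _)
    (Finset.mem_univ d)

lemma diam_pos : 0 < R.diam := by
  refine Real.sqrt_pos.2 ?_
  have := R.lt 0
  have := R.lt 1
  rw [Fin.sum_univ_two]
  have h0 : 0 < R.hi 0 - R.lo 0 := by linarith
  positivity

lemma eval_gradDot_self (x : Pt) (p : Poly) :
    eval x (gradDot p p) = eval x (pderiv 0 p) ^ 2 + eval x (pderiv 1 p) ^ 2 := by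
  simp [gradDot, Fin.sum_univ_two, sq]

/-- A discrete Poincaré inequality. -/
lemma integral_sq_le_of_eval_lo_eq_zero {e : Poly} (he : e ∈ restrictDegree (Fin 2) ℝ 5)
    (hlo : eval R.lo e = 0) :
    R.integral (e ^ 2) ≤ 37 / 2 * R.diam ^ 2 * R.integral (gradDot e e) := by
  have h0 := sub_pos.2 (R.lt 0)
  have h1 := sub_pos.2 (R.lt 1)
  set a := R.lo 0
  set b := R.hi 0
  set c := R.lo 1
  set d := R.hi 1
  have hcont : ∀ p : Poly, Continuous fun t : ℝ => ∫ s in a..b,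
      eval (fun e => if e = 0 then s else t) p := fun p => by
    refine intervalIntegral.continuous_parametric_intervalIntegral_of_continuous' ?_ a b
    refine (MvPolynomial.continuous_eval p).comp (continuous_pi fun e => ?_)
    split_ifs <;> fun_prop
  have hcs : ∀ (p : Poly) (t : ℝ),
      Continuous fun s : ℝ => eval (fun e : Fin 2 => if e = 0 then s else t) p := fun p t => by
    refine (MvPolynomial.continuous_eval p).comp (continuous_pi fun e => ?_)
    split_ifs <;> fun_prop
  have hct : ∀ (p : Poly) (s : ℝ),
      Continuous fun t : ℝ => eval (fun e : Fin 2 => if e = 0 then s else t) p := fun p t => by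
    refine (MvPolynomial.continuous_eval p).comp (continuous_pi fun e => ?_)
    split_ifs <;> fun_prop
  -- A point value is not controlled by the energy in two dimensions, so the degree bound is
  -- essential. The argument goes from the corner along the left side, where `E` is the trace, and
  -- then along horizontal lines.
  set E : ℝ → ℝ := fun t => eval (fun e : Fin 2 => if e = 0 then a else t) e with hE
  have hEc : Continuous E := hct e a
  -- lines in the direction of the first axis
  have hline : ∀ t, ∫ s in a..b, eval (fun e => if e = 0 then s else t) (e ^ 2) ≤
      37 * (b - a) ^ 2 / 2 * (∫ s in a..b, eval (fun e => if e = 0 then s else t)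
        (pderiv 0 e ^ 2)) + 37 / 36 * (b - a) * E t ^ 2 := fun t => by
    have hp := integral_sq_sub_eval_le (slice 0 t e) (R.lt 0).le
    simp only [derivative_slice, eval_slice] at hp
    have hm : ∫ s in a..b, eval (fun e => if e = 0 then s else t) (e ^ 2) ≤
        ∫ s in a..b, (37 * (eval (fun e => if e = 0 then s else t) e - E t) ^ 2 +
          37 / 36 * E t ^ 2) := by
      refine intervalIntegral.integral_mono_on (R.lt 0).le ((hcs _ _).intervalIntegrable _ _)
        (Continuous.intervalIntegrable ?_ _ _) fun s _ => ?_
      · have := hcs e t; fun_prop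
      · rw [map_pow]
        nlinarith [sq_nonneg (36 * (eval (fun e => if e = 0 then s else t) e - E t) - E t)]
    refine hm.trans ?_
    rw [intervalIntegral.integral_add, intervalIntegral.integral_const_mul]
    · simp only [intervalIntegral.integral_const, smul_eq_mul, map_pow]
      nlinarith
    · have := hcs e t; exact Continuous.intervalIntegrable (by fun_prop) _ _
    · exact Continuous.intervalIntegrable (by fun_prop) _ _
  have hE2 : ∫ t in c..d, E t ^ 2 ≤ (d - c) ^ 2 / 2 *
      ∫ t in c..d, eval (fun e : Fin 2 => if e = 0 then a else t) (pderiv 1 e) ^ 2 := by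
    have hp := integral_sq_sub_eval_le (slice 1 a e) (R.lt 1).le
    have hflip : ∀ t, (fun i : Fin 2 => if i = 1 then t else a) =
        fun i => if i = 0 then a else t := fun t => by
      funext i; fin_cases i <;> simp
    have hc0 : eval (fun i : Fin 2 => if i = 0 then a else c) e = 0 := by
      rw [← hlo]; congr 2; funext i; fin_cases i <;> rfl
    simp only [derivative_slice, eval_slice, hflip] at hp
    simpa [c, hc0] using hp
  -- The trace inequality for degree at most 5 moves the tangential derivative from the left side
  -- into the rectangle.
  have htr : ∀ t, (b - a) * eval (fun e : Fin 2 => if e = 0 then a else t) (pderiv 1 e) ^ 2 ≤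
      36 * ∫ s in a..b, eval (fun e => if e = 0 then s else t) (pderiv 1 e ^ 2) := fun t => by
    have := sq_eval_left_le (natDegree_slice_le (pderiv_mem_restrictDegree he 1) 0 t) (R.lt 0)
    simpa only [eval_slice, map_pow] using this
  have htr2 : (b - a) * ∫ t in c..d, eval (fun e : Fin 2 => if e = 0 then a else t)
      (pderiv 1 e) ^ 2 ≤ 36 * R.integral (pderiv 1 e ^ 2) := by
    rw [R.integral_eq_iterated, ← intervalIntegral.integral_const_mul,
      ← intervalIntegral.integral_const_mul]
    refine intervalIntegral.integral_mono_on (R.lt 1).le (Continuous.intervalIntegrable ?_ _ _)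
      (Continuous.intervalIntegrable ?_ _ _) fun t _ => htr t
    · have := hct (pderiv 1 e) a; fun_prop
    · have := hcont (pderiv 1 e ^ 2); fun_prop
  have hmain : R.integral (e ^ 2) ≤ 37 * (b - a) ^ 2 / 2 * R.integral (pderiv 0 e ^ 2) +
      37 / 36 * (b - a) * ∫ t in c..d, E t ^ 2 := by
    rw [R.integral_eq_iterated, R.integral_eq_iterated, ← intervalIntegral.integral_const_mul,
      ← intervalIntegral.integral_const_mul, ← intervalIntegral.integral_add]
    · refine intervalIntegral.integral_mono_on (R.lt 1).le
        ((hcont _).intervalIntegrable _ _) (Continuous.intervalIntegrable ?_ _ _)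
        fun t _ => hline t
      have := hcont (pderiv 0 e ^ 2); fun_prop
    · have := hcont (pderiv 0 e ^ 2); exact Continuous.intervalIntegrable (by fun_prop) _ _
    · exact Continuous.intervalIntegrable (by fun_prop) _ _
  have hgrad : R.integral (gradDot e e) =
      R.integral (pderiv 0 e ^ 2) + R.integral (pderiv 1 e ^ 2) := by
    rw [← R.integral_add']; congr 1; simp [gradDot, Fin.sum_univ_two, sq]
  have hn0 : 0 ≤ R.integral (pderiv 0 e ^ 2) :=
    R.integral_nonneg' fun x _ => by rw [map_pow]; exact sq_nonneg _
  have hn1 : 0 ≤ R.integral (pderiv 1 e ^ 2) :=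
    R.integral_nonneg' fun x _ => by rw [map_pow]; exact sq_nonneg _
  have hs0 : (b - a) ^ 2 ≤ R.diam ^ 2 := R.side_sq_le 0
  have hs1 : (d - c) ^ 2 ≤ R.diam ^ 2 := R.side_sq_le 1
  have hB : 37 / 36 * (b - a) * ∫ t in c..d, E t ^ 2 ≤
      37 / 2 * (d - c) ^ 2 * R.integral (pderiv 1 e ^ 2) := by
    calc 37 / 36 * (b - a) * ∫ t in c..d, E t ^ 2
        ≤ 37 / 36 * (b - a) * ((d - c) ^ 2 / 2 * ∫ t in c..d,
          eval (fun e : Fin 2 => if e = 0 then a else t) (pderiv 1 e) ^ 2) := by gcongr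
      _ = 37 / 72 * (d - c) ^ 2 * ((b - a) * ∫ t in c..d,
          eval (fun e : Fin 2 => if e = 0 then a else t) (pderiv 1 e) ^ 2) := by ring
      _ ≤ 37 / 72 * (d - c) ^ 2 * (36 * R.integral (pderiv 1 e ^ 2)) := by gcongr
      _ = _ := by ring
  rw [hgrad]
  calc R.integral (e ^ 2) ≤ 37 * (b - a) ^ 2 / 2 * R.integral (pderiv 0 e ^ 2) +
        37 / 2 * (d - c) ^ 2 * R.integral (pderiv 1 e ^ 2) := by linarith
    _ ≤ 37 * R.diam ^ 2 / 2 * R.integral (pderiv 0 e ^ 2) +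
        37 / 2 * R.diam ^ 2 * R.integral (pderiv 1 e ^ 2) := by gcongr
    _ = _ := by ring

/-- The edge integral as a linear functional. -/
noncomputable def edgeHom (d : Fin 2) (c : ℝ) : Poly →ₗ[ℝ] ℝ where
  toFun := R.edgeIntegral d c
  map_add' p q := by
    simp only [edgeIntegral, map_add]
    refine intervalIntegral.integral_add ?_ ?_ <;>
    · refine Continuous.intervalIntegrable ((MvPolynomial.continuous_eval _).comp
        (continuous_pi fun e => ?_)) _ _
      split_ifs <;> fun_prop
  map_smul' c p := by
    simp only [edgeIntegral, smul_eval, RingHom.id_apply, smul_eq_mul]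
    exact intervalIntegral.integral_const_mul _ _

lemma edgeHom_apply (d : Fin 2) (c : ℝ) (p : Poly) : R.edgeHom d c p = R.edgeIntegral d c p := rfl

lemma edgeIntegral_mono (d : Fin 2) (c : ℝ) {p q : Poly}
    (h : ∀ t ∈ Set.Icc (R.lo (d + 1)) (R.hi (d + 1)),
      eval (fun e => if e = d then c else t) p ≤ eval (fun e => if e = d then c else t) q) :
    R.edgeIntegral d c p ≤ R.edgeIntegral d c q := by
  refine intervalIntegral.integral_mono_on (R.lt _).le ?_ ?_ h <;>
  · refine Continuous.intervalIntegrable ((MvPolynomial.continuous_eval _).comp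
      (continuous_pi fun e => ?_)) _ _
    split_ifs <;> fun_prop

lemma edgeIntegral_nonneg (d : Fin 2) (c : ℝ) {p : Poly}
    (h : ∀ t ∈ Set.Icc (R.lo (d + 1)) (R.hi (d + 1)),
      0 ≤ eval (fun e => if e = d then c else t) p) :
    0 ≤ R.edgeIntegral d c p :=
  intervalIntegral.integral_nonneg (R.lt _).le h

end Rect

end CEM

/-! ### Bilinear functions on a rectangle: faces, interpolation, edges. -/

namespace CEM

open MvPolynomial

/-- The point with coordinate `c` in direction `d` and coordinate `t` in the other direction. -/
def pt (d : Fin 2) (c t : ℝ) : Pt := fun e => if e = d then c else t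

@[simp] lemma pt_self (d : Fin 2) (c t : ℝ) : pt d c t d = c := by simp [pt]

lemma succ_ne (d : Fin 2) : d + 1 ≠ d := by fin_cases d <;> decide

@[simp] lemma pt_succ (d : Fin 2) (c t : ℝ) : pt d c t (d + 1) = t := by
  simp [pt]

lemma eq_or_eq_succ (d e : Fin 2) : e = d ∨ e = d + 1 := by
  fin_cases d <;> fin_cases e <;> decide

lemma forall_fin_two_iff (d : Fin 2) {P : Fin 2 → Prop} : (∀ e, P e) ↔ P d ∧ P (d + 1) := by
  refine ⟨fun h => ⟨h _, h _⟩, fun h e => ?_⟩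
  rcases eq_or_eq_succ d e with rfl | rfl
  exacts [h.1, h.2]

lemma pt_eta (d : Fin 2) (x : Pt) : pt d (x d) (x (d + 1)) = x := by
  funext e
  rcases eq_or_eq_succ d e with rfl | rfl <;> simp

lemma pt_flip (d : Fin 2) (c t : ℝ) : pt (d + 1) t c = pt d c t := by
  funext e
  rcases eq_or_eq_succ d e with rfl | rfl
  · simp [pt]
  · simp

/-- Linear interpolation of the values `A` at `a` and `B` at `b`. -/
noncomputable def lin (a b A B x : ℝ) : ℝ := ((b - x) * A + (x - a) * B) / (b - a)

lemma lin_eq_zero {a b A B x : ℝ} (hA : x = b ∨ A = 0) (hB : x = a ∨ B = 0) :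
    lin a b A B x = 0 := by
  unfold lin
  rcases hA with rfl | rfl <;> rcases hB with rfl | rfl <;> simp

lemma eval_eq_lin_of_natDegree_le_one {q : Polynomial ℝ} (hq : q.natDegree ≤ 1) {a b : ℝ}
    (hab : a < b) (x : ℝ) : q.eval x = lin a b (q.eval a) (q.eval b) x := by
  obtain ⟨m, c, rfl⟩ := Polynomial.exists_eq_X_add_C_of_natDegree_le_one hq
  have : b - a ≠ 0 := (sub_pos.2 hab).ne'
  simp only [lin, Polynomial.eval_add, Polynomial.eval_mul, Polynomial.eval_C, Polynomial.eval_X]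
  field_simp
  ring

lemma eval_pt_eq_lin {p : Poly} (hp : p ∈ restrictDegree (Fin 2) ℝ 1) (d : Fin 2) {a b : ℝ}
    (hab : a < b) (s t : ℝ) :
    eval (pt d s t) p = lin a b (eval (pt d a t) p) (eval (pt d b t) p) s := by
  have := eval_eq_lin_of_natDegree_le_one (natDegree_slice_le hp d t) hab s
  rwa [eval_slice, eval_slice, eval_slice] at this

lemma eval_pt_eq_lin' {p : Poly} (hp : p ∈ restrictDegree (Fin 2) ℝ 1) (d : Fin 2) {a b : ℝ}
    (hab : a < b) (c t : ℝ) :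
    eval (pt d c t) p = lin a b (eval (pt d c a) p) (eval (pt d c b) p) t := by
  have := eval_pt_eq_lin hp (d + 1) hab t c
  simpa only [pt_flip] using this

lemma exists_eq_C_of_pderiv_eq_zero {p : Poly} (h : ∀ d, pderiv d p = 0) : ∃ c, p = C c := by
  have key : ∀ d s s' t, eval (pt d s t) p = eval (pt d s' t) p := fun d s s' t => by
    have h1 : (slice d t p).derivative = 0 := by rw [derivative_slice, h, map_zero]
    have h2 := Polynomial.eq_C_of_natDegree_eq_zero
      (Polynomial.derivative_eq_zero.1 h1)
    have h3 : ∀ s, eval (pt d s t) p = (slice d t p).coeff 0 := fun s => by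
      have := eval_slice d s t p
      rw [h2, Polynomial.eval_C] at this
      exact this.symm
    rw [h3, h3]
  refine ⟨eval 0 p, MvPolynomial.funext fun x => ?_⟩
  rw [eval_C, ← pt_eta 0 x, key 0 _ 0, ← pt_flip, key _ _ 0]
  congr 2
  funext e
  simp [pt]

namespace Rect

variable (R : Rect)

lemma mem_carrier {x : Pt} : x ∈ R.carrier ↔ ∀ d, R.lo d ≤ x d ∧ x d ≤ R.hi d := by
  simp [carrier, Pi.le_def, forall_and]

lemma mem_vertices {x : Pt} : x ∈ R.vertices ↔ ∀ d, x d = R.lo d ∨ x d = R.hi d := by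
  simp [vertices]

lemma vertices_subset {x : Pt} (hx : x ∈ R.vertices) : x ∈ R.carrier := by
  rw [mem_vertices] at hx
  rw [mem_carrier]
  intro d
  have := R.lt d
  rcases hx d with h | h <;> rw [h] <;> constructor <;> linarith

lemma card_vertices : R.vertices.card = 4 := by
  rw [vertices, Fintype.card_piFinset, Fin.prod_univ_two, Finset.card_pair (R.lt 0).ne,
    Finset.card_pair (R.lt 1).ne]
  norm_num

/-- A bilinear function vanishes at a point if it vanishes at the vertices of the smallest face
which contains this point. -/
lemma eval_eq_zero_of_face {p : Poly} (hp : p ∈ restrictDegree (Fin 2) ℝ 1) (x : Pt)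
    (h : ∀ v ∈ R.vertices, (∀ d, x d = R.lo d → v d = R.lo d) →
      (∀ d, x d = R.hi d → v d = R.hi d) → eval v p = 0) : eval x p = 0 := by
  -- An end point of a side interval is admissible unless `x` sits at the opposite one; the
  -- admissible pairs are the vertices of the smallest face containing `x`.
  have key : ∀ s t, (s = R.lo 0 ∧ x 0 ≠ R.hi 0 ∨ s = R.hi 0 ∧ x 0 ≠ R.lo 0) →
      (t = R.lo 1 ∧ x 1 ≠ R.hi 1 ∨ t = R.hi 1 ∧ x 1 ≠ R.lo 1) → eval (pt 0 s t) p = 0 := by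
    intro s t hs ht
    refine h _ (R.mem_vertices.2 (Fin.forall_fin_two.2 ?_)) (Fin.forall_fin_two.2 ?_)
      (Fin.forall_fin_two.2 ?_) <;> simp only [pt, if_true, one_ne_zero, if_false] <;> tauto
  have row : ∀ s, (s = R.lo 0 ∧ x 0 ≠ R.hi 0 ∨ s = R.hi 0 ∧ x 0 ≠ R.lo 0) →
      eval (pt 0 s (x 1)) p = 0 := by
    intro s hs
    rw [eval_pt_eq_lin' hp 0 (R.lt 1)]
    refine lin_eq_zero ?_ ?_
    · by_cases hx : x 1 = R.hi 1
      · exact Or.inl hx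
      · exact Or.inr (key _ _ hs (Or.inl ⟨rfl, hx⟩))
    · by_cases hx : x 1 = R.lo 1
      · exact Or.inl hx
      · exact Or.inr (key _ _ hs (Or.inr ⟨rfl, hx⟩))
  rw [← pt_eta 0 x, eval_pt_eq_lin hp 0 (R.lt 0)]
  refine lin_eq_zero ?_ ?_
  · by_cases hx : x 0 = R.hi 0
    · exact Or.inl hx
    · exact Or.inr (row _ (Or.inl ⟨rfl, hx⟩))
  · by_cases hx : x 0 = R.lo 0
    · exact Or.inl hx
    · exact Or.inr (row _ (Or.inr ⟨rfl, hx⟩))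

lemma eq_of_eval_vertices {p q : Poly} (hp : p ∈ restrictDegree (Fin 2) ℝ 1)
    (hq : q ∈ restrictDegree (Fin 2) ℝ 1) (h : ∀ v ∈ R.vertices, eval v p = eval v q) :
    p = q := by
  rw [← sub_eq_zero]
  refine R.eq_zero_of_eval fun x _ => ?_
  exact R.eval_eq_zero_of_face (Submodule.sub_mem _ hp hq) x fun v hv _ _ => by simp [h v hv]

/-- The bilinear nodal basis function of the vertex `v`. -/
noncomputable def shape (v : Pt) : Poly :=
  ∏ d, C (R.hi d - R.lo d)⁻¹ * (if v d = R.lo d then C (R.hi d) - X d else X d - C (R.lo d))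

lemma shape_mem (v : Pt) : R.shape v ∈ restrictDegree (Fin 2) ℝ 1 := by
  have hX : ∀ d e : Fin 2, d ≠ e → ∀ c c' : ℝ, ∀ p q : Poly,
      (p = C c - X d ∨ p = X d - C c) → (q = C c' - X e ∨ q = X e - C c') →
      p * q ∈ restrictDegree (Fin 2) ℝ 1 := by
    intro d e hde c c' p q hp hq
    have hm : ∀ a b : ℕ, a ≤ 1 → b ≤ 1 → (X d ^ a * X e ^ b : Poly) ∈
        restrictDegree (Fin 2) ℝ 1 := by
      intro a b ha hb
      rw [X_pow_eq_monomial, X_pow_eq_monomial, monomial_mul, mem_restrictDegree]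
      intro s hs i
      rw [Finset.mem_singleton.1 (support_monomial_subset hs)]
      simp only [Finsupp.add_apply, Finsupp.single_apply]
      split_ifs <;> omega
    have hXX := hm 1 1 le_rfl le_rfl
    have hX0 := hm 1 0 le_rfl zero_le_one
    have h0X := hm 0 1 zero_le_one le_rfl
    simp only [pow_one, pow_zero, mul_one, one_mul] at hXX hX0 h0X
    have hsm : ∀ (a : ℝ) (r : Poly), r ∈ restrictDegree (Fin 2) ℝ 1 →
        C a * r ∈ restrictDegree (Fin 2) ℝ 1 := fun a r hr => by
      rw [C_mul']; exact Submodule.smul_mem _ _ hr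
    have hprod : (X d - C c) * (X e - C c') ∈ restrictDegree (Fin 2) ℝ 1 := by
      have : (X d - C c) * (X e - C c') =
          (X d * X e - C c' * X d - C c * X e + C (c * c') : Poly) := by
        rw [C_mul]; ring
      rw [this]
      exact Submodule.add_mem _ (Submodule.sub_mem _ (Submodule.sub_mem _ hXX (hsm _ _ hX0))
        (hsm _ _ h0X)) (C_mem_restrictDegree _ _)
    rcases hp with rfl | rfl <;> rcases hq with rfl | rfl
    · convert hprod using 1; ring
    · convert Submodule.neg_mem _ hprod using 1; ring
    · convert Submodule.neg_mem _ hprod using 1; ring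
    · exact hprod
  have : R.shape v = C ((R.hi 0 - R.lo 0)⁻¹ * (R.hi 1 - R.lo 1)⁻¹) *
      ((if v 0 = R.lo 0 then C (R.hi 0) - X 0 else X 0 - C (R.lo 0)) *
      (if v 1 = R.lo 1 then C (R.hi 1) - X 1 else X 1 - C (R.lo 1))) := by
    rw [shape, Fin.prod_univ_two, C_mul]; ring
  rw [this, C_mul']
  refine Submodule.smul_mem _ _ ?_
  split_ifs
  · exact hX 0 1 zero_ne_one _ _ _ _ (Or.inl rfl) (Or.inl rfl)
  · exact hX 0 1 zero_ne_one _ _ _ _ (Or.inl rfl) (Or.inr rfl)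
  · exact hX 0 1 zero_ne_one _ _ _ _ (Or.inr rfl) (Or.inl rfl)
  · exact hX 0 1 zero_ne_one _ _ _ _ (Or.inr rfl) (Or.inr rfl)

lemma eval_shape {v w : Pt} (hv : v ∈ R.vertices) (hw : w ∈ R.vertices) :
    eval w (R.shape v) = if v = w then 1 else 0 := by
  rw [mem_vertices] at hv hw
  have hfac : ∀ d, eval w (C (R.hi d - R.lo d)⁻¹ *
      (if v d = R.lo d then C (R.hi d) - X d else X d - C (R.lo d))) =
      if v d = w d then 1 else 0 := fun d => by
    have hlt := R.lt d
    have hne : R.hi d - R.lo d ≠ 0 := (sub_pos.2 hlt).ne'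
    rcases hv d with h1 | h1 <;> rcases hw d with h2 | h2 <;>
      simp [h1, h2, hne, hlt.ne, hlt.ne']
  rw [shape, map_prod, Finset.prod_congr rfl fun d _ => hfac d]
  by_cases h : v = w
  · simp [h]
  · rw [if_neg h]
    obtain ⟨d, hd⟩ := Function.ne_iff.1 h
    exact Finset.prod_eq_zero (Finset.mem_univ d) (if_neg hd)

/-- The bilinear interpolant at the vertices. -/
noncomputable def interp : Poly →ₗ[ℝ] Poly where
  toFun u := ∑ v ∈ R.vertices, C (eval v u) * R.shape v
  map_add' u w := by simp [add_mul, Finset.sum_add_distrib]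
  map_smul' c u := by
    simp [smul_eval, C_mul', Finset.smul_sum]

lemma interp_mem (u : Poly) : R.interp u ∈ restrictDegree (Fin 2) ℝ 1 := by
  refine Submodule.sum_mem _ fun v _ => ?_
  rw [C_mul']
  exact Submodule.smul_mem _ _ (R.shape_mem v)

lemma eval_interp {v : Pt} (hv : v ∈ R.vertices) (u : Poly) :
    eval v (R.interp u) = eval v u := by
  change eval v (∑ w ∈ R.vertices, C (eval w u) * R.shape w) = _
  rw [map_sum, Finset.sum_congr rfl fun w hw => by
    rw [map_mul, eval_C, R.eval_shape hw hv]]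
  simp [hv]

lemma interp_eq_self {p : Poly} (hp : p ∈ restrictDegree (Fin 2) ℝ 1) : R.interp p = p :=
  R.eq_of_eval_vertices (R.interp_mem p) hp fun _ hv => R.eval_interp hv p

lemma gradDot_integral_nonneg (p : Poly) : 0 ≤ R.integral (gradDot p p) :=
  R.integral_nonneg' fun x _ => by rw [eval_gradDot_self]; positivity

lemma exists_eq_C_of_integral_gradDot {p : Poly} (h : R.integral (gradDot p p) = 0) :
    ∃ c, p = C c := by
  have hgrad : R.integral (gradDot p p) =
      R.integral (pderiv 0 p ^ 2) + R.integral (pderiv 1 p ^ 2) := by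
    rw [← R.integral_add']; congr 1; simp [gradDot, Fin.sum_univ_two, sq]
  have hn : ∀ d, 0 ≤ R.integral (pderiv d p ^ 2) := fun d =>
    R.integral_nonneg' fun x _ => by rw [map_pow]; exact sq_nonneg _
  have h0 := hn 0
  have h1 := hn 1
  refine exists_eq_C_of_pderiv_eq_zero (Fin.forall_fin_two.2 ⟨?_, ?_⟩) <;>
  · refine R.eq_zero_of_integral_sq ?_
    linarith

lemma integral_gradDot_add_le (p q : Poly) :
    R.integral (gradDot (p + q) (p + q)) ≤
      2 * R.integral (gradDot p p) + 2 * R.integral (gradDot q q) := by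
  rw [← R.integral_C_mul, ← R.integral_C_mul, ← R.integral_add']
  refine R.integral_mono' fun x _ => ?_
  simp only [map_add, map_mul, eval_C, eval_gradDot_self]
  nlinarith [sq_nonneg (eval x (pderiv 0 p) - eval x (pderiv 0 q)),
    sq_nonneg (eval x (pderiv 1 p) - eval x (pderiv 1 q))]

/-- On an edge, a bilinear function is determined by its values at the end points. -/
lemma edgeIntegral_sq {p : Poly} (hp : p ∈ restrictDegree (Fin 2) ℝ 1) (d : Fin 2) (c : ℝ) :
    R.edgeIntegral d c (p ^ 2) = (R.hi (d + 1) - R.lo (d + 1)) / 3 *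
      (eval (pt d c (R.lo (d + 1))) p ^ 2 +
        eval (pt d c (R.lo (d + 1))) p * eval (pt d c (R.hi (d + 1))) p +
        eval (pt d c (R.hi (d + 1))) p ^ 2) := by
  rw [← integral_linear_sq (R.lt (d + 1)), edgeIntegral]
  refine intervalIntegral.integral_congr fun t _ => ?_
  simp only [map_pow]
  have := eval_pt_eq_lin' hp d (R.lt (d + 1)) c t
  rw [lin] at this
  rw [← this]
  rfl

lemma edgeIntegral_eq_zero {p : Poly} (hp : p ∈ restrictDegree (Fin 2) ℝ 1) (d : Fin 2) (c : ℝ)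
    (h0 : eval (pt d c (R.lo (d + 1))) p = 0) (h1 : eval (pt d c (R.hi (d + 1))) p = 0) :
    R.edgeIntegral d c (p ^ 2) = 0 := by
  rw [R.edgeIntegral_sq hp, h0, h1]; ring

/-- Stability of the interpolation of the products with a partition of unity on an edge. -/
lemma sum_edgeIntegral_sq_le {ι : Type*} (s : Finset ι) {p : Poly} {q : ι → Poly}
    (hp : p ∈ restrictDegree (Fin 2) ℝ 1) (hq : ∀ i ∈ s, q i ∈ restrictDegree (Fin 2) ℝ 1)
    (d : Fin 2) (c : ℝ) (α β : ι → ℝ) (hα : ∑ i ∈ s, α i ^ 2 ≤ 1) (hβ : ∑ i ∈ s, β i ^ 2 ≤ 1)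
    (h0 : ∀ i ∈ s, eval (pt d c (R.lo (d + 1))) (q i) = α i * eval (pt d c (R.lo (d + 1))) p)
    (h1 : ∀ i ∈ s, eval (pt d c (R.hi (d + 1))) (q i) = β i * eval (pt d c (R.hi (d + 1))) p) :
    ∑ i ∈ s, R.edgeIntegral d c (q i ^ 2) ≤ 3 * R.edgeIntegral d c (p ^ 2) := by
  rw [R.edgeIntegral_sq hp]
  set A := eval (pt d c (R.lo (d + 1))) p
  set B := eval (pt d c (R.hi (d + 1))) p
  have hl := sub_pos.2 (R.lt (d + 1))
  set l := R.hi (d + 1) - R.lo (d + 1) with hldef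
  calc ∑ i ∈ s, R.edgeIntegral d c (q i ^ 2)
      ≤ ∑ i ∈ s, l / 2 * (α i ^ 2 * A ^ 2 + β i ^ 2 * B ^ 2) := by
        refine Finset.sum_le_sum fun i hi => ?_
        rw [R.edgeIntegral_sq (hq i hi), h0 i hi, h1 i hi, ← hldef]
        -- The form (l/3)(A² + AB + B²) lies between l/6 and l/2 times A² + B²; the quotient of
        -- these constants is the factor 3.
        nlinarith [mul_nonneg hl.le (sq_nonneg (α i * A - β i * B))]
    _ = l / 2 * ((∑ i ∈ s, α i ^ 2) * A ^ 2 + (∑ i ∈ s, β i ^ 2) * B ^ 2) := by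
        rw [Finset.sum_mul, Finset.sum_mul, ← Finset.sum_add_distrib, Finset.mul_sum]
    _ ≤ l / 2 * (1 * A ^ 2 + 1 * B ^ 2) := by gcongr
    _ ≤ _ := by nlinarith [mul_nonneg hl.le (sq_nonneg (A + B))]

end Rect

end CEM

/-! ### Geometry of conforming meshes and the boundary of the domain. -/

namespace CEM

open MvPolynomial

namespace Rect

variable (R : Rect)

lemma interior_carrier :
    interior R.carrier = Set.pi Set.univ fun d => Set.Ioo (R.lo d) (R.hi d) := by
  rw [carrier, ← Set.pi_univ_Icc, interior_pi_set Set.finite_univ]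
  simp

lemma isClosed_carrier : IsClosed R.carrier := isClosed_Icc

lemma mem_frontier {x : Pt} :
    x ∈ frontier R.carrier ↔ x ∈ R.carrier ∧ ∃ d, x d = R.lo d ∨ x d = R.hi d := by
  rw [R.isClosed_carrier.frontier_eq, Set.mem_sdiff, interior_carrier]
  refine and_congr_right fun hx => ?_
  rw [mem_carrier] at hx
  simp only [Set.mem_univ_pi, Set.mem_Ioo, not_forall]
  refine exists_congr fun d => ?_
  obtain ⟨h1, h2⟩ := hx d
  rw [not_and_or, not_lt, not_lt, le_antisymm_iff, le_antisymm_iff]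
  tauto

/-- The one-dimensional factors of the bilinear hat function. -/
noncomputable def hat1 (d : Fin 2) (z x : ℝ) : ℝ :=
  if z = R.lo d ∨ z = R.hi d then 1 - |x - z| / (R.hi d - R.lo d) else 0

lemma hat_eq_prod (z x : Pt) : R.hat z x = ∏ d, R.hat1 d (z d) (x d) := by
  unfold hat hat1
  by_cases h : z ∈ R.vertices
  · rw [if_pos h]
    rw [mem_vertices] at h
    exact Finset.prod_congr rfl fun d _ => by rw [if_pos (h d)]
  · rw [if_neg h]
    rw [mem_vertices, not_forall] at h
    obtain ⟨d, hd⟩ := h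
    exact (Finset.prod_eq_zero (Finset.mem_univ d) (if_neg hd)).symm

lemma hat1_lo (d : Fin 2) (z : ℝ) : R.hat1 d z (R.lo d) = if z = R.lo d then 1 else 0 := by
  have h := R.lt d
  have hne : R.hi d - R.lo d ≠ 0 := (sub_pos.2 h).ne'
  unfold hat1
  by_cases h1 : z = R.lo d
  · simp [h1]
  · by_cases h2 : z = R.hi d
    · rw [if_pos (Or.inr h2), if_neg h1, h2, abs_sub_comm, abs_of_pos (sub_pos.2 h), div_self hne,
        sub_self]
    · simp [h1, h2]

lemma hat1_hi (d : Fin 2) (z : ℝ) : R.hat1 d z (R.hi d) = if z = R.hi d then 1 else 0 := by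
  have h := R.lt d
  have hne : R.hi d - R.lo d ≠ 0 := (sub_pos.2 h).ne'
  unfold hat1
  by_cases h1 : z = R.hi d
  · simp [h1]
  · by_cases h2 : z = R.lo d
    · rw [if_pos (Or.inl h2), if_neg h1, h2, abs_of_pos (sub_pos.2 h), div_self hne, sub_self]
    · simp [h1, h2]

lemma hat_of_notMem {z : Pt} (h : z ∉ R.vertices) (x : Pt) : R.hat z x = 0 := if_neg h

lemma sum_hat {x : Pt} (hx : x ∈ R.carrier) : ∑ z ∈ R.vertices, R.hat z x = 1 := by
  rw [mem_carrier] at hx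
  have h1 : ∀ d, ∑ t ∈ ({R.lo d, R.hi d} : Finset ℝ), R.hat1 d t (x d) = 1 := fun d => by
    have h := R.lt d
    have hne : R.hi d - R.lo d ≠ 0 := (sub_pos.2 h).ne'
    rw [Finset.sum_pair h.ne, hat1, hat1, if_pos (Or.inl rfl), if_pos (Or.inr rfl),
      abs_of_nonneg (by linarith [(hx d).1]), abs_of_nonpos (by linarith [(hx d).2])]
    field_simp
    ring
  calc ∑ z ∈ R.vertices, R.hat z x = ∑ z ∈ R.vertices, ∏ d, R.hat1 d (z d) (x d) :=
        Finset.sum_congr rfl fun z _ => R.hat_eq_prod z x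
    _ = ∏ d, ∑ t ∈ ({R.lo d, R.hi d} : Finset ℝ), R.hat1 d t (x d) :=
        (Finset.prod_univ_sum (fun d => ({R.lo d, R.hi d} : Finset ℝ))
          (fun d t => R.hat1 d t (x d))).symm
    _ = 1 := by simp [h1]

lemma exists_vertex_hat_eq_zero {x : Pt} (hx : x ∈ frontier R.carrier) :
    ∃ z ∈ R.vertices, R.hat z x = 0 := by
  obtain ⟨-, d, hd⟩ := R.mem_frontier.1 hx
  have hlt := R.lt d
  rcases hd with hd | hd
  · refine ⟨R.hi, R.mem_vertices.2 fun _ => Or.inr rfl, ?_⟩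
    rw [hat_eq_prod]
    refine Finset.prod_eq_zero (Finset.mem_univ d) ?_
    rw [hd, hat1_lo, if_neg hlt.ne']
  · refine ⟨R.lo, R.mem_vertices.2 fun _ => Or.inl rfl, ?_⟩
    rw [hat_eq_prod]
    refine Finset.prod_eq_zero (Finset.mem_univ d) ?_
    rw [hd, hat1_hi, if_neg hlt.ne]

end Rect

lemma Conforming.cases {T : Finset Rect} (hT : Conforming T) {R S : Rect} (hR : R ∈ T) (hS : S ∈ T)
    {x : Pt} (hxR : x ∈ R.carrier) (hxS : x ∈ S.carrier) (d : Fin 2) :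
    (R.lo d = S.lo d ∧ R.hi d = S.hi d) ∨ R.hi d = S.lo d ∨ S.hi d = R.lo d := by
  rcases hT R hR S hS with h | h
  · exact absurd hxS (Set.disjoint_left.1 h hxR)
  · exact h d

/-- Adjacent intervals share only one point. -/
lemma Conforming.cases_mem {T : Finset Rect} (hT : Conforming T) {R S : Rect} (hR : R ∈ T)
    (hS : S ∈ T) {x : Pt} (hxR : x ∈ R.carrier) (hxS : x ∈ S.carrier) (d : Fin 2) :
    (R.lo d = S.lo d ∧ R.hi d = S.hi d) ∨ (x d = R.hi d ∧ x d = S.lo d) ∨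
      (x d = S.hi d ∧ x d = R.lo d) := by
  have h1 := R.mem_carrier.1 hxR d
  have h2 := S.mem_carrier.1 hxS d
  rcases hT.cases hR hS hxR hxS d with h | h | h
  · exact Or.inl h
  · exact Or.inr (Or.inl ⟨by linarith, by linarith⟩)
  · exact Or.inr (Or.inr ⟨by linarith, by linarith⟩)

lemma Conforming.mem_frontier {T : Finset Rect} (hT : Conforming T) {R S : Rect} (hR : R ∈ T)
    (hS : S ∈ T) (hne : R ≠ S) {x : Pt} (hxR : x ∈ R.carrier) (hxS : x ∈ S.carrier) :
    x ∈ frontier R.carrier := by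
  rw [R.mem_frontier]
  refine ⟨hxR, ?_⟩
  by_contra hcon
  push Not at hcon
  refine hne (Rect.ext (funext fun d => ?_) (funext fun d => ?_)) <;>
  · obtain ⟨h1, h2⟩ := hcon d
    rcases hT.cases_mem hR hS hxR hxS d with h | h | h
    · first | exact h.1 | exact h.2
    · exact absurd h.1 h2
    · exact absurd h.2 h1

/-- In each direction the two intervals agree, or x is at a common end point, where the
one-dimensional factor only depends on whether z has the same coordinate. -/
lemma Conforming.hat_eq {T : Finset Rect} (hT : Conforming T) {R S : Rect} (hR : R ∈ T)
    (hS : S ∈ T) {x : Pt} (hxR : x ∈ R.carrier) (hxS : x ∈ S.carrier) (z : Pt) :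
    R.hat z x = S.hat z x := by
  rw [R.hat_eq_prod, S.hat_eq_prod]
  refine Finset.prod_congr rfl fun d _ => ?_
  rcases hT.cases_mem hR hS hxR hxS d with ⟨h1, h2⟩ | ⟨h1, h2⟩ | ⟨h1, h2⟩
  · rw [Rect.hat1, Rect.hat1, h1, h2]
  · conv_lhs => rw [h1, Rect.hat1_hi, ← h1]
    conv_rhs => rw [h2, Rect.hat1_lo, ← h2]
  · conv_lhs => rw [h2, Rect.hat1_lo, ← h2]
    conv_rhs => rw [h1, Rect.hat1_hi, ← h1]

/-- Bilinear functions on two blocks of a conforming mesh agree at a common point if they agree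
at the common vertices. -/
lemma Conforming.eval_eq {T : Finset Rect} (hT : Conforming T) {R S : Rect} (hR : R ∈ T)
    (hS : S ∈ T) {x : Pt} (hxR : x ∈ R.carrier) (hxS : x ∈ S.carrier) {p q : Poly}
    (hp : p ∈ restrictDegree (Fin 2) ℝ 1) (hq : q ∈ restrictDegree (Fin 2) ℝ 1)
    (h : ∀ v ∈ R.vertices, v ∈ S.vertices → eval v p = eval v q) : eval x p = eval x q := by
  rw [← sub_eq_zero, ← map_sub]
  refine R.eval_eq_zero_of_face (Submodule.sub_mem _ hp hq) x fun v hv hlo hhi => ?_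
  rw [map_sub, sub_eq_zero]
  refine h v hv (S.mem_vertices.2 fun d => ?_)
  have hvd := R.mem_vertices.1 hv d
  rcases hT.cases_mem hR hS hxR hxS d with ⟨h1, h2⟩ | ⟨h1, h2⟩ | ⟨h1, h2⟩
  · rwa [← h1, ← h2]
  · exact Or.inl (by rw [hhi d h1, ← h1, h2])
  · exact Or.inr (by rw [hlo d h2, ← h2, h1])

namespace Mesh

variable (M : Mesh)

lemma mem_union_iff {x : Pt} :
    x ∈ (⋃ K : M.coarse, K.1.carrier) ↔ ∃ τ : M.fine, x ∈ τ.1.carrier := by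
  rw [Set.mem_iUnion]
  constructor
  · rintro ⟨K, hK⟩
    obtain ⟨τ, -, hτ⟩ := M.parent_cover K x hK
    exact ⟨τ, hτ⟩
  · rintro ⟨τ, hτ⟩
    exact ⟨M.parent τ, M.parent_sub τ hτ⟩

lemma isOpen_Ω : IsOpen M.Ω := isOpen_interior

lemma mem_frontier_Ω {τ : M.fine} {x : Pt} (hx : x ∈ τ.1.carrier) :
    x ∈ frontier M.Ω ↔ x ∉ M.Ω := by
  rw [M.isOpen_Ω.frontier_eq, Set.mem_sdiff, and_iff_right]
  have hsub : τ.1.carrier ⊆ ⋃ K : M.coarse, K.1.carrier := fun y hy =>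
    M.mem_union_iff.2 ⟨τ, hy⟩
  exact closure_mono (interior_mono hsub) (τ.1.subset_closure_interior hx)

/-- The blocks that miss x are finitely many closed sets, hence stay away from a neighbourhood of x.
This turns membership in the open domain into a statement about blocks. -/
lemma exists_common_block {x : Pt} (hx : x ∈ M.Ω) :
    ∃ ε > 0, ∀ y : Pt, (∀ d, |y d - x d| < ε) → ∃ σ : M.fine, x ∈ σ.1.carrier ∧ y ∈ σ.1.carrier := by
  have h1 : ∀ᶠ y in nhds x, y ∈ M.Ω := M.isOpen_Ω.mem_nhds hx
  have h2 : ∀ᶠ y in nhds x, ∀ σ : M.fine, x ∉ σ.1.carrier → y ∉ σ.1.carrier := by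
    rw [Filter.eventually_all]
    intro σ
    by_cases hσ : x ∈ σ.1.carrier
    · exact Filter.Eventually.of_forall fun y h => absurd hσ h
    · filter_upwards [σ.1.isClosed_carrier.isOpen_compl.mem_nhds hσ] with y hy _ using hy
  obtain ⟨ε, hε, h⟩ := Metric.eventually_nhds_iff.1 (h1.and h2)
  refine ⟨ε, hε, fun y hy => ?_⟩
  obtain ⟨hyΩ, hyσ⟩ := h ((dist_pi_lt_iff hε).2 fun d => by rw [Real.dist_eq]; exact hy d)
  obtain ⟨σ, hσ⟩ := M.mem_union_iff.1 (interior_subset hyΩ)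
  refine ⟨σ, ?_, hσ⟩
  by_contra hx
  exact hyσ σ hx hσ

lemma exists_Ioo_near {a b v ε : ℝ} (hab : a < b) (hv : v = a ∨ v = b) (hε : 0 < ε) :
    ∃ c, a < c ∧ c < b ∧ |c - v| < ε := by
  have hm : 0 < min ((b - a) / 2) (ε / 2) := by
    refine lt_min ?_ ?_ <;> linarith
  have h1 := min_le_left ((b - a) / 2) (ε / 2)
  have h2 := min_le_right ((b - a) / 2) (ε / 2)
  rcases hv with rfl | rfl
  · refine ⟨v + min ((b - v) / 2) (ε / 2), by linarith, by linarith, ?_⟩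
    rw [add_sub_cancel_left, abs_of_pos hm]; linarith
  · refine ⟨v - min ((v - a) / 2) (ε / 2), by linarith, by linarith, ?_⟩
    rw [sub_sub_cancel_left, abs_neg, abs_of_pos hm]; linarith

/-- If a vertex of the smallest face containing `x` is inside the domain, then so is `x`. -/
lemma mem_Ω_of_face {τ : M.fine} {x v : Pt} (hx : x ∈ τ.1.carrier) (hv : v ∈ τ.1.vertices)
    (hlo : ∀ d, x d = τ.1.lo d → v d = τ.1.lo d) (hhi : ∀ d, x d = τ.1.hi d → v d = τ.1.hi d)
    (hvΩ : v ∈ M.Ω) : x ∈ M.Ω := by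
  obtain ⟨ε, hε, hnear⟩ := M.exists_common_block hvΩ
  have hvτ := τ.1.vertices_subset hv
  choose c hc1 hc2 hc3 using fun d =>
    exists_Ioo_near (τ.1.lt d) (τ.1.mem_vertices.1 hv d) hε
  have hev : ∀ᶠ y in nhds x, ∀ d, |y d - x d| < ε ∧
      (τ.1.lo d < x d ∧ x d < τ.1.hi d → τ.1.lo d < y d ∧ y d < τ.1.hi d) := by
    rw [Filter.eventually_all]
    intro d
    have hcd : Filter.Tendsto (fun y : Pt => y d) (nhds x) (nhds (x d)) :=
      (continuous_apply d).tendsto x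
    refine Filter.Eventually.and ?_ ?_
    · have := hcd.eventually (Metric.ball_mem_nhds (x d) hε)
      simpa [Real.dist_eq] using this
    · by_cases h : τ.1.lo d < x d ∧ x d < τ.1.hi d
      · filter_upwards [hcd.eventually (Ioo_mem_nhds h.1 h.2)] with y hy _ using hy
      · exact Filter.Eventually.of_forall fun y hy => absurd hy h
  refine mem_interior_iff_mem_nhds.2 (Filter.mem_of_superset hev fun y hy => ?_)
  have hend : ∀ d, ¬ (τ.1.lo d < x d ∧ x d < τ.1.hi d) → v d = x d := fun d hd => by
    obtain ⟨h1, h2⟩ := τ.1.mem_carrier.1 hx d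
    rcases h1.eq_or_lt with h | h
    · rw [hlo d h.symm, h]
    · have : x d = τ.1.hi d := le_antisymm h2 (not_lt.1 fun h' => hd ⟨h, h'⟩)
      rw [hhi d this, this]
  -- The coordinates in which `x` is interior to `τ` are replaced by values close to `v`. The new
  -- point is near `v`, so it shares a block `σ` with `v`, and conformity makes `σ` and `τ` coincide
  -- in those directions. Hence `σ` contains `y` as well.
  obtain ⟨σ, hvσ, hyσ⟩ := hnear
    (fun d => if τ.1.lo d < x d ∧ x d < τ.1.hi d then c d else y d) fun d => by
      by_cases hd : τ.1.lo d < x d ∧ x d < τ.1.hi d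
      · rw [if_pos hd]; exact hc3 d
      · rw [if_neg hd, hend d hd]; exact (hy d).1
  refine M.mem_union_iff.2 ⟨σ, σ.1.mem_carrier.2 fun d => ?_⟩
  have hyd := σ.1.mem_carrier.1 hyσ d
  by_cases hd : τ.1.lo d < x d ∧ x d < τ.1.hi d
  · simp only [if_pos hd] at hyd
    have := hc1 d
    have := hc2 d
    have := (hy d).2 hd
    rcases M.fine_conforming.cases τ.2 σ.2 hvτ hvσ d with ⟨h1, h2⟩ | h | h
    · rw [← h1, ← h2]; exact ⟨this.1.le, this.2.le⟩
    · linarith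
    · linarith
  · simpa only [if_neg hd] using hyd

/-- This is what makes vertex interpolation preserve zero boundary values: at a boundary point only
vertices on the boundary count. -/
lemma mem_frontier_Ω_of_face {τ : M.fine} {x v : Pt} (hx : x ∈ τ.1.carrier)
    (hv : v ∈ τ.1.vertices) (hlo : ∀ d, x d = τ.1.lo d → v d = τ.1.lo d)
    (hhi : ∀ d, x d = τ.1.hi d → v d = τ.1.hi d) (hxΩ : x ∈ frontier M.Ω) :
    v ∈ frontier M.Ω := by
  rw [M.mem_frontier_Ω hx] at hxΩ
  rw [M.mem_frontier_Ω (τ.1.vertices_subset hv)]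
  exact fun h => hxΩ (M.mem_Ω_of_face hx hv hlo hhi h)

lemma edge_vertex (R : Rect) (d : Fin 2) {c t : ℝ} (hc : c = R.lo d ∨ c = R.hi d)
    (ht : t = R.lo (d + 1) ∨ t = R.hi (d + 1)) : pt d c t ∈ R.vertices := by
  rw [R.mem_vertices, forall_fin_two_iff d, pt_self, pt_succ]
  exact ⟨hc, ht⟩

/-- The vertices of an edge without a neighbour lie on the boundary of the domain. -/
lemma hi_edge_mem_frontier {τ : M.fine} {d : Fin 2} (h : ∀ σ : M.fine, ¬ τ.1.Precedes d σ.1)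
    {t : ℝ} (ht : t = τ.1.lo (d + 1) ∨ t = τ.1.hi (d + 1)) :
    pt d (τ.1.hi d) t ∈ frontier M.Ω := by
  have hx := τ.1.vertices_subset (edge_vertex τ.1 d (Or.inr rfl) ht)
  rw [M.mem_frontier_Ω hx]
  intro hΩ
  obtain ⟨ε, hε, hnear⟩ := M.exists_common_block hΩ
  obtain ⟨c, hc1, hc2, hc3⟩ := exists_Ioo_near (τ.1.lt (d + 1)) ht hε
  -- The probe point lies just across the edge and strictly inside its tangential range. Conformity
  -- then leaves only a neighbour across this edge for `σ`.
  obtain ⟨σ, hxσ, hyσ⟩ := hnear (pt d (τ.1.hi d + ε / 2) c) (by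
    rw [forall_fin_two_iff d]
    simp only [pt_self, pt_succ, add_sub_cancel_left]
    exact ⟨by rw [abs_of_pos (by linarith)]; linarith, hc3⟩)
  rw [σ.1.mem_carrier, forall_fin_two_iff d, pt_self, pt_succ] at hyσ
  have hlt := τ.1.lt d
  refine h σ ⟨?_, fun e he => ?_⟩
  · rcases M.fine_conforming.cases τ.2 σ.2 hx hxσ d with ⟨h1, h2⟩ | h' | h'
    · linarith [hyσ.1.2]
    · exact h'
    · linarith [hyσ.1.2]
  · obtain rfl : e = d + 1 := (eq_or_eq_succ d e).resolve_left he
    rcases M.fine_conforming.cases τ.2 σ.2 hx hxσ (d + 1) with h' | h' | h'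
    · exact h'
    · linarith [hyσ.2.1]
    · linarith [hyσ.2.2]

lemma lo_edge_mem_frontier {τ : M.fine} {d : Fin 2} (h : ∀ σ : M.fine, ¬ σ.1.Precedes d τ.1)
    {t : ℝ} (ht : t = τ.1.lo (d + 1) ∨ t = τ.1.hi (d + 1)) :
    pt d (τ.1.lo d) t ∈ frontier M.Ω := by
  have hx := τ.1.vertices_subset (edge_vertex τ.1 d (Or.inl rfl) ht)
  rw [M.mem_frontier_Ω hx]
  intro hΩ
  obtain ⟨ε, hε, hnear⟩ := M.exists_common_block hΩ
  obtain ⟨c, hc1, hc2, hc3⟩ := exists_Ioo_near (τ.1.lt (d + 1)) ht hε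
  obtain ⟨σ, hxσ, hyσ⟩ := hnear (pt d (τ.1.lo d - ε / 2) c) (by
    rw [forall_fin_two_iff d]
    simp only [pt_self, pt_succ, sub_sub_cancel_left]
    exact ⟨by rw [abs_neg, abs_of_pos (by linarith)]; linarith, hc3⟩)
  rw [σ.1.mem_carrier, forall_fin_two_iff d, pt_self, pt_succ] at hyσ
  have hlt := τ.1.lt d
  refine h σ ⟨?_, fun e he => ?_⟩
  · rcases M.fine_conforming.cases τ.2 σ.2 hx hxσ d with ⟨h1, h2⟩ | h' | h'
    · linarith [hyσ.1.1]
    · linarith [hyσ.1.1]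
    · exact h'
  · obtain rfl : e = d + 1 := (eq_or_eq_succ d e).resolve_left he
    rcases M.fine_conforming.cases τ.2 σ.2 hx hxσ (d + 1) with h' | h' | h'
    · exact ⟨h'.1.symm, h'.2.symm⟩
    · linarith [hyσ.2.1]
    · linarith [hyσ.2.2]

/-- The end points of a common edge of two fine blocks are vertices of both blocks. -/
lemma precedes_vertex {R S : Rect} {d : Fin 2} (h : R.Precedes d S) {t : ℝ}
    (ht : t = R.lo (d + 1) ∨ t = R.hi (d + 1)) : pt d (R.hi d) t ∈ S.vertices := by
  refine edge_vertex S d (Or.inl h.1) ?_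
  obtain ⟨h1, h2⟩ := h.2 (d + 1) (succ_ne d)
  rwa [← h1, ← h2]

end Mesh

end CEM

/-! ### The forms as bilinear maps, their locality and positivity. -/

namespace CEM

open MvPolynomial

lemma gradDot_add_left (p p' q : Poly) : gradDot (p + p') q = gradDot p q + gradDot p' q := by
  simp [gradDot, Fin.sum_univ_two]; ring

lemma gradDot_smul_left (c : ℝ) (p q : Poly) : gradDot (c • p) q = c • gradDot p q := by
  simp [gradDot, Fin.sum_univ_two]

lemma gradDot_comm (p q : Poly) : gradDot p q = gradDot q p := by
  simp [gradDot, Fin.sum_univ_two]; ring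

lemma ite_add_zero (P : Prop) [Decidable P] (a b : ℝ) :
    (if P then a + b else 0) = (if P then a else 0) + if P then b else 0 := by
  split_ifs <;> simp

lemma ite_mul_zero (P : Prop) [Decidable P] (a b : ℝ) :
    (if P then a * b else 0) = a * if P then b else 0 := by
  split_ifs <;> simp

namespace Mesh

variable (M : Mesh)

noncomputable section

/-- A symmetric bilinear map, given by a function that is linear in its first argument. -/
def symmForm {V : Type*} [AddCommGroup V] [Module ℝ V] (f : V → V → ℝ)
    (hs : ∀ v w, f v w = f w v) (ha : ∀ v v' w, f (v + v') w = f v w + f v' w)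
    (hm : ∀ (c : ℝ) v w, f (c • v) w = c * f v w) : V →ₗ[ℝ] V →ₗ[ℝ] ℝ :=
  LinearMap.mk₂ ℝ f ha hm (fun v w w' => by rw [hs, ha, hs w, hs w'])
    (fun c v w => by rw [hs, hm, hs w, smul_eq_mul])

lemma aLoc_comm (κ : M.fine → ℝ) (K : M.coarse) (v w : M.Fun) :
    M.aLoc κ K v w = M.aLoc κ K w v := by
  simp only [aLoc, gradDot_comm]

/-- `a_K` as a bilinear map. -/
def aLocForm (κ : M.fine → ℝ) (K : M.coarse) : M.Fun →ₗ[ℝ] M.Fun →ₗ[ℝ] ℝ :=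
  symmForm (M.aLoc κ K) (M.aLoc_comm κ K)
    (fun v v' w => by
      classical
      simp only [aLoc, Pi.add_apply, gradDot_add_left, Rect.integral_add', mul_add, ite_add_zero,
        Finset.sum_add_distrib])
    (fun c v w => by
      classical
      simp only [aLoc, Pi.smul_apply, gradDot_smul_left, ← Rect.integralHom_apply, map_smul,
        smul_eq_mul, Finset.mul_sum, ← ite_mul_zero]
      exact Finset.sum_congr rfl fun τ _ => if_congr Iff.rfl (by ring) rfl)

@[simp] lemma aLocForm_apply (κ : M.fine → ℝ) (K : M.coarse) (v w : M.Fun) :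
    M.aLocForm κ K v w = M.aLoc κ K v w := rfl

lemma sLoc_comm (κ : M.fine → ℝ) (χ : Pt → M.Fun) (K : M.coarse) (v w : M.Fun) :
    M.sLoc κ χ K v w = M.sLoc κ χ K w v := by
  simp only [sLoc]
  exact Finset.sum_congr rfl fun τ _ => by rw [mul_assoc, mul_comm (v τ), ← mul_assoc]

/-- `s_K` as a bilinear map. -/
def sLocForm (κ : M.fine → ℝ) (χ : Pt → M.Fun) (K : M.coarse) : M.Fun →ₗ[ℝ] M.Fun →ₗ[ℝ] ℝ :=
  symmForm (M.sLoc κ χ K) (M.sLoc_comm κ χ K)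
    (fun v v' w => by
      classical
      simp only [sLoc, Pi.add_apply, mul_add, add_mul, Rect.integral_add', ite_add_zero,
        Finset.sum_add_distrib])
    (fun c v w => by
      classical
      simp only [sLoc, Pi.smul_apply, mul_smul_comm, smul_mul_assoc, ← Rect.integralHom_apply,
        map_smul, smul_eq_mul, Finset.mul_sum, ← ite_mul_zero])

@[simp] lemma sLocForm_apply (κ : M.fine → ℝ) (χ : Pt → M.Fun) (K : M.coarse) (v w : M.Fun) :
    M.sLocForm κ χ K v w = M.sLoc κ χ K v w := rfl

/-- `s` as a bilinear map. -/
def sForm (κ : M.fine → ℝ) (χ : Pt → M.Fun) : M.Fun →ₗ[ℝ] M.Fun →ₗ[ℝ] ℝ :=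
  ∑ K, M.sLocForm κ χ K

@[simp] lemma sForm_apply (κ : M.fine → ℝ) (χ : Pt → M.Fun) (v w : M.Fun) :
    M.sForm κ χ v w = M.s κ χ v w := by
  simp [sForm, s, LinearMap.sum_apply]

lemma s_comm (κ : M.fine → ℝ) (χ : Pt → M.Fun) (v w : M.Fun) :
    M.s κ χ v w = M.s κ χ w v :=
  Finset.sum_congr rfl fun K _ => M.sLoc_comm κ χ K v w

lemma skeleton_add (F F' : Fin 2 → M.fine → M.fine → Poly) (G G' : Fin 2 → ℝ → M.fine → Poly) :
    M.skeleton (fun d τ σ => F d τ σ + F' d τ σ) (fun d s τ => G d s τ + G' d s τ) =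
      M.skeleton F G + M.skeleton F' G' := by
  classical
  simp only [skeleton, ← Rect.edgeHom_apply, map_add, ite_add_zero, Finset.sum_add_distrib]
  ring

lemma skeleton_smul (c : ℝ) (F : Fin 2 → M.fine → M.fine → Poly)
    (G : Fin 2 → ℝ → M.fine → Poly) :
    M.skeleton (fun d τ σ => c • F d τ σ) (fun d s τ => c • G d s τ) = c * M.skeleton F G := by
  classical
  simp only [skeleton, ← Rect.edgeHom_apply, map_smul, smul_eq_mul, ite_mul_zero,
    ← Finset.mul_sum]
  ring

lemma skeleton_eq_zero {F : Fin 2 → M.fine → M.fine → Poly} {G : Fin 2 → ℝ → M.fine → Poly}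
    (hF : ∀ d τ σ, τ.1.Precedes d σ.1 → F d τ σ = 0) (hG : ∀ d s τ, G d s τ = 0) :
    M.skeleton F G = 0 := by
  classical
  simp only [skeleton, ← Rect.edgeHom_apply, hG, map_zero, ite_self, Finset.sum_const_zero,
    add_zero]
  refine Finset.sum_eq_zero fun d _ => Finset.sum_eq_zero fun τ _ => Finset.sum_eq_zero
    fun σ _ => ?_
  split_ifs with h
  · rw [hF d τ σ h.1, map_zero]
  · rfl

lemma penalty_comm (κ : M.fine → ℝ) (v w : M.Fun) : M.penalty κ v w = M.penalty κ w v := by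
  unfold penalty
  congr 1
  · funext d τ σ; ring
  · funext d s τ; ring

/-- The penalty term as a bilinear map. -/
def penaltyForm (κ : M.fine → ℝ) : M.Fun →ₗ[ℝ] M.Fun →ₗ[ℝ] ℝ :=
  symmForm (M.penalty κ) (M.penalty_comm κ)
    (fun v v' w => by
      unfold penalty
      rw [← skeleton_add]
      congr 1
      · funext d τ σ; simp only [Pi.add_apply]; ring
      · funext d s τ; simp only [Pi.add_apply]; ring)
    (fun c v w => by
      unfold penalty
      rw [← skeleton_smul]
      congr 1
      · funext d τ σ; simp only [Pi.smul_apply, smul_eq_C_mul]; ring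
      · funext d s τ; simp only [Pi.smul_apply, smul_eq_C_mul]; ring)

@[simp] lemma penaltyForm_apply (κ : M.fine → ℝ) (v w : M.Fun) :
    M.penaltyForm κ v w = M.penalty κ v w := rfl

/-- The consistency term as a bilinear map. -/
def fluxForm (κ : M.fine → ℝ) : M.Fun →ₗ[ℝ] M.Fun →ₗ[ℝ] ℝ :=
  LinearMap.mk₂ ℝ (M.flux κ)
    (fun v v' w => by
      unfold flux
      rw [← skeleton_add]
      congr 1
      · funext d τ σ; simp only [Pi.add_apply, map_add]; ring
      · funext d s τ; simp only [Pi.add_apply, map_add]; ring)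
    (fun c v w => by
      unfold flux
      rw [smul_eq_mul, ← skeleton_smul]
      congr 1
      · funext d τ σ; simp only [Pi.smul_apply, Derivation.map_smul]; simp only [smul_eq_C_mul]; ring
      · funext d s τ; simp only [Pi.smul_apply, Derivation.map_smul]; simp only [smul_eq_C_mul]; ring)
    (fun v w w' => by
      unfold flux
      rw [← skeleton_add]
      congr 1
      · funext d τ σ; simp only [Pi.add_apply]; ring
      · funext d s τ; simp only [Pi.add_apply]; ring)
    (fun c v w => by
      unfold flux
      rw [smul_eq_mul, ← skeleton_smul]
      congr 1
      · funext d τ σ; simp only [Pi.smul_apply, smul_eq_C_mul]; ring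
      · funext d s τ; simp only [Pi.smul_apply, smul_eq_C_mul]; ring)

@[simp] lemma fluxForm_apply (κ : M.fine → ℝ) (v w : M.Fun) :
    M.fluxForm κ v w = M.flux κ v w := rfl

/-- The form of the DG norm. -/
def dgForm (κ : M.fine → ℝ) (γ : ℝ) : M.Fun →ₗ[ℝ] M.Fun →ₗ[ℝ] ℝ :=
  ∑ K, M.aLocForm κ K + (γ / M.h) • M.penaltyForm κ

lemma dgForm_apply (κ : M.fine → ℝ) (γ : ℝ) (v w : M.Fun) :
    M.dgForm κ γ v w = (∑ K, M.aLoc κ K v w) + γ / M.h * M.penalty κ v w := by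
  simp [dgForm, LinearMap.sum_apply]

lemma dgForm_self (κ : M.fine → ℝ) (γ : ℝ) (v : M.Fun) :
    M.dgForm κ γ v v = M.normDGsq κ γ v := M.dgForm_apply κ γ v v

lemma dgForm_comm (κ : M.fine → ℝ) (γ : ℝ) (v w : M.Fun) :
    M.dgForm κ γ v w = M.dgForm κ γ w v := by
  simp only [dgForm_apply, M.aLoc_comm κ _ v w, M.penalty_comm κ v w]

/-- `a_DG` as a bilinear map. -/
def aForm (κ : M.fine → ℝ) (γ : ℝ) : M.Fun →ₗ[ℝ] M.Fun →ₗ[ℝ] ℝ :=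
  M.dgForm κ γ - M.fluxForm κ - (M.fluxForm κ).flip

@[simp] lemma aForm_apply (κ : M.fine → ℝ) (γ : ℝ) (v w : M.Fun) :
    M.aForm κ γ v w = M.aDG κ γ v w := by
  simp only [aForm, LinearMap.sub_apply, dgForm_apply, fluxForm_apply, LinearMap.flip_apply, aDG]
  ring

lemma aDG_comm (κ : M.fine → ℝ) (γ : ℝ) (v w : M.Fun) :
    M.aDG κ γ v w = M.aDG κ γ w v := by
  simp only [aDG, M.aLoc_comm κ _ v w, M.penalty_comm κ v w]
  ring

end

/-- Functions whose supports do not touch are orthogonal. -/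
lemma aDG_eq_zero_of_not_touching (κ : M.fine → ℝ) (γ : ℝ) {v w : M.Fun}
    (h : ∀ τ σ : M.fine, ((M.parent τ).1.carrier ∩ (M.parent σ).1.carrier).Nonempty →
      v τ = 0 ∨ w σ = 0) : M.aDG κ γ v w = 0 := by
  classical
  have hself : ∀ τ, v τ = 0 ∨ w τ = 0 := fun τ =>
    h τ τ (by
      rw [Set.inter_self]
      exact ⟨_, Set.left_mem_Icc.2 (M.parent τ).1.lo_le_hi⟩)
  have hpre : ∀ d (τ σ : M.fine), τ.1.Precedes d σ.1 →
      ((M.parent τ).1.carrier ∩ (M.parent σ).1.carrier).Nonempty := fun d τ σ hp =>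
    ⟨pt d (τ.1.hi d) (τ.1.lo (d + 1)),
      M.parent_sub τ (τ.1.vertices_subset (edge_vertex τ.1 d (Or.inr rfl) (Or.inl rfl))),
      M.parent_sub σ (σ.1.vertices_subset (precedes_vertex hp (Or.inl rfl)))⟩
  have hcases : ∀ d (τ σ : M.fine), τ.1.Precedes d σ.1 →
      (v τ = 0 ∧ v σ = 0) ∨ (w τ = 0 ∧ w σ = 0) := fun d τ σ hp => by
    have h1 := hself τ
    have h2 := hself σ
    have h3 := h τ σ (hpre d τ σ hp)
    have h4 := h σ τ (by rw [Set.inter_comm]; exact hpre d τ σ hp)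
    tauto
  have ha : ∀ K, M.aLoc κ K v w = 0 := fun K => by
    rw [aLoc]
    refine Finset.sum_eq_zero fun τ _ => ?_
    rcases hself τ with h | h <;>
      simp only [h, gradDot, map_zero, zero_mul, mul_zero, Finset.sum_const_zero,
        Rect.integral_zero', ite_self]
  have hf : ∀ v w : M.Fun, (∀ τ, v τ = 0 ∨ w τ = 0) → (∀ d (τ σ : M.fine), τ.1.Precedes d σ.1 →
      (v τ = 0 ∧ v σ = 0) ∨ (w τ = 0 ∧ w σ = 0)) → M.flux κ v w = 0 := by
    intro v w h1 h2
    refine M.skeleton_eq_zero (fun d τ σ hp => ?_) fun d s τ => ?_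
    · rcases h2 d τ σ hp with ⟨h, h'⟩ | ⟨h, h'⟩ <;> simp [h, h']
    · rcases h1 τ with h | h <;> simp [h]
  have hp : M.penalty κ v w = 0 := by
    refine M.skeleton_eq_zero (fun d τ σ hp => ?_) fun d s τ => ?_
    · rcases hcases d τ σ hp with ⟨h, h'⟩ | ⟨h, h'⟩ <;> simp [h, h']
    · rcases hself τ with h | h <;> simp [h]
  rw [aDG, Finset.sum_eq_zero fun K _ => ha K, hf v w hself hcases,
    hf w v (fun τ => (hself τ).symm) (fun d τ σ h => (hcases d τ σ h).symm), hp]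
  simp

lemma sum_ite_parent (f : M.fine → ℝ) [∀ τ K, Decidable (M.parent τ = K)] :
    ∑ K : M.coarse, ∑ τ : M.fine, (if M.parent τ = K then f τ else 0) = ∑ τ, f τ := by
  rw [Finset.sum_comm]
  exact Finset.sum_congr rfl fun τ _ => by
    rw [Finset.sum_eq_single (M.parent τ)] <;> simp +contextual [eq_comm]

lemma sum_aLoc (κ : M.fine → ℝ) (v w : M.Fun) :
    ∑ K, M.aLoc κ K v w = ∑ τ : M.fine, κ τ * τ.1.integral (gradDot (v τ) (w τ)) := by
  classical
  exact M.sum_ite_parent (fun τ => _)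

lemma s_eq_sum (κ : M.fine → ℝ) (χ : Pt → M.Fun) (v w : M.Fun) :
    M.s κ χ v w = ∑ τ : M.fine, τ.1.integral (M.kTilde κ χ τ * v τ * w τ) := by
  classical
  exact M.sum_ite_parent (fun τ => _)

variable {κ : M.fine → ℝ} (hκ : ∀ τ, 0 < κ τ) (χ : Pt → M.Fun)

lemma eval_Θ_nonneg (τ : M.fine) (x : Pt) : 0 ≤ eval x (M.Θ χ τ) := by
  rw [Θ, map_sum]
  exact Finset.sum_nonneg fun z _ => by rw [Rect.eval_gradDot_self]; positivity

include hκ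

lemma eval_kTilde_nonneg (τ : M.fine) (x : Pt) : 0 ≤ eval x (M.kTilde κ χ τ) := by
  rw [kTilde, map_mul, eval_C]
  exact mul_nonneg (hκ τ).le (M.eval_Θ_nonneg χ τ x)

lemma integral_kTilde_sq_nonneg (τ : M.fine) (p : Poly) :
    0 ≤ τ.1.integral (M.kTilde κ χ τ * p * p) :=
  τ.1.integral_nonneg' fun x _ => by
    rw [map_mul, map_mul, mul_assoc]
    exact mul_nonneg (M.eval_kTilde_nonneg hκ χ τ x) (mul_self_nonneg _)

lemma sLoc_self_nonneg (K : M.coarse) (v : M.Fun) : 0 ≤ M.sLoc κ χ K v v :=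
  Finset.sum_nonneg fun τ _ => by
    split_ifs
    · exact M.integral_kTilde_sq_nonneg hκ χ τ _
    · exact le_rfl

lemma aLoc_self_nonneg (K : M.coarse) (v : M.Fun) : 0 ≤ M.aLoc κ K v v :=
  Finset.sum_nonneg fun τ _ => by
    split_ifs
    · exact mul_nonneg (hκ τ).le (τ.1.gradDot_integral_nonneg _)
    · exact le_rfl

lemma s_self_nonneg (v : M.Fun) : 0 ≤ M.s κ χ v v :=
  Finset.sum_nonneg fun K _ => M.sLoc_self_nonneg hκ χ K v

lemma kMax_nonneg (K : M.coarse) : 0 ≤ M.kMax κ K :=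
  Real.iSup_nonneg fun τ => (hκ τ.1).le

lemma penalty_self_nonneg (v : M.Fun) : 0 ≤ M.penalty κ v v := by
  have hk := M.kMax_nonneg hκ
  have hG : ∀ (τ : M.fine) (d : Fin 2) (c : ℝ),
      0 ≤ τ.1.edgeIntegral d c (C (M.kMax κ (M.parent τ)) * v τ * v τ) := fun τ d c =>
    τ.1.edgeIntegral_nonneg d c fun t _ => by
      rw [map_mul, map_mul, eval_C, mul_assoc]
      exact mul_nonneg (hk _) (mul_self_nonneg _)
  unfold penalty skeleton
  refine add_nonneg (add_nonneg ?_ ?_) ?_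
  · refine Finset.sum_nonneg fun d _ => Finset.sum_nonneg fun τ _ => Finset.sum_nonneg
      fun σ _ => ?_
    split_ifs
    · refine τ.1.edgeIntegral_nonneg d _ fun t _ => ?_
      rw [map_mul, map_mul, eval_C, mul_assoc]
      exact mul_nonneg (by linarith [hk (M.parent τ), hk (M.parent σ)]) (mul_self_nonneg _)
    · exact le_rfl
  · refine Finset.sum_nonneg fun d _ => Finset.sum_nonneg fun τ _ => ?_
    split_ifs
    exacts [hG _ _ _, le_rfl]
  · refine Finset.sum_nonneg fun d _ => Finset.sum_nonneg fun τ _ => ?_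
    split_ifs
    exacts [hG _ _ _, le_rfl]

omit hκ in
lemma h_nonneg : 0 ≤ M.h := Real.iSup_nonneg fun _ => Real.sqrt_nonneg _

omit hκ in
lemma diam_le_h (τ : M.fine) : τ.1.diam ≤ M.h :=
  le_ciSup (f := fun τ : M.fine => τ.1.diam) (Set.finite_range _).bddAbove τ

omit hκ in
lemma h_pos (τ : M.fine) : 0 < M.h := τ.1.diam_pos.trans_le (M.diam_le_h τ)

lemma normDGsq_nonneg {γ : ℝ} (hγ : 0 < γ) (v : M.Fun) : 0 ≤ M.normDGsq κ γ v :=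
  add_nonneg (Finset.sum_nonneg fun K _ => M.aLoc_self_nonneg hκ K v)
    (mul_nonneg (div_nonneg hγ.le (M.h_nonneg)) (M.penalty_self_nonneg hκ v))

omit hκ

variable (κ) in
open Classical in
/-- For functions which vanish on the boundary of the domain, the penalty term is a sum over the
fine edges between different coarse blocks. -/
lemma penalty_eq_sum {S : Set M.coarse} {v : M.Fun} (hv : v ∈ M.VhOn S) :
    M.penalty κ v v = ∑ e : Fin 2 × M.fine × M.fine with
      e.2.1.1.Precedes e.1 e.2.2.1 ∧ M.parent e.2.1 ≠ M.parent e.2.2,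
      (M.kMax κ (M.parent e.2.1) + M.kMax κ (M.parent e.2.2)) / 2 *
        e.2.1.1.edgeIntegral e.1 (e.2.1.1.hi e.1) ((v e.2.1 - v e.2.2) ^ 2) := by
  -- Both end points of a boundary edge lie on the boundary of the domain, and a bilinear trace is
  -- determined by its end point values.
  have hz : ∀ (τ : M.fine) (d : Fin 2) (c : ℝ), (c = τ.1.lo d ∨ c = τ.1.hi d) →
      (∀ t, t = τ.1.lo (d + 1) ∨ t = τ.1.hi (d + 1) → pt d c t ∈ frontier M.Ω) →
      τ.1.edgeIntegral d c (C (M.kMax κ (M.parent τ)) * v τ * v τ) = 0 := by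
    intro τ d c hc hfr
    rw [mul_assoc, ← Rect.edgeHom_apply, C_mul', map_smul, Rect.edgeHom_apply, ← sq,
      τ.1.edgeIntegral_eq_zero (hv.1.1 τ), smul_zero] <;>
    refine hv.2.1 τ _ ⟨τ.1.vertices_subset (edge_vertex τ.1 d hc ?_), hfr _ ?_⟩ <;> simp
  unfold penalty skeleton
  rw [Finset.sum_eq_zero (s := Finset.univ) (f := fun d : Fin 2 => ∑ τ : M.fine,
      if ∀ σ : M.fine, ¬ τ.1.Precedes d σ.1 then τ.1.edgeIntegral d (τ.1.hi d)
        (C (M.kMax κ (M.parent τ)) * v τ * v τ) else 0),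
    Finset.sum_eq_zero (s := Finset.univ) (f := fun d : Fin 2 => ∑ τ : M.fine,
      if ∀ σ : M.fine, ¬ σ.1.Precedes d τ.1 then τ.1.edgeIntegral d (τ.1.lo d)
        (C (M.kMax κ (M.parent τ)) * v τ * v τ) else 0), add_zero, add_zero, Finset.sum_filter,
    Fintype.sum_prod_type]
  · refine Finset.sum_congr rfl fun d _ => ?_
    rw [Fintype.sum_prod_type]
    refine Finset.sum_congr rfl fun τ _ => Finset.sum_congr rfl fun σ _ => ?_
    refine if_congr Iff.rfl ?_ rfl
    simp only
    rw [mul_assoc, ← Rect.edgeHom_apply, C_mul', map_smul, Rect.edgeHom_apply, ← sq, smul_eq_mul]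
  · intro d _
    refine Finset.sum_eq_zero fun τ _ => ?_
    split_ifs with h
    · exact hz τ d _ (Or.inl rfl) fun t ht => M.lo_edge_mem_frontier h ht
    · rfl
  · intro d _
    refine Finset.sum_eq_zero fun τ _ => ?_
    split_ifs with h
    · exact hz τ d _ (Or.inr rfl) fun t ht => M.hi_edge_mem_frontier h ht
    · rfl

include hκ in
/-- Comparison of penalty terms edge by edge. -/
lemma sum_penalty_le {ι ι' : Type*} (s : Finset ι) (s' : Finset ι') {v : ι → M.Fun}
    {w : ι' → M.Fun} {S S' : Set M.coarse} (hv : ∀ i ∈ s, v i ∈ M.VhOn S)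
    (hw : ∀ i ∈ s', w i ∈ M.VhOn S') (c : ℝ)
    (h : ∀ (d : Fin 2) (τ σ : M.fine), τ.1.Precedes d σ.1 → M.parent τ ≠ M.parent σ →
      ∑ i ∈ s, τ.1.edgeIntegral d (τ.1.hi d) ((v i τ - v i σ) ^ 2) ≤
        c * ∑ i ∈ s', τ.1.edgeIntegral d (τ.1.hi d) ((w i τ - w i σ) ^ 2)) :
    ∑ i ∈ s, M.penalty κ (v i) (v i) ≤ c * ∑ i ∈ s', M.penalty κ (w i) (w i) := by
  classical
  rw [Finset.sum_congr rfl fun i hi => M.penalty_eq_sum κ (hv i hi),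
    Finset.sum_congr rfl fun i hi => M.penalty_eq_sum κ (hw i hi), Finset.sum_comm,
    Finset.sum_comm (s := s'), Finset.mul_sum]
  refine Finset.sum_le_sum fun e he => ?_
  rw [← Finset.mul_sum, ← Finset.mul_sum, mul_left_comm]
  obtain ⟨h1, h2⟩ := (Finset.mem_filter.1 he).2
  refine mul_le_mul_of_nonneg_left (h _ _ _ h1 h2) ?_
  have := M.kMax_nonneg hκ (M.parent e.2.1)
  have := M.kMax_nonneg hκ (M.parent e.2.2)
  positivity

end Mesh

end CEM

/-! ### Cut-off, fine interpolation, and the multiscale partition of unity. -/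

namespace CEM

open MvPolynomial

namespace Mesh

variable (M : Mesh)

noncomputable section

open Classical in
/-- The restriction of a function to the coarse blocks in `S`, extended by zero. -/
def cut (S : Set M.coarse) : M.Fun →ₗ[ℝ] M.Fun where
  toFun v τ := if M.parent τ ∈ S then v τ else 0
  map_add' v w := by funext τ; simp only [Pi.add_apply]; split_ifs <;> simp
  map_smul' c v := by funext τ; simp only [Pi.smul_apply, RingHom.id_apply]; split_ifs <;> simp

/-- The fine grid interpolation at the vertices. -/
def Ih : M.Fun →ₗ[ℝ] M.Fun where
  toFun v τ := τ.1.interp (v τ)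
  map_add' v w := by funext τ; simp
  map_smul' c v := by funext τ; simp

/-- The coarse blocks with vertex `z`. -/
def star (z : Pt) : Set M.coarse := {K | z ∈ K.1.vertices}

end

lemma cut_of_mem {S : Set M.coarse} {τ : M.fine} (h : M.parent τ ∈ S) (v : M.Fun) :
    M.cut S v τ = v τ := if_pos h

lemma cut_of_notMem {S : Set M.coarse} {τ : M.fine} (h : M.parent τ ∉ S) (v : M.Fun) :
    M.cut S v τ = 0 := if_neg h

lemma Ih_apply (v : M.Fun) (τ : M.fine) : M.Ih v τ = τ.1.interp (v τ) := rfl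

lemma cut_mem_broken {k : ℕ} {v : M.Fun} (hv : v ∈ M.broken k) (S : Set M.coarse) :
    M.cut S v ∈ M.broken k := by
  refine ⟨fun τ => ?_, fun τ σ hp x hx => ?_⟩
  · by_cases h : M.parent τ ∈ S
    · rw [M.cut_of_mem h]; exact hv.1 τ
    · rw [M.cut_of_notMem h]; exact zero_mem _
  · by_cases h : M.parent τ ∈ S
    · rw [M.cut_of_mem h, M.cut_of_mem (hp ▸ h)]; exact hv.2 τ σ hp x hx
    · rw [M.cut_of_notMem h, M.cut_of_notMem (hp ▸ h)]

lemma cut_mem_VhOn {S' : Set M.coarse} {v : M.Fun} (hv : v ∈ M.VhOn S') (S : Set M.coarse) :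
    M.cut S v ∈ M.VhOn S := by
  refine ⟨M.cut_mem_broken hv.1 S, fun τ x hx => ?_, fun τ hτ => M.cut_of_notMem hτ v⟩
  by_cases h : M.parent τ ∈ S
  · rw [M.cut_of_mem h]; exact hv.2.1 τ x hx
  · rw [M.cut_of_notMem h, map_zero]

lemma VhOn_mono {S S' : Set M.coarse} (h : S ⊆ S') : M.VhOn S ≤ M.VhOn S' :=
  fun _ hv => ⟨hv.1, hv.2.1, fun τ hτ => hv.2.2 τ fun h' => hτ (h h')⟩

lemma VhOn_le_Vh (S : Set M.coarse) : M.VhOn S ≤ M.Vh := M.VhOn_mono (Set.subset_univ S)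

lemma broken_mono {k l : ℕ} (h : k ≤ l) : M.broken k ≤ M.broken l :=
  fun _ hv => ⟨fun τ => restrictDegree_mono h (hv.1 τ), hv.2⟩

/-- Continuity and boundary conditions of a bilinear interpolant are decided at vertices, so they
are inherited from a function of any degree. -/
lemma Ih_mem_VhOn {S : Set M.coarse} {v : M.Fun}
    (hc : ∀ τ σ, M.parent τ = M.parent σ → ∀ x ∈ τ.1.carrier ∩ σ.1.carrier,
      eval x (v τ) = eval x (v σ))
    (hz : ∀ τ, ∀ x ∈ τ.1.carrier ∩ frontier M.Ω, eval x (v τ) = 0)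
    (hS : ∀ τ, M.parent τ ∉ S → v τ = 0) : M.Ih v ∈ M.VhOn S := by
  refine ⟨⟨fun τ => τ.1.interp_mem _, fun τ σ hp x hx => ?_⟩, fun τ x hx => ?_, fun τ hτ => ?_⟩
  · refine M.fine_conforming.eval_eq τ.2 σ.2 hx.1 hx.2 (τ.1.interp_mem _) (σ.1.interp_mem _)
      fun p hpτ hpσ => ?_
    rw [Ih_apply, Ih_apply, τ.1.eval_interp hpτ, σ.1.eval_interp hpσ]
    exact hc τ σ hp p ⟨τ.1.vertices_subset hpτ, σ.1.vertices_subset hpσ⟩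
  · refine τ.1.eval_eq_zero_of_face (τ.1.interp_mem _) x fun p hp hlo hhi => ?_
    rw [τ.1.eval_interp hp]
    exact hz τ p ⟨τ.1.vertices_subset hp, M.mem_frontier_Ω_of_face hx.1 hp hlo hhi hx.2⟩
  · rw [Ih_apply, hS τ hτ, map_zero]

lemma Ih_eq_self {v : M.Fun} (hv : v ∈ M.broken 1) : M.Ih v = v :=
  funext fun τ => τ.1.interp_eq_self (hv.1 τ)

lemma eval_Ih {τ : M.fine} {x : Pt} (hx : x ∈ τ.1.vertices) (v : M.Fun) :
    eval x (M.Ih v τ) = eval x (v τ) := τ.1.eval_interp hx _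

lemma mul_continuous {k l : ℕ} {v w : M.Fun} (hv : v ∈ M.broken k) (hw : w ∈ M.broken l) :
    v * w ∈ M.broken (k + l) :=
  ⟨fun τ => mul_mem_restrictDegree (hv.1 τ) (hw.1 τ), fun τ σ hp x hx => by
    simp only [Pi.mul_apply, map_mul, hv.2 τ σ hp x hx, hw.2 τ σ hp x hx]⟩

/-- The interpolant of the product of a continuous function with an element of the DG space. -/
lemma Ih_mul_mem {k : ℕ} {b w : M.Fun} (hb : b ∈ M.broken k) {S : Set M.coarse}
    (hw : w ∈ M.VhOn S) : M.Ih (b * w) ∈ M.VhOn S := by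
  refine M.Ih_mem_VhOn (M.mul_continuous hb hw.1).2 (fun τ x hx => ?_) fun τ hτ => ?_
  · rw [Pi.mul_apply, map_mul, hw.2.1 τ x hx, mul_zero]
  · rw [Pi.mul_apply, hw.2.2 τ hτ, mul_zero]

section Uniqueness

variable {M} {κ : M.fine → ℝ} (hκ : ∀ τ, 0 < κ τ)

include hκ

/-- Zero energy gives a constant on each fine block. If two constants differed, the blocks carrying
the first constant and the remaining ones would form two closed sets covering the connected coarse
block; continuity at a common point contradicts this. -/
lemma exists_const_of_aLoc_eq_zero {v : M.Fun} (hv : v ∈ M.broken 1) {K : M.coarse}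
    (h : M.aLoc κ K v v = 0) : ∃ c, ∀ τ, M.parent τ = K → v τ = C c := by
  classical
  have h1 : ∀ τ, M.parent τ = K → ∃ c, v τ = C c := fun τ hτ => by
    have := (Finset.sum_eq_zero_iff_of_nonneg (fun τ _ => by
      split_ifs
      · exact mul_nonneg (hκ τ).le (τ.1.gradDot_integral_nonneg _)
      · exact le_rfl)).1 h τ (Finset.mem_univ τ)
    rw [if_pos hτ] at this
    exact τ.1.exists_eq_C_of_integral_gradDot
      ((mul_eq_zero.1 this).resolve_left (hκ τ).ne')
  choose! c hc using h1
  obtain ⟨τ0, hτ0, -⟩ := M.parent_cover K _ (Set.left_mem_Icc.2 K.1.lo_le_hi)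
  refine ⟨c τ0, fun τ hτ => ?_⟩
  rw [hc τ hτ]
  congr 1
  by_contra hne
  have hpre : IsPreconnected K.1.carrier := by
    rw [Rect.carrier, ← Set.pi_univ_Icc]
    exact isPreconnected_univ_pi fun d => isPreconnected_Icc
  have hclosed : ∀ P : M.fine → Prop, IsClosed (⋃ σ : {σ : M.fine // M.parent σ = K ∧ P σ},
      σ.1.1.carrier) := fun P => isClosed_iUnion_of_finite fun σ => σ.1.1.isClosed_carrier
  have hA := hclosed fun σ => c σ = c τ0
  have hB := hclosed fun σ => c σ ≠ c τ0
  have hcov : K.1.carrier ⊆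
      (⋃ σ : {σ : M.fine // M.parent σ = K ∧ c σ = c τ0}, σ.1.1.carrier) ∪
      ⋃ σ : {σ : M.fine // M.parent σ = K ∧ c σ ≠ c τ0}, σ.1.1.carrier := fun x hx => by
    obtain ⟨σ, hσ, hxσ⟩ := M.parent_cover K x hx
    by_cases h : c σ = c τ0
    · exact Or.inl (Set.mem_iUnion.2 ⟨⟨σ, hσ, h⟩, hxσ⟩)
    · exact Or.inr (Set.mem_iUnion.2 ⟨⟨σ, hσ, h⟩, hxσ⟩)
  have hlo : ∀ σ : M.fine, M.parent σ = K → (σ.1.lo ∈ K.1.carrier ∧ σ.1.lo ∈ σ.1.carrier) :=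
    fun σ hσ => ⟨hσ ▸ M.parent_sub σ (Set.left_mem_Icc.2 σ.1.lo_le_hi),
      Set.left_mem_Icc.2 σ.1.lo_le_hi⟩
  obtain ⟨x, hx, hxA, hxB⟩ := isPreconnected_closed_iff.1 hpre _ _ hA hB hcov
    ⟨_, (hlo τ0 hτ0).1, Set.mem_iUnion.2 ⟨⟨τ0, hτ0, rfl⟩, (hlo τ0 hτ0).2⟩⟩
    ⟨_, (hlo τ hτ).1, Set.mem_iUnion.2 ⟨⟨τ, hτ, hne⟩, (hlo τ hτ).2⟩⟩
  obtain ⟨⟨σ, hσ, hcσ⟩, hxσ⟩ := Set.mem_iUnion.1 hxA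
  obtain ⟨⟨ρ, hρ, hcρ⟩, hxρ⟩ := Set.mem_iUnion.1 hxB
  have := hv.2 σ ρ (hσ.trans hρ.symm) x ⟨hxσ, hxρ⟩
  rw [hc σ hσ, hc ρ hρ, eval_C, eval_C] at this
  exact hcρ (this ▸ hcσ)

lemma eq_zero_of_aLoc_eq_zero {v : M.Fun} (hv : v ∈ M.broken 1) {K : M.coarse}
    (h : M.aLoc κ K v v = 0)
    (hb : ∀ τ : M.fine, M.parent τ = K → ∀ x ∈ τ.1.carrier ∩ frontier K.1.carrier,
      eval x (v τ) = 0) : ∀ τ, M.parent τ = K → v τ = 0 := by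
  obtain ⟨c, hc⟩ := exists_const_of_aLoc_eq_zero hκ hv h
  have hlo : K.1.lo ∈ K.1.carrier := Set.left_mem_Icc.2 K.1.lo_le_hi
  obtain ⟨τ0, hτ0, hx⟩ := M.parent_cover K _ hlo
  have := hb τ0 hτ0 _ ⟨hx, K.1.mem_frontier.2 ⟨hlo, 0, Or.inl rfl⟩⟩
  rw [hc τ0 hτ0, eval_C] at this
  intro τ hτ
  rw [hc τ hτ, this, C_0]

variable {χ : Pt → M.Fun} (hχ : M.IsMsBasis κ χ)

include hχ

/-- The basis function of a coarse node vanishes on the coarse blocks without this vertex. -/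
lemma msBasis_eq_zero {z : Pt} (hz : z ∈ M.nodes) {τ : M.fine}
    (h : z ∉ (M.parent τ).1.vertices) : χ z τ = 0 := by
  classical
  obtain ⟨h1, h2, h3⟩ := hχ z hz
  set K := M.parent τ with hK
  -- The boundary data of `χ z` on this block are zero, so its restriction is an admissible test
  -- function in its own discrete equation.
  have hw : M.cut {K} (χ z) ∈ M.broken 1 := M.cut_mem_broken h1 _
  have hb : ∀ σ : M.fine, ∀ x ∈ σ.1.carrier ∩ frontier (M.parent σ).1.carrier,
      eval x (M.cut {K} (χ z) σ) = 0 := fun σ x hx => by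
    by_cases hσ : M.parent σ = K
    · rw [M.cut_of_mem (Set.mem_singleton_iff.2 hσ), h2 σ x hx, hσ, K.1.hat_of_notMem h]
    · rw [M.cut_of_notMem (mt Set.mem_singleton_iff.1 hσ), map_zero]
  have h0 := h3 K _ hw hb
  have h4 : M.aLoc κ K (M.cut {K} (χ z)) (M.cut {K} (χ z)) = 0 := by
    rw [← h0]
    refine Finset.sum_congr rfl fun σ _ => ?_
    split_ifs with hσ
    · rw [M.cut_of_mem (Set.mem_singleton_iff.2 hσ)]
    · rfl
  have := eq_zero_of_aLoc_eq_zero hκ hw h4 (fun σ hσ x hx => hb σ x (by rwa [hσ])) τ rfl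
  rwa [M.cut_of_mem (Set.mem_singleton_iff.2 hK.symm)] at this

/-- The multiscale basis functions form a partition of unity. -/
lemma sum_msBasis (τ : M.fine) : ∑ z ∈ M.nodes, χ z τ = 1 := by
  classical
  set v : M.Fun := ∑ z ∈ M.nodes, χ z - 1 with hv
  have hone : (1 : M.Fun) ∈ M.broken 1 :=
    ⟨fun τ => by simpa using C_mem_restrictDegree 1 1, fun τ σ _ x _ => by simp⟩
  have hvm : v ∈ M.broken 1 :=
    Submodule.sub_mem _ (Submodule.sum_mem _ fun z hz => (hχ z hz).1) hone
  have hb : ∀ σ : M.fine, ∀ x ∈ σ.1.carrier ∩ frontier (M.parent σ).1.carrier,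
      eval x (v σ) = 0 := fun σ x hx => by
    have hsub : (M.parent σ).1.vertices ⊆ M.nodes :=
      Finset.subset_biUnion_of_mem Rect.vertices (M.parent σ).2
    rw [hv, Pi.sub_apply, Finset.sum_apply, map_sub, map_sum, Pi.one_apply, map_one,
      Finset.sum_congr rfl fun z hz => (hχ z hz).2.1 σ x hx,
      ← Finset.sum_subset hsub fun z _ hz => (M.parent σ).1.hat_of_notMem hz x,
      (M.parent σ).1.sum_hat (M.parent_sub σ hx.1), sub_self]
  have h0 : M.aLoc κ (M.parent τ) v v = 0 := by
    have h1 : M.aLocForm κ (M.parent τ) 1 v = 0 := by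
      refine Finset.sum_eq_zero fun σ _ => ?_
      simp [gradDot]
    rw [← aLocForm_apply]
    have h2 : M.aLocForm κ (M.parent τ) v v =
        M.aLocForm κ (M.parent τ) (∑ z ∈ M.nodes, χ z - 1) v := by
      rw [← hv]
    rw [h2, LinearMap.map_sub₂, LinearMap.map_sum₂, h1, sub_zero]
    exact Finset.sum_eq_zero fun z hz => (hχ z hz).2.2 _ v hvm hb
  have := eq_zero_of_aLoc_eq_zero hκ hvm h0 (fun σ hσ x hx => hb σ x (by rwa [hσ])) τ rfl
  rw [hv, Pi.sub_apply, Finset.sum_apply, sub_eq_zero] at this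
  exact this

omit hκ in
/-- The basis functions are continuous across the coarse edges. -/
lemma msBasis_trace {z : Pt} (hz : z ∈ M.nodes) {τ σ : M.fine} {x : Pt}
    (hτ : x ∈ τ.1.carrier) (hσ : x ∈ σ.1.carrier) : eval x (χ z τ) = eval x (χ z σ) := by
  by_cases h : M.parent τ = M.parent σ
  · exact (hχ z hz).1.2 τ σ h x ⟨hτ, hσ⟩
  · have hne : (M.parent τ).1 ≠ (M.parent σ).1 := fun h' => h (Subtype.ext h')
    have hxτ := M.parent_sub τ hτ
    have hxσ := M.parent_sub σ hσ
    rw [(hχ z hz).2.1 τ x ⟨hτ, M.coarse_conforming.mem_frontier (M.parent τ).2 (M.parent σ).2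
        hne hxτ hxσ⟩, (hχ z hz).2.1 σ x ⟨hσ, M.coarse_conforming.mem_frontier (M.parent σ).2
        (M.parent τ).2 hne.symm hxσ hxτ⟩]
    exact M.coarse_conforming.hat_eq (M.parent τ).2 (M.parent σ).2 hxτ hxσ z

variable (hχ_nonneg : ∀ z ∈ M.nodes, ∀ τ : M.fine, ∀ x ∈ τ.1.carrier, 0 ≤ eval x (χ z τ))

include hχ_nonneg

lemma msBasis_le_one {z : Pt} (hz : z ∈ M.nodes) {τ : M.fine} {x : Pt} (hx : x ∈ τ.1.carrier) :
    eval x (χ z τ) ≤ 1 := by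
  have h := congrArg (eval x) (sum_msBasis hκ hχ τ)
  rw [map_sum, map_one] at h
  rw [← h]
  exact Finset.single_le_sum (f := fun z => eval x (χ z τ))
    (fun z hz => hχ_nonneg z hz τ x hx) hz

lemma sum_msBasis_sq_le {τ : M.fine} {x : Pt} (hx : x ∈ τ.1.carrier) :
    ∑ z ∈ M.nodes, eval x (χ z τ) ^ 2 ≤ 1 := by
  have h := congrArg (eval x) (sum_msBasis hκ hχ τ)
  rw [map_sum, map_one] at h
  rw [← h]
  refine Finset.sum_le_sum fun z hz => ?_
  have := hχ_nonneg z hz τ x hx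
  have := msBasis_le_one hκ hχ hχ_nonneg hz hx
  nlinarith

omit hκ hχ hχ_nonneg in
lemma vertices_subset_nodes (K : M.coarse) : K.1.vertices ⊆ M.nodes :=
  Finset.subset_biUnion_of_mem Rect.vertices K.2

lemma bubble_mem_Icc {τ : M.fine} {x : Pt} (hx : x ∈ τ.1.carrier) :
    eval x (M.bubble χ τ) ∈ Set.Icc (0 : ℝ) 1 := by
  rw [bubble, map_prod]
  exact ⟨Finset.prod_nonneg fun z hz => hχ_nonneg z (vertices_subset_nodes _ hz) τ x hx,
    Finset.prod_le_one (fun z hz => hχ_nonneg z (vertices_subset_nodes _ hz) τ x hx)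
      fun z hz => msBasis_le_one hκ hχ hχ_nonneg (vertices_subset_nodes _ hz) hx⟩

omit hκ hχ_nonneg

/-- A boundary point lies on a side of the coarse block, and the hat function of a vertex off that
side vanishes there. -/
lemma bubble_eq_zero {τ : M.fine} {x : Pt}
    (hx : x ∈ τ.1.carrier ∩ frontier (M.parent τ).1.carrier) : eval x (M.bubble χ τ) = 0 := by
  obtain ⟨z, hz, h0⟩ := (M.parent τ).1.exists_vertex_hat_eq_zero hx.2
  rw [bubble, map_prod]
  refine Finset.prod_eq_zero hz ?_
  rw [(hχ z (vertices_subset_nodes _ hz)).2.1 τ x hx, h0]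

/-- Four vertices give four bilinear factors. Multiplied by a function in the DG space the bubble is
of degree at most 5, the degree admitted in the interpolation and Poincaré estimates. -/
lemma bubble_mem_broken : M.bubble χ ∈ M.broken 4 := by
  refine ⟨fun τ => ?_, fun τ σ hp x hx => ?_⟩
  · rw [← (M.parent τ).1.card_vertices]
    exact prod_mem_restrictDegree _ _ fun z hz => (hχ z (vertices_subset_nodes _ hz)).1.1 τ
  · rw [bubble, bubble, ← hp, map_prod, map_prod]
    exact Finset.prod_congr rfl fun z hz => (hχ z (vertices_subset_nodes _ hz)).1.2 τ σ hp x hx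

end Uniqueness

/-! ### Energy and weighted L² bounds for the interpolation error. -/

section Interpolation

variable {M} {κ : M.fine → ℝ} (hκ : ∀ τ, 0 < κ τ) {χ : Pt → M.Fun} {CI : ℝ}
  (hCI : M.IsInterpConst κ χ CI)

lemma bddAbove_Θ (S : Set M.coarse) : BddAbove {t | ∃ τ : M.fine, M.parent τ ∈ S ∧
    ∃ x ∈ τ.1.carrier, t = eval x (M.Θ χ τ)} := by
  have h : ∀ τ : M.fine, ∃ b, ∀ x ∈ τ.1.carrier, eval x (M.Θ χ τ) ≤ b := fun τ => by
    obtain ⟨b, hb⟩ := (isCompact_Icc (a := τ.1.lo) (b := τ.1.hi)).bddAbove_image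
      (MvPolynomial.continuous_eval (M.Θ χ τ)).continuousOn
    exact ⟨b, fun x hx => hb ⟨x, hx, rfl⟩⟩
  choose b hb using h
  obtain ⟨B, hB⟩ := (Set.finite_range b).bddAbove
  refine ⟨B, ?_⟩
  rintro t ⟨τ, -, x, hx, rfl⟩
  exact (hb τ x hx).trans (hB ⟨τ, rfl⟩)

lemma eval_Θ_le {S : Set M.coarse} {τ : M.fine} (hτ : M.parent τ ∈ S) {x : Pt}
    (hx : x ∈ τ.1.carrier) : eval x (M.Θ χ τ) ≤ M.ΘSup χ S :=
  le_csSup (bddAbove_Θ S) ⟨τ, hτ, x, hx, rfl⟩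

lemma ΘSup_nonneg (S : Set M.coarse) : 0 ≤ M.ΘSup χ S := by
  refine Real.sSup_nonneg ?_
  rintro t ⟨τ, -, x, -, rfl⟩
  exact M.eval_Θ_nonneg χ τ x

lemma ΘSup_le_univ (S : Set M.coarse) : M.ΘSup χ S ≤ M.ΘSup χ Set.univ := by
  refine Real.sSup_le ?_ (ΘSup_nonneg _)
  rintro t ⟨τ, -, x, hx, rfl⟩
  exact eval_Θ_le (Set.mem_univ _) hx

include hκ hCI

lemma interp_error_energy_le (τ : M.fine) {u : Poly} (hu : u ∈ restrictDegree (Fin 2) ℝ 5)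
    (hz : ∀ x ∈ τ.1.carrier ∩ frontier M.Ω, eval x u = 0) :
    κ τ * τ.1.integral (gradDot (u - τ.1.interp u) (u - τ.1.interp u)) ≤
      CI ^ 2 * (κ τ * τ.1.integral (gradDot u u)) := by
  have h := hCI.2 τ u hu hz (τ.1.interp u) (τ.1.interp_mem u) fun x hx => τ.1.eval_interp hx u
  have hh := M.h_pos τ
  have hC : 0 ≤ CI := zero_le_one.trans hCI.1
  have h1 : M.h * √(κ τ * τ.1.integral (gradDot (u - τ.1.interp u) (u - τ.1.interp u))) ≤
      M.h * (CI * √(κ τ * τ.1.integral (gradDot u u))) := by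
    have := Real.sqrt_nonneg (τ.1.integral (M.kTilde κ χ τ * (u - τ.1.interp u) ^ 2))
    linarith
  have h2 := le_of_mul_le_mul_left h1 hh
  have hn := mul_nonneg (hκ τ).le (τ.1.gradDot_integral_nonneg u)
  have hn' := mul_nonneg (hκ τ).le (τ.1.gradDot_integral_nonneg (u - τ.1.interp u))
  have h3 := pow_le_pow_left₀ (Real.sqrt_nonneg _) h2 2
  rwa [mul_pow, Real.sq_sqrt hn, Real.sq_sqrt hn'] at h3

lemma interp_energy_le (τ : M.fine) {u : Poly} (hu : u ∈ restrictDegree (Fin 2) ℝ 5)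
    (hz : ∀ x ∈ τ.1.carrier ∩ frontier M.Ω, eval x u = 0) :
    κ τ * τ.1.integral (gradDot (τ.1.interp u) (τ.1.interp u)) ≤
      2 * (1 + CI ^ 2) * (κ τ * τ.1.integral (gradDot u u)) := by
  have h := interp_error_energy_le hκ hCI τ hu hz
  have h2 := τ.1.integral_gradDot_add_le u (-(u - τ.1.interp u))
  have h3 : gradDot (-(u - τ.1.interp u)) (-(u - τ.1.interp u)) =
      gradDot (u - τ.1.interp u) (u - τ.1.interp u) := by
    simp [gradDot, Fin.sum_univ_two]; ring
  rw [h3, neg_sub, add_sub_cancel] at h2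
  have := mul_le_mul_of_nonneg_left h2 (hκ τ).le
  linarith

/-- The smallness criterion on `h` carries the factor ‖Θ‖^{1/2}, which the weighted term of
`IsInterpConst` does not show. The bound with this factor comes from κ̃ ≤ κ ‖Θ‖, the discrete
Poincaré inequality for the error, which vanishes at the vertices, and the energy part of the
interpolation estimate. -/
lemma interp_error_s_le (τ : M.fine) {S : Set M.coarse} (hτ : M.parent τ ∈ S) {u : Poly}
    (hu : u ∈ restrictDegree (Fin 2) ℝ 5)
    (hz : ∀ x ∈ τ.1.carrier ∩ frontier M.Ω, eval x u = 0) :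
    τ.1.integral (M.kTilde κ χ τ * (u - τ.1.interp u) * (u - τ.1.interp u)) ≤
      37 / 2 * (CI ^ 2 * M.ΘSup χ S * M.h ^ 2) * (κ τ * τ.1.integral (gradDot u u)) := by
  set e := u - τ.1.interp u with he
  have hem : e ∈ restrictDegree (Fin 2) ℝ 5 :=
    Submodule.sub_mem _ hu (restrictDegree_mono (by norm_num) (τ.1.interp_mem u))
  have hlo : eval τ.1.lo e = 0 := by
    rw [he, map_sub, τ.1.eval_interp (τ.1.mem_vertices.2 fun d => Or.inl rfl), sub_self]
  have hP := τ.1.integral_sq_le_of_eval_lo_eq_zero hem hlo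
  have hE := interp_error_energy_le hκ hCI τ hu hz
  rw [← he] at hE
  have hΘ := ΘSup_nonneg (χ := χ) S
  have hd : τ.1.diam ^ 2 ≤ M.h ^ 2 :=
    pow_le_pow_left₀ τ.1.diam_pos.le (M.diam_le_h τ) 2
  have hg := τ.1.gradDot_integral_nonneg e
  have hk := (hκ τ).le
  calc τ.1.integral (M.kTilde κ χ τ * e * e)
      ≤ τ.1.integral (C (κ τ * M.ΘSup χ S) * e ^ 2) := by
        refine τ.1.integral_mono' fun x hx => ?_
        rw [kTilde, mul_assoc, ← sq, map_mul, map_mul, map_mul, eval_C, eval_C, map_pow]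
        have := eval_Θ_le (χ := χ) hτ hx
        gcongr
    _ = M.ΘSup χ S * (κ τ * τ.1.integral (e ^ 2)) := by rw [τ.1.integral_C_mul]; ring
    _ ≤ M.ΘSup χ S * (κ τ * (37 / 2 * M.h ^ 2 * τ.1.integral (gradDot e e))) := by
        gcongr
        exact hP.trans (by gcongr)
    _ = M.ΘSup χ S * (37 / 2 * M.h ^ 2) * (κ τ * τ.1.integral (gradDot e e)) := by ring
    _ ≤ M.ΘSup χ S * (37 / 2 * M.h ^ 2) * (CI ^ 2 * (κ τ * τ.1.integral (gradDot u u))) := by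
        gcongr
    _ = _ := by ring

end Interpolation

end Mesh

end CEM

/-! ### Products with the partition of unity and with the bubble functions. -/

namespace CEM

open MvPolynomial

lemma eval_gradDot_mul_le (x : Pt) (p q : Poly) :
    eval x (gradDot (p * q) (p * q)) ≤
      2 * (eval x p ^ 2 * eval x (gradDot q q)) + 2 * (eval x q ^ 2 * eval x (gradDot p p)) := by
  have key : ∀ d, eval x (pderiv d (p * q)) =
      eval x (pderiv d p) * eval x q + eval x p * eval x (pderiv d q) := fun d => by
    rw [pderiv_mul, map_add, map_mul, map_mul]
  rw [Rect.eval_gradDot_self, Rect.eval_gradDot_self, Rect.eval_gradDot_self, key, key]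
  nlinarith [sq_nonneg (eval x (pderiv 0 p) * eval x q - eval x p * eval x (pderiv 0 q)),
    sq_nonneg (eval x (pderiv 1 p) * eval x q - eval x p * eval x (pderiv 1 q))]

lemma abs_pderiv_prod_le {ι : Type*} (s : Finset ι) (f : ι → Poly) (x : Pt)
    (hf : ∀ i ∈ s, eval x (f i) ∈ Set.Icc (0 : ℝ) 1) (d : Fin 2) :
    |eval x (pderiv d (∏ i ∈ s, f i))| ≤ ∑ i ∈ s, |eval x (pderiv d (f i))| := by
  classical
  induction s using Finset.induction_on with
  | empty => simp
  | insert i s hi ih =>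
    have h1 := hf i (Finset.mem_insert_self i s)
    have hs : ∀ j ∈ s, eval x (f j) ∈ Set.Icc (0 : ℝ) 1 := fun j hj =>
      hf j (Finset.mem_insert_of_mem hj)
    have hP : |eval x (∏ j ∈ s, f j)| ≤ 1 := by
      rw [map_prod, abs_of_nonneg (Finset.prod_nonneg fun j hj => (hs j hj).1)]
      exact Finset.prod_le_one (fun j hj => (hs j hj).1) fun j hj => (hs j hj).2
    have hfi : |eval x (f i)| ≤ 1 := by rw [abs_of_nonneg h1.1]; exact h1.2
    rw [Finset.prod_insert hi, Finset.sum_insert hi, pderiv_mul, map_add, map_mul, map_mul]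
    refine (abs_add_le _ _).trans (add_le_add ?_ ?_)
    · rw [abs_mul]
      exact mul_le_of_le_one_right (abs_nonneg _) hP
    · rw [abs_mul]
      exact (mul_le_of_le_one_left (abs_nonneg _) hfi).trans (ih hs)

lemma eval_gradDot_prod_le {ι : Type*} (s : Finset ι) (f : ι → Poly) (x : Pt)
    (hf : ∀ i ∈ s, eval x (f i) ∈ Set.Icc (0 : ℝ) 1) :
    eval x (gradDot (∏ i ∈ s, f i) (∏ i ∈ s, f i)) ≤
      s.card * ∑ i ∈ s, eval x (gradDot (f i) (f i)) := by
  have key : ∀ d, eval x (pderiv d (∏ i ∈ s, f i)) ^ 2 ≤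
      s.card * ∑ i ∈ s, eval x (pderiv d (f i)) ^ 2 := fun d => by
    rw [← sq_abs]
    refine (pow_le_pow_left₀ (abs_nonneg _) (abs_pderiv_prod_le s f x hf d) 2).trans ?_
    refine sq_sum_le_card_mul_sum_sq.trans (le_of_eq ?_)
    simp only [sq_abs]
  simp only [Rect.eval_gradDot_self, Finset.sum_add_distrib, mul_add]
  exact add_le_add (key 0) (key 1)

namespace Mesh

variable {M : Mesh} {κ : M.fine → ℝ} {χ : Pt → M.Fun}

lemma sLoc_congr {K : M.coarse} {v v' w w' : M.Fun} (hv : ∀ τ, M.parent τ = K → v τ = v' τ)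
    (hw : ∀ τ, M.parent τ = K → w τ = w' τ) : M.sLoc κ χ K v w = M.sLoc κ χ K v' w' := by
  refine Finset.sum_congr rfl fun τ _ => ?_
  split_ifs with h
  · rw [hv τ h, hw τ h]
  · rfl

lemma aLoc_congr {K : M.coarse} {v v' w w' : M.Fun} (hv : ∀ τ, M.parent τ = K → v τ = v' τ)
    (hw : ∀ τ, M.parent τ = K → w τ = w' τ) : M.aLoc κ K v w = M.aLoc κ K v' w' := by
  refine Finset.sum_congr rfl fun τ _ => ?_
  split_ifs with h
  · rw [hv τ h, hw τ h]
  · rfl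

lemma cut_singleton {K : M.coarse} {τ : M.fine} (h : M.parent τ = K) (v : M.Fun) :
    M.cut {K} v τ = v τ := M.cut_of_mem (Set.mem_singleton_iff.2 h) v

lemma sLoc_cut (K : M.coarse) (v w : M.Fun) :
    M.sLoc κ χ K (M.cut {K} v) w = M.sLoc κ χ K v w :=
  sLoc_congr (fun _ h => cut_singleton h v) fun _ _ => rfl

lemma sLoc_eq_zero_right {K : M.coarse} {v w : M.Fun} (hw : ∀ τ, M.parent τ = K → w τ = 0) :
    M.sLoc κ χ K v w = 0 := by
  rw [sLoc_congr (v' := v) (w' := 0) (fun _ _ => rfl) hw]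
  exact (M.sLocForm κ χ K v).map_zero

lemma s_eq_sLoc {K : M.coarse} {w : M.Fun} (hw : ∀ τ, M.parent τ ≠ K → w τ = 0) (v : M.Fun) :
    M.s κ χ v w = M.sLoc κ χ K v w :=
  Finset.sum_eq_single K (fun K' _ hne => sLoc_eq_zero_right fun τ hτ =>
    hw τ (by rw [hτ]; exact hne)) fun h => absurd (Finset.mem_univ K) h

lemma eq_zero_off_of_mem_VhLoc {K : M.coarse} {w : M.Fun} (hw : w ∈ M.VhLoc K) :
    ∀ τ, M.parent τ ≠ K → w τ = 0 := fun τ hτ => hw.2.2 τ hτ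

/-- A rectangle has four vertices; the block `K` rules out the empty mesh, where the supremum would
be 0. -/
lemma CT_eq (K : M.coarse) : M.CT = 4 := by
  have : (M.coarse.sup fun K => K.vertices.card) = 4 := by
    refine le_antisymm (Finset.sup_le fun K _ => K.card_vertices.le) ?_
    rw [← K.1.card_vertices]
    exact Finset.le_sup (f := fun K : Rect => K.vertices.card) K.2
  rw [CT, this]
  norm_num

section Products

variable (hκ : ∀ τ, 0 < κ τ) (hχ : M.IsMsBasis κ χ)
  (hχ_nonneg : ∀ z ∈ M.nodes, ∀ τ : M.fine, ∀ x ∈ τ.1.carrier, 0 ≤ eval x (χ z τ))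

include hκ hχ hχ_nonneg

/-- The reason for the weight κ̃: in the product rule summed over z, the terms with ∇w carry Σ χ_z²
≤ 1 and those with ∇χ_z add up to κ Θ w². -/
lemma sum_energy_mul_le (τ : M.fine) (w : Poly) :
    ∑ z ∈ M.nodes, κ τ * τ.1.integral (gradDot (χ z τ * w) (χ z τ * w)) ≤
      2 * (κ τ * τ.1.integral (gradDot w w) + τ.1.integral (M.kTilde κ χ τ * w * w)) := by
  have hk := (hκ τ).le
  rw [← τ.1.integral_C_mul, ← τ.1.integral_add', ← τ.1.integral_C_mul,
    Finset.sum_congr rfl fun z _ => (τ.1.integral_C_mul (κ τ) _).symm, ← τ.1.integral_sum']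
  refine τ.1.integral_mono' fun x hx => ?_
  have h1 := sum_msBasis_sq_le hκ hχ hχ_nonneg hx
  have hg : 0 ≤ eval x (gradDot w w) := by rw [Rect.eval_gradDot_self]; positivity
  simp only [map_sum, map_mul, map_add, eval_C, kTilde, Θ]
  rw [← Finset.mul_sum]
  calc κ τ * ∑ z ∈ M.nodes, eval x (gradDot (χ z τ * w) (χ z τ * w))
      ≤ κ τ * ∑ z ∈ M.nodes, (2 * (eval x (χ z τ) ^ 2 * eval x (gradDot w w)) +
          2 * (eval x w ^ 2 * eval x (gradDot (χ z τ) (χ z τ)))) := by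
        gcongr with z hz
        exact eval_gradDot_mul_le x _ _
    _ = κ τ * (2 * ((∑ z ∈ M.nodes, eval x (χ z τ) ^ 2) * eval x (gradDot w w)) +
          2 * (eval x w ^ 2 * ∑ z ∈ M.nodes, eval x (gradDot (χ z τ) (χ z τ)))) := by
        rw [Finset.sum_add_distrib, ← Finset.mul_sum, ← Finset.mul_sum, Finset.sum_mul,
          Finset.mul_sum (M.nodes) _ (eval x w ^ 2)]
    _ ≤ κ τ * (2 * (1 * eval x (gradDot w w)) +
          2 * (eval x w ^ 2 * ∑ z ∈ M.nodes, eval x (gradDot (χ z τ) (χ z τ)))) := by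
        gcongr
    _ = _ := by ring

lemma sum_s_mul_le (τ : M.fine) (w : Poly) :
    ∑ z ∈ M.nodes, τ.1.integral (M.kTilde κ χ τ * (χ z τ * w) * (χ z τ * w)) ≤
      τ.1.integral (M.kTilde κ χ τ * w * w) := by
  rw [← τ.1.integral_sum']
  refine τ.1.integral_mono' fun x hx => ?_
  have h1 := sum_msBasis_sq_le hκ hχ hχ_nonneg hx
  have h2 := M.eval_kTilde_nonneg hκ χ τ x
  simp only [map_sum, map_mul]
  calc ∑ z ∈ M.nodes, eval x (M.kTilde κ χ τ) * (eval x (χ z τ) * eval x w) *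
        (eval x (χ z τ) * eval x w)
      = (∑ z ∈ M.nodes, eval x (χ z τ) ^ 2) * (eval x (M.kTilde κ χ τ) * eval x w ^ 2) := by
        rw [Finset.sum_mul]
        exact Finset.sum_congr rfl fun z _ => by ring
    _ ≤ 1 * (eval x (M.kTilde κ χ τ) * eval x w ^ 2) := by gcongr
    _ = _ := by ring

/-- All factors of the bubble lie in [0, 1], so |∇B|² is at most four times the sum of four squared
gradients, hence at most 4 Θ. The product rule doubles this to 8. -/
lemma energy_bubble_mul_le (τ : M.fine) (w : Poly) :
    κ τ * τ.1.integral (gradDot (M.bubble χ τ * w) (M.bubble χ τ * w)) ≤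
      2 * (κ τ * τ.1.integral (gradDot w w)) +
        8 * τ.1.integral (M.kTilde κ χ τ * w * w) := by
  have hk := (hκ τ).le
  rw [← τ.1.integral_C_mul, ← τ.1.integral_C_mul, ← τ.1.integral_C_mul, ← τ.1.integral_C_mul,
    ← τ.1.integral_add']
  refine τ.1.integral_mono' fun x hx => ?_
  have hB := bubble_mem_Icc hκ hχ hχ_nonneg hx
  have hB2 : eval x (M.bubble χ τ) ^ 2 ≤ 1 := pow_le_one₀ hB.1 hB.2
  have hg : 0 ≤ eval x (gradDot w w) := by rw [Rect.eval_gradDot_self]; positivity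
  have hgB : eval x (gradDot (M.bubble χ τ) (M.bubble χ τ)) ≤ 4 * eval x (M.Θ χ τ) := by
    refine (eval_gradDot_prod_le _ _ x fun z hz =>
      ⟨hχ_nonneg z (vertices_subset_nodes _ hz) τ x hx,
        msBasis_le_one hκ hχ hχ_nonneg (vertices_subset_nodes _ hz) hx⟩).trans ?_
    rw [(M.parent τ).1.card_vertices, Θ, map_sum]
    push_cast
    gcongr
    · intro z _ _
      rw [Rect.eval_gradDot_self]; positivity
    · exact vertices_subset_nodes _
  simp only [map_mul, map_add, eval_C, kTilde]
  calc κ τ * eval x (gradDot (M.bubble χ τ * w) (M.bubble χ τ * w))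
      ≤ κ τ * (2 * (eval x (M.bubble χ τ) ^ 2 * eval x (gradDot w w)) +
          2 * (eval x w ^ 2 * eval x (gradDot (M.bubble χ τ) (M.bubble χ τ)))) := by
        gcongr
        exact eval_gradDot_mul_le x _ _
    _ ≤ κ τ * (2 * (1 * eval x (gradDot w w)) +
          2 * (eval x w ^ 2 * (4 * eval x (M.Θ χ τ)))) := by gcongr
    _ = _ := by ring

omit hκ hχ_nonneg in
lemma Ih_msBasis_mul_mem (hκ : ∀ τ, 0 < κ τ) {z : Pt} (hz : z ∈ M.nodes) {S : Set M.coarse}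
    {w : M.Fun} (hw : w ∈ M.VhOn S) : M.Ih (χ z * w) ∈ M.VhOn (M.star z) := by
  refine M.Ih_mem_VhOn (M.mul_continuous (hχ z hz).1 hw.1).2 (fun τ x hx => ?_) fun τ hτ => ?_
  · rw [Pi.mul_apply, map_mul, hw.2.1 τ x hx, mul_zero]
  · rw [Pi.mul_apply, msBasis_eq_zero hκ hχ hz hτ, zero_mul]

omit hχ_nonneg in
lemma sum_Ih_msBasis_mul {w : M.Fun} (hw : w ∈ M.broken 1) :
    ∑ z ∈ M.nodes, M.Ih (χ z * w) = w := by
  rw [← map_sum, ← Finset.sum_mul]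
  have : ∑ z ∈ M.nodes, χ z = 1 := funext fun τ => by
    rw [Finset.sum_apply]; exact sum_msBasis hκ hχ τ
  rw [this, one_mul, M.Ih_eq_self hw]

/-- The χ_z are continuous across coarse edges. At the end points of an edge the jump of I_h(χ_z w)
is therefore χ_z times the jump of w, and the edge stability bound applies. -/
lemma sum_penalty_Ih_le {S : Set M.coarse} {w : M.Fun} (hw : w ∈ M.VhOn S) :
    ∑ z ∈ M.nodes, M.penalty κ (M.Ih (χ z * w)) (M.Ih (χ z * w)) ≤ 3 * M.penalty κ w w := by
  have h := M.sum_penalty_le hκ M.nodes ({()} : Finset Unit) (v := fun z => M.Ih (χ z * w))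
    (w := fun _ => w) (S := Set.univ) (S' := S)
    (fun z hz => M.VhOn_mono (Set.subset_univ _) (Ih_msBasis_mul_mem hχ hκ hz hw))
    (fun _ _ => hw) 3 (fun d τ σ hp _ => by
      rw [Finset.sum_singleton]
      have hend : ∀ t, t = τ.1.lo (d + 1) ∨ t = τ.1.hi (d + 1) →
          pt d (τ.1.hi d) t ∈ τ.1.vertices ∧ pt d (τ.1.hi d) t ∈ σ.1.vertices := fun t ht =>
        ⟨edge_vertex τ.1 d (Or.inr rfl) ht, precedes_vertex hp ht⟩
      have hval : ∀ z ∈ M.nodes, ∀ t, t = τ.1.lo (d + 1) ∨ t = τ.1.hi (d + 1) →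
          eval (pt d (τ.1.hi d) t) (M.Ih (χ z * w) τ - M.Ih (χ z * w) σ) =
          eval (pt d (τ.1.hi d) t) (χ z τ) * eval (pt d (τ.1.hi d) t) (w τ - w σ) := by
        intro z hz t ht
        obtain ⟨h1, h2⟩ := hend t ht
        rw [map_sub, M.eval_Ih h1, M.eval_Ih h2, Pi.mul_apply, Pi.mul_apply, map_mul, map_mul,
          ← msBasis_trace hχ hz (τ.1.vertices_subset h1) (σ.1.vertices_subset h2), map_sub]
        ring
      exact τ.1.sum_edgeIntegral_sq_le M.nodes (Submodule.sub_mem _ (hw.1.1 τ) (hw.1.1 σ))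
        (fun z _ => Submodule.sub_mem _ (τ.1.interp_mem _) (σ.1.interp_mem _)) d _
        (fun z => eval (pt d (τ.1.hi d) (τ.1.lo (d + 1))) (χ z τ))
        (fun z => eval (pt d (τ.1.hi d) (τ.1.hi (d + 1))) (χ z τ))
        (sum_msBasis_sq_le hκ hχ hχ_nonneg (τ.1.vertices_subset (hend _ (Or.inl rfl)).1))
        (sum_msBasis_sq_le hκ hχ hχ_nonneg (τ.1.vertices_subset (hend _ (Or.inr rfl)).1))
        (fun z hz => hval z hz _ (Or.inl rfl)) (fun z hz => hval z hz _ (Or.inr rfl)))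
  simpa using h

variable {CI : ℝ} (hCI : M.IsInterpConst κ χ CI)

include hCI

lemma sum_energy_Ih_le {S : Set M.coarse} {w : M.Fun} (hw : w ∈ M.VhOn S) :
    ∑ z ∈ M.nodes, ∑ K, M.aLoc κ K (M.Ih (χ z * w)) (M.Ih (χ z * w)) ≤
      4 * (1 + CI ^ 2) * ((∑ K, M.aLoc κ K w w) + M.s κ χ w w) := by
  simp only [sum_aLoc, s_eq_sum]
  rw [Finset.sum_comm, ← Finset.sum_add_distrib, Finset.mul_sum]
  refine Finset.sum_le_sum fun τ _ => ?_
  have h := sum_energy_mul_le hκ hχ hχ_nonneg τ (w τ)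
  calc ∑ z ∈ M.nodes, κ τ * τ.1.integral (gradDot (M.Ih (χ z * w) τ) (M.Ih (χ z * w) τ))
      ≤ ∑ z ∈ M.nodes, 2 * (1 + CI ^ 2) *
          (κ τ * τ.1.integral (gradDot (χ z τ * w τ) (χ z τ * w τ))) := by
        refine Finset.sum_le_sum fun z hz => ?_
        refine interp_energy_le hκ hCI τ (restrictDegree_mono (by norm_num : 2 ≤ 5)
          (mul_mem_restrictDegree ((hχ z hz).1.1 τ) (hw.1.1 τ))) fun x hx => ?_
        rw [Pi.mul_apply, map_mul, hw.2.1 τ x hx, mul_zero]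
    _ ≤ _ := by
        rw [← Finset.mul_sum]
        have : 0 ≤ 2 * (1 + CI ^ 2) := by positivity
        calc _ ≤ 2 * (1 + CI ^ 2) * _ := mul_le_mul_of_nonneg_left h this
          _ = _ := by ring

/-- With g = χ_z w, (I_h g)² ≤ 2 g² + 2 (g - I_h g)². The factor 74 is 2 · 37/2 from the error term
times the 2 of the product rule. -/
lemma sum_s_Ih_le {S : Set M.coarse} {w : M.Fun} (hw : w ∈ M.VhOn S) :
    ∑ z ∈ M.nodes, M.s κ χ (M.Ih (χ z * w)) (M.Ih (χ z * w)) ≤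
      2 * M.s κ χ w w + 74 * (CI ^ 2 * M.ΘSup χ Set.univ * M.h ^ 2) *
        ((∑ K, M.aLoc κ K w w) + M.s κ χ w w) := by
  simp only [sum_aLoc, s_eq_sum]
  rw [Finset.sum_comm, ← Finset.sum_add_distrib, Finset.mul_sum, Finset.mul_sum,
    ← Finset.sum_add_distrib]
  refine Finset.sum_le_sum fun τ _ => ?_
  have h := sum_energy_mul_le hκ hχ hχ_nonneg τ (w τ)
  have h2 := sum_s_mul_le hκ hχ hχ_nonneg τ (w τ)
  set θ := CI ^ 2 * M.ΘSup χ Set.univ * M.h ^ 2 with hθ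
  have hθ0 : 0 ≤ θ := by
    have := ΘSup_nonneg (χ := χ) Set.univ
    positivity
  calc ∑ z ∈ M.nodes, τ.1.integral (M.kTilde κ χ τ * M.Ih (χ z * w) τ * M.Ih (χ z * w) τ)
      ≤ ∑ z ∈ M.nodes, (2 * τ.1.integral (M.kTilde κ χ τ * (χ z τ * w τ) * (χ z τ * w τ)) +
          2 * (37 / 2 * θ * (κ τ * τ.1.integral (gradDot (χ z τ * w τ) (χ z τ * w τ))))) := by
        refine Finset.sum_le_sum fun z hz => ?_
        have he := interp_error_s_le hκ hCI τ (Set.mem_univ _) (u := χ z τ * w τ)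
          (restrictDegree_mono (by norm_num : 2 ≤ 5)
          (mul_mem_restrictDegree ((hχ z hz).1.1 τ) (hw.1.1 τ))) fun x hx => by
            rw [map_mul, hw.2.1 τ x hx, mul_zero]
        refine le_trans ?_ (add_le_add_right (mul_le_mul_of_nonneg_left he zero_le_two) _)
        rw [← τ.1.integral_C_mul, ← τ.1.integral_C_mul, ← τ.1.integral_add']
        refine τ.1.integral_mono' fun x _ => ?_
        have hk := M.eval_kTilde_nonneg hκ χ τ x
        simp only [Ih_apply, Pi.mul_apply, map_add, map_mul, map_sub, eval_C]
        set a := eval x (χ z τ) * eval x (w τ)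
        set b := eval x (τ.1.interp (χ z τ * w τ))
        nlinarith [mul_nonneg hk (sq_nonneg (2 * a - b))]
    _ = 2 * ∑ z ∈ M.nodes, τ.1.integral (M.kTilde κ χ τ * (χ z τ * w τ) * (χ z τ * w τ)) +
          37 * θ * ∑ z ∈ M.nodes,
            κ τ * τ.1.integral (gradDot (χ z τ * w τ) (χ z τ * w τ)) := by
        rw [Finset.sum_add_distrib, ← Finset.mul_sum, ← Finset.mul_sum, ← Finset.mul_sum]
        ring
    _ ≤ 2 * τ.1.integral (M.kTilde κ χ τ * w τ * w τ) + 37 * θ *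
          (2 * (κ τ * τ.1.integral (gradDot (w τ) (w τ)) +
            τ.1.integral (M.kTilde κ χ τ * w τ * w τ))) := by gcongr
    _ = _ := by ring

end Products

end Mesh

end CEM

/-! ### The local spectral problems and the spectral gap. -/

namespace CEM

open MvPolynomial

namespace Mesh

variable {M : Mesh} {κ : M.fine → ℝ} {χ : Pt → M.Fun} {lam : M.coarse → ℕ → ℝ}
  {φ : M.coarse → ℕ → M.Fun}

section Eigen

variable (hφ : M.IsEigensystem κ χ lam φ) {K : M.coarse}

include hφ

/-- Orthonormal functions are independent, and their number is the dimension. Positivity of the rank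
is needed because `finrank` is 0 for infinite-dimensional spaces. -/
lemma eigen_expansion (hn : 0 < Module.finrank ℝ (M.VhLoc K)) {v : M.Fun} (hv : v ∈ M.VhLoc K) :
    v = ∑ j ∈ Finset.Icc 1 (Module.finrank ℝ (M.VhLoc K)), M.sLoc κ χ K v (φ K j) • φ K j := by
  classical
  set n := Module.finrank ℝ (M.VhLoc K) with hndef
  have : FiniteDimensional ℝ (M.VhLoc K) := FiniteDimensional.of_finrank_pos hn
  let f : Finset.Icc 1 n → M.VhLoc K := fun j => ⟨φ K j, (hφ K j j.2).1⟩
  have hpair : ∀ (c : Finset.Icc 1 n → ℝ) (l : Finset.Icc 1 n),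
      M.sLocForm κ χ K (∑ j, c j • φ K j) (φ K l) = c l := fun c l => by
    rw [LinearMap.map_sum₂, Finset.sum_eq_single l]
    · rw [LinearMap.map_smul₂, sLocForm_apply, ((hφ K l l.2).2.2 l l.2).1]
      simp
    · intro j _ hne
      rw [LinearMap.map_smul₂, sLocForm_apply, ((hφ K j j.2).2.2 l l.2).1,
        if_neg fun h => hne (Subtype.ext h), smul_zero]
    · exact fun h => absurd (Finset.mem_univ l) h
  have hli : LinearIndependent ℝ f := by
    refine Fintype.linearIndependent_iff.2 fun c hc l => ?_
    have h1 : ∑ j, c j • φ K (j : ℕ) = 0 := by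
      have := congrArg Subtype.val hc
      simpa [f] using this
    rw [← hpair c l, h1, LinearMap.map_zero₂]
  have hspan := hli.span_eq_top_of_card_eq_finrank' (by simp [← hndef])
  have hmem : (⟨v, hv⟩ : M.VhLoc K) ∈ Submodule.span ℝ (Set.range f) := by
    rw [hspan]; exact Submodule.mem_top
  obtain ⟨c, hc⟩ := (Submodule.mem_span_range_iff_exists_fun ℝ).1 hmem
  have hvc : ∑ j, c j • φ K (j : ℕ) = v := by
    have := congrArg Subtype.val hc
    simpa [f] using this
  rw [← Finset.sum_coe_sort (Finset.Icc 1 n) fun j => M.sLoc κ χ K v (φ K j) • φ K j]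
  conv_lhs => rw [← hvc]
  refine Finset.sum_congr rfl fun j _ => ?_
  rw [← hpair c j, hvc, sLocForm_apply]

lemma sLoc_self_eq_sum (hn : 0 < Module.finrank ℝ (M.VhLoc K)) {v : M.Fun}
    (hv : v ∈ M.VhLoc K) :
    M.sLoc κ χ K v v =
      ∑ j ∈ Finset.Icc 1 (Module.finrank ℝ (M.VhLoc K)), M.sLoc κ χ K v (φ K j) ^ 2 := by
  have h : M.sLocForm κ χ K v v = M.sLocForm κ χ K v
    (∑ j ∈ Finset.Icc 1 (Module.finrank ℝ (M.VhLoc K)), M.sLoc κ χ K v (φ K j) • φ K j) := by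
    rw [← eigen_expansion hφ hn hv]
  rw [map_sum] at h
  rw [← sLocForm_apply, h]
  exact Finset.sum_congr rfl fun j _ => by simp [sq]

lemma aLoc_self_eq_sum (hn : 0 < Module.finrank ℝ (M.VhLoc K)) {v : M.Fun}
    (hv : v ∈ M.VhLoc K) :
    M.aLoc κ K v v = ∑ j ∈ Finset.Icc 1 (Module.finrank ℝ (M.VhLoc K)),
      lam K j * M.sLoc κ χ K v (φ K j) ^ 2 := by
  have h : M.aLocForm κ K v v = M.aLocForm κ K v
    (∑ j ∈ Finset.Icc 1 (Module.finrank ℝ (M.VhLoc K)), M.sLoc κ χ K v (φ K j) • φ K j) := by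
    rw [← eigen_expansion hφ hn hv]
  rw [map_sum] at h
  rw [← aLocForm_apply, h]
  refine Finset.sum_congr rfl fun j hj => ?_
  rw [map_smul, aLocForm_apply, aLoc_comm, (hφ K j hj).2.1 v hv, M.sLoc_comm κ χ K (φ K j),
    smul_eq_mul]
  ring

/-- Definiteness of `sLoc` is not read off from the weight κ̃; it comes from the expansion in an
orthonormal basis. -/
lemma eq_zero_of_sLoc_eq_zero (hn : 0 < Module.finrank ℝ (M.VhLoc K)) {v : M.Fun}
    (hv : v ∈ M.VhLoc K) (h : M.sLoc κ χ K v v = 0) : v = 0 := by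
  rw [sLoc_self_eq_sum hφ hn hv] at h
  have h0 := (Finset.sum_eq_zero_iff_of_nonneg fun j _ => sq_nonneg _).1 h
  rw [eigen_expansion hφ hn hv]
  refine Finset.sum_eq_zero fun j hj => ?_
  rw [pow_eq_zero_iff (two_ne_zero)|>.1 (h0 j hj), zero_smul]

lemma lam_nonneg (hκ : ∀ τ, 0 < κ τ) {j : ℕ}
    (hj : j ∈ Finset.Icc 1 (Module.finrank ℝ (M.VhLoc K))) : 0 ≤ lam K j := by
  obtain ⟨h1, h2, h3⟩ := hφ K j hj
  have := h2 _ h1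
  rw [(h3 j hj).1, if_pos rfl, mul_one] at this
  rw [← this]
  exact M.aLoc_self_nonneg hκ K _

/-- Only the first eigenvalue may vanish. -/
lemma lam_pos (hκ : ∀ τ, 0 < κ τ) {j : ℕ}
    (hj : j ∈ Finset.Icc 1 (Module.finrank ℝ (M.VhLoc K))) (hj2 : 2 ≤ j) : 0 < lam K j := by
  refine (lam_nonneg hφ hκ hj).lt_of_ne fun h0 => ?_
  have h1mem : 1 ∈ Finset.Icc 1 (Module.finrank ℝ (M.VhLoc K)) :=
    Finset.mem_Icc.2 ⟨le_rfl, (Finset.mem_Icc.1 hj).1.trans (Finset.mem_Icc.1 hj).2⟩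
  have h10 : lam K 1 = 0 := le_antisymm
    ((((hφ K 1 h1mem).2.2 j hj).2 (by omega)).trans h0.symm.le) (lam_nonneg hφ hκ h1mem)
  -- Eigenfunctions with eigenvalue 0 are constants on the block, and two constants are linearly
  -- dependent, which contradicts orthonormality.
  have hconst : ∀ l ∈ Finset.Icc 1 (Module.finrank ℝ (M.VhLoc K)), lam K l = 0 →
      ∃ c, ∀ τ, M.parent τ = K → φ K l τ = C c := fun l hl hl0 => by
    obtain ⟨g1, g2, -⟩ := hφ K l hl
    exact exists_const_of_aLoc_eq_zero hκ g1.1 (by rw [g2 _ g1, hl0, zero_mul])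
  obtain ⟨c1, hc1⟩ := hconst 1 h1mem h10
  obtain ⟨c2, hc2⟩ := hconst j hj h0.symm
  have e11 := ((hφ K 1 h1mem).2.2 1 h1mem).1
  have e1j := ((hφ K 1 h1mem).2.2 j hj).1
  have ejj := ((hφ K j hj).2.2 j hj).1
  rw [if_pos rfl] at e11 ejj
  rw [if_neg (by omega)] at e1j
  have hz : ∀ w, M.sLoc κ χ K (c2 • φ K 1 - c1 • φ K j) w = 0 := fun w => by
    rw [sLoc_comm]
    refine sLoc_eq_zero_right fun τ hτ => ?_
    simp only [Pi.sub_apply, Pi.smul_apply, hc1 τ hτ, hc2 τ hτ, smul_eq_C_mul]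
    ring
  have hz1 := hz (φ K 1)
  have hzj := hz (φ K j)
  rw [← sLocForm_apply, map_sub, map_smul, map_smul, LinearMap.sub_apply, LinearMap.smul_apply,
    LinearMap.smul_apply, sLocForm_apply, sLocForm_apply] at hz1 hzj
  rw [M.sLoc_comm κ χ K (φ K j), e11, e1j] at hz1
  rw [e1j, ejj] at hzj
  have hc20 : c2 = 0 := by simpa using hz1
  rw [sLoc_eq_zero_right (v := φ K j) fun τ hτ => by rw [hc2 τ hτ, hc20, C_0]] at ejj
  exact zero_ne_one ejj

end Eigen

section Gap

variable (hκ : ∀ τ, 0 < κ τ) (hφ : M.IsEigensystem κ χ lam φ) {L : M.coarse → ℕ}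
  (hL : ∀ K, 1 ≤ L K ∧ L K < Module.finrank ℝ (M.VhLoc K))

include hL in
lemma mem_Icc_of_le {K : M.coarse} {j : ℕ} (hj : j ∈ Finset.Icc 1 (L K)) :
    j ∈ Finset.Icc 1 (Module.finrank ℝ (M.VhLoc K)) := by
  rw [Finset.mem_Icc] at *
  exact ⟨hj.1, hj.2.trans (hL K).2.le⟩

include hL in
lemma finrank_pos (K : M.coarse) : 0 < Module.finrank ℝ (M.VhLoc K) :=
  (Nat.zero_le _).trans_lt (hL K).2

lemma Λ_le (K : M.coarse) : M.Λ lam L ≤ lam K (L K + 1) :=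
  ciInf_le (f := fun K => lam K (L K + 1)) (Set.finite_range _).bddBelow K

lemma le_lamMax (K : M.coarse) : lam K (L K) ≤ M.lamMax lam L :=
  le_ciSup (f := fun K => lam K (L K)) (Set.finite_range _).bddAbove K

include hφ hL

include hκ in
lemma Λ_pos (i : M.coarse) : 0 < M.Λ lam L := by
  have : Nonempty M.coarse := ⟨i⟩
  obtain ⟨K, hK⟩ := exists_eq_ciInf_of_finite (f := fun K => lam K (L K + 1))
  rw [Λ, ← hK]
  have := hL K
  exact lam_pos hφ hκ (Finset.mem_Icc.2 ⟨by omega, by omega⟩) (by omega)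

include hκ in
lemma lamMax_nonneg (i : M.coarse) : 0 ≤ M.lamMax lam L :=
  (lam_nonneg hφ hκ (mem_Icc_of_le hL (Finset.mem_Icc.2 ⟨(hL i).1, le_rfl⟩))).trans (le_lamMax i)

lemma s_phi {K : M.coarse} {j : ℕ} (hj : j ∈ Finset.Icc 1 (L K)) (v : M.Fun) :
    M.s κ χ v (φ K j) = M.sLoc κ χ K v (φ K j) :=
  s_eq_sLoc (eq_zero_off_of_mem_VhLoc (hφ K j (mem_Icc_of_le hL hj)).1) v

lemma isPhiOrthogonal_phi {K : M.coarse} {j : ℕ} (hj : j ∈ Finset.Icc 1 (L K)) :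
    M.IsPhiOrthogonal κ χ φ L K j (φ K j) := by
  intro K' l hl
  rw [s_phi hφ hL hl]
  have hjm := mem_Icc_of_le hL hj
  have hlm := mem_Icc_of_le hL hl
  by_cases h : K' = K
  · subst h
    rw [((hφ K' j hjm).2.2 l hlm).1]
    exact ⟨fun h => if_pos h.2.symm, fun h => if_neg fun h' => h ⟨rfl, h'.symm⟩⟩
  · refine ⟨fun h' => absurd h'.1 h, fun _ => ?_⟩
    rw [sLoc_comm]
    exact sLoc_eq_zero_right fun τ hτ =>
      eq_zero_off_of_mem_VhLoc (hφ K j hjm).1 τ (by rw [hτ]; exact h)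

/-- The spectral gap estimate for functions without component in the auxiliary space. -/
lemma Λ_mul_sLoc_le {w : M.Fun} (hw : w ∈ M.Vh) (K : M.coarse)
    (h : ∀ l ∈ Finset.Icc 1 (L K), M.s κ χ w (φ K l) = 0) :
    M.Λ lam L * M.sLoc κ χ K w w ≤ M.aLoc κ K w w := by
  have hn := finrank_pos hL K
  have hv : M.cut {K} w ∈ M.VhLoc K := M.cut_mem_VhOn hw {K}
  have e1 : M.sLoc κ χ K w w = M.sLoc κ χ K (M.cut {K} w) (M.cut {K} w) :=
    sLoc_congr (fun τ hτ => (cut_singleton hτ w).symm) fun τ hτ => (cut_singleton hτ w).symm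
  have e2 : M.aLoc κ K w w = M.aLoc κ K (M.cut {K} w) (M.cut {K} w) :=
    aLoc_congr (fun τ hτ => (cut_singleton hτ w).symm) fun τ hτ => (cut_singleton hτ w).symm
  rw [e1, e2, sLoc_self_eq_sum hφ hn hv, aLoc_self_eq_sum hφ hn hv, Finset.mul_sum]
  refine Finset.sum_le_sum fun j hj => ?_
  -- The coefficients up to `L K` vanish by hypothesis; the remaining ones carry eigenvalues of at
  -- least Λ.
  by_cases hjL : j ≤ L K
  · have hjm : j ∈ Finset.Icc 1 (L K) := Finset.mem_Icc.2 ⟨(Finset.mem_Icc.1 hj).1, hjL⟩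
    rw [sLoc_cut, ← s_phi hφ hL hjm, h j hjm]
    simp
  · refine mul_le_mul_of_nonneg_right ((Λ_le K).trans ?_) (sq_nonneg _)
    have := hL K
    exact ((hφ K _ (Finset.mem_Icc.2 ⟨by omega, by omega⟩)).2.2 j hj).2 (by omega)

lemma Vaux_le_Vh : M.Vaux φ L ≤ M.Vh := by
  refine Submodule.span_le.2 ?_
  rintro v ⟨K, j, hj, rfl⟩
  exact M.VhOn_le_Vh {K} (hφ K j (mem_Icc_of_le hL hj)).1

lemma cut_mem_Vaux {ν : M.Fun} (hν : ν ∈ M.Vaux φ L) (K : M.coarse) :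
    M.cut {K} ν ∈ M.Vaux φ L := by
  have h : M.Vaux φ L ≤ (M.Vaux φ L).comap (M.cut {K}) := by
    refine Submodule.span_le.2 ?_
    rintro v ⟨K', j, hj, rfl⟩
    have hoff := eq_zero_off_of_mem_VhLoc (hφ K' j (mem_Icc_of_le hL hj)).1
    change M.cut {K} (φ K' j) ∈ M.Vaux φ L
    by_cases hK : K' = K
    · subst hK
      have : M.cut {K'} (φ K' j) = φ K' j := funext fun τ => by
        by_cases hτ : M.parent τ = K'
        · rw [cut_singleton hτ]
        · rw [hoff τ hτ, M.cut_of_notMem (mt Set.mem_singleton_iff.1 hτ)]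
      rw [this]
      exact Submodule.subset_span ⟨K', j, hj, rfl⟩
    · have : M.cut {K} (φ K' j) = 0 := funext fun τ => by
        by_cases hτ : M.parent τ = K
        · rw [cut_singleton hτ, hoff τ (by rw [hτ]; exact Ne.symm hK)]; rfl
        · rw [M.cut_of_notMem (mt Set.mem_singleton_iff.1 hτ)]; rfl
      rw [this]
      exact zero_mem _
  exact h hν

/-- In the auxiliary space, the energy is bounded by the largest eigenvalue in use. -/
lemma aLoc_le_lamMax {ν : M.Fun} (hν : ν ∈ M.Vaux φ L) (K : M.coarse) :
    M.aLoc κ K ν ν ≤ M.lamMax lam L * M.sLoc κ χ K ν ν := by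
  have hn := finrank_pos hL K
  have hv : M.cut {K} ν ∈ M.VhLoc K := M.cut_mem_VhOn (Vaux_le_Vh hφ hL hν) {K}
  have e1 : M.sLoc κ χ K ν ν = M.sLoc κ χ K (M.cut {K} ν) (M.cut {K} ν) :=
    sLoc_congr (fun τ hτ => (cut_singleton hτ ν).symm) fun τ hτ => (cut_singleton hτ ν).symm
  have e2 : M.aLoc κ K ν ν = M.aLoc κ K (M.cut {K} ν) (M.cut {K} ν) :=
    aLoc_congr (fun τ hτ => (cut_singleton hτ ν).symm) fun τ hτ => (cut_singleton hτ ν).symm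
  rw [e1, e2, sLoc_self_eq_sum hφ hn hv, aLoc_self_eq_sum hφ hn hv, Finset.mul_sum]
  refine Finset.sum_le_sum fun j hj => ?_
  by_cases hjL : j ≤ L K
  · refine mul_le_mul_of_nonneg_right (le_trans ?_ (le_lamMax K)) (sq_nonneg _)
    exact ((hφ K j hj).2.2 (L K) (mem_Icc_of_le hL (Finset.mem_Icc.2 ⟨(hL K).1, le_rfl⟩))).2 hjL
  · have h0 : M.Vaux φ L ≤ LinearMap.ker ((M.sLocForm κ χ K).flip (φ K j)) := by
      refine Submodule.span_le.2 ?_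
      rintro v ⟨K', l, hl, rfl⟩
      have hlm := mem_Icc_of_le hL hl
      change M.sLoc κ χ K (φ K' l) (φ K j) = 0
      by_cases hK : K' = K
      · subst hK
        rw [((hφ K' l hlm).2.2 j hj).1, if_neg]
        have := (Finset.mem_Icc.1 hl).2
        omega
      · rw [sLoc_comm]
        exact sLoc_eq_zero_right fun τ hτ =>
          eq_zero_off_of_mem_VhLoc (hφ K' l hlm).1 τ (by rw [hτ]; exact Ne.symm hK)
    have h1 : M.sLoc κ χ K ν (φ K j) = 0 := h0 hν
    rw [sLoc_cut, h1]
    simp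

omit hφ in
-- Every local space has positive `finrank`, hence finite dimension, and the blockwise restrictions
-- of a function add up to it.
lemma finiteDimensional_Vh : FiniteDimensional ℝ M.Vh := by
  have : ∀ K, FiniteDimensional ℝ (M.VhLoc K) := fun K =>
    FiniteDimensional.of_finrank_pos (finrank_pos hL K)
  have hle : M.Vh ≤ ⨆ K, M.VhLoc K := fun v hv => by
    have hsum : v = ∑ K, M.cut {K} v := funext fun τ => by
      rw [Finset.sum_apply, Finset.sum_eq_single (M.parent τ)]
      · rw [cut_singleton rfl]
      · intro K _ hne
        exact M.cut_of_notMem (mt Set.mem_singleton_iff.1 hne.symm) v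
      · exact fun h => absurd (Finset.mem_univ _) h
    rw [hsum]
    exact Submodule.sum_mem _ fun K _ =>
      Submodule.mem_iSup_of_mem K (M.cut_mem_VhOn hv {K})
  exact Submodule.finiteDimensional_of_le hle

lemma finiteDimensional_Vaux : FiniteDimensional ℝ (M.Vaux φ L) :=
  have := finiteDimensional_Vh hL
  Submodule.finiteDimensional_of_le (Vaux_le_Vh hφ hL)

end Gap

end Mesh

end CEM

/-! ### The moment corrector built from interpolated bubble functions. -/

namespace CEM

open MvPolynomial

namespace Mesh

variable {M : Mesh} {κ : M.fine → ℝ} {χ : Pt → M.Fun} {lam : M.coarse → ℕ → ℝ}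
  {φ : M.coarse → ℕ → M.Fun} {L : M.coarse → ℕ} {CI Cπ : ℝ}

/-- Here σ = s(ν,ν), b is its bubble-weighted version, ε the squared interpolation error of Bν, and
p its pairing with ν. Since (16 + l)² - 24(2l + 8) = (l - 8)², one has ε C² ≤ (37/48) σ, and 37/48 <
(22/25)². So C|p| ≤ (22/25) σ is absorbed, leaving 3/25 of σ. -/
lemma le_of_small_error {C θ l σ ε p b : ℝ} (hC : 1 ≤ C) (hθ : 0 ≤ θ) (hσ : 0 ≤ σ)
    (hs : C ^ 2 * (16 + l) ^ 2 * θ < 1) (hε : ε ≤ 37 / 2 * θ * ((2 * l + 8) * σ))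
    (hp : p ^ 2 ≤ ε * σ) (hb : σ ≤ C * b) : σ ≤ 25 / 3 * C * (b - p) := by
  have h6 : (2 * l + 8) * σ ≤ (16 + l) ^ 2 / 24 * σ :=
    mul_le_mul_of_nonneg_right (by nlinarith [sq_nonneg (l - 8)]) hσ
  have h1 : ε * C ^ 2 ≤ (22 / 25) ^ 2 * σ :=
    calc ε * C ^ 2 ≤ 37 / 2 * θ * ((2 * l + 8) * σ) * C ^ 2 := by gcongr
      _ ≤ 37 / 2 * θ * ((16 + l) ^ 2 / 24 * σ) * C ^ 2 := by gcongr
      _ = 37 / 48 * σ * (C ^ 2 * (16 + l) ^ 2 * θ) := by ring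
      _ ≤ 37 / 48 * σ * 1 := by gcongr
      _ ≤ _ := by linarith
  have h3 : |C * p| ≤ 22 / 25 * σ := by
    refine abs_le_of_sq_le_sq ?_ (by positivity)
    calc (C * p) ^ 2 = C ^ 2 * p ^ 2 := by ring
      _ ≤ C ^ 2 * (ε * σ) := by gcongr
      _ = ε * C ^ 2 * σ := by ring
      _ ≤ (22 / 25) ^ 2 * σ * σ := by gcongr
      _ = _ := by ring
  have h4 := le_abs_self (C * p)
  linarith

lemma le_sq_mul_of_le_mul {C x p q : ℝ} (hq : 0 ≤ q) (hx : 0 ≤ x) (h : x ≤ C * p)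
    (hp : p ^ 2 ≤ q * x) : x ≤ C ^ 2 * q := by
  rcases hx.eq_or_lt with h0 | h0
  · rw [← h0]; positivity
  · refine le_of_mul_le_mul_right ?_ h0
    calc x * x ≤ (C * p) * (C * p) := mul_self_le_mul_self hx h
      _ = C ^ 2 * p ^ 2 := by ring
      _ ≤ C ^ 2 * (q * x) := by gcongr
      _ = _ := by ring

/-- Again 24(2l + 8) ≤ (16 + l)²; the numerical factor 1250/(9 · 24) is below 8, and 8 ≤ 4(1 + I²).
-/
lemma corrector_bound {C l I q x : ℝ} (hI : 1 ≤ I) (hl : 0 ≤ l) (hq : 0 ≤ q)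
    (hx : x ≤ (25 / 3 * C) ^ 2 * q) :
    2 * (1 + I ^ 2) * ((2 * l + 8) * x) ≤ (2 * C * (1 + I ^ 2) * (16 + l)) ^ 2 * q := by
  have h5 : 2 ≤ 1 + I ^ 2 := by nlinarith
  have h6 : 24 * (2 * l + 8) ≤ (16 + l) ^ 2 := by nlinarith [sq_nonneg (l - 8)]
  have h7 : 2 * (16 + l) ^ 2 ≤ (1 + I ^ 2) * (16 + l) ^ 2 := by gcongr
  calc 2 * (1 + I ^ 2) * ((2 * l + 8) * x)
      ≤ 2 * (1 + I ^ 2) * ((2 * l + 8) * ((25 / 3 * C) ^ 2 * q)) := by gcongr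
    _ = (1 + I ^ 2) * C ^ 2 * q * (1250 / 9 * (2 * l + 8)) := by ring
    _ ≤ (1 + I ^ 2) * C ^ 2 * q * (4 * (1 + I ^ 2) * (16 + l) ^ 2) := by
        refine mul_le_mul_of_nonneg_left ?_ (by positivity)
        linarith
    _ = _ := by ring

lemma sLoc_bubble_mul (K : M.coarse) (μ : M.Fun) :
    M.sLoc κ χ K (M.bubble χ * μ) μ = M.sBubble κ χ K μ := by
  unfold sLoc sBubble
  refine Finset.sum_congr rfl fun τ _ => ?_
  rw [Pi.mul_apply]
  congr 2
  ring

lemma s_cut_right (K : M.coarse) (v w : M.Fun) :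
    M.s κ χ v (M.cut {K} w) = M.sLoc κ χ K v w := by
  rw [s_eq_sLoc fun τ hτ => M.cut_of_notMem (mt Set.mem_singleton_iff.1 hτ) w, sLoc_comm,
    sLoc_cut, sLoc_comm]

section

variable (hκ : ∀ τ, 0 < κ τ) (hχ : M.IsMsBasis κ χ)

include hκ hχ

/-- The products with the bubble functions have no jumps. -/
lemma penalty_Ih_bubble_mul {S : Set M.coarse} {w : M.Fun} (hw : w ∈ M.VhOn S) :
    M.penalty κ (M.Ih (M.bubble χ * w)) (M.Ih (M.bubble χ * w)) = 0 := by
  have hB := M.Ih_mul_mem (bubble_mem_broken hχ) hw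
  have h := M.sum_penalty_le hκ {()} (∅ : Finset Unit) (v := fun _ => M.Ih (M.bubble χ * w))
    (w := fun _ => w) (fun _ _ => hB) (fun _ _ => hw) 1 (fun d τ σ hp hne => by
      rw [Finset.sum_singleton, Finset.sum_empty, mul_zero]
      have hval : ∀ t, t = τ.1.lo (d + 1) ∨ t = τ.1.hi (d + 1) →
          eval (pt d (τ.1.hi d) t)
            (M.Ih (M.bubble χ * w) τ - M.Ih (M.bubble χ * w) σ) = 0 := fun t ht => by
        have h1 := edge_vertex τ.1 d (Or.inr rfl) ht
        have h2 := precedes_vertex hp ht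
        have h1' := M.parent_sub τ (τ.1.vertices_subset h1)
        have h2' := M.parent_sub σ (σ.1.vertices_subset h2)
        have hne' : (M.parent τ).1 ≠ (M.parent σ).1 := fun h => hne (Subtype.ext h)
        rw [map_sub, M.eval_Ih h1, M.eval_Ih h2, Pi.mul_apply, Pi.mul_apply, map_mul, map_mul,
          bubble_eq_zero hχ ⟨τ.1.vertices_subset h1, M.coarse_conforming.mem_frontier
            (M.parent τ).2 (M.parent σ).2 hne' h1' h2'⟩,
          bubble_eq_zero hχ ⟨σ.1.vertices_subset h2, M.coarse_conforming.mem_frontier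
            (M.parent σ).2 (M.parent τ).2 hne'.symm h2' h1'⟩]
        ring
      exact (τ.1.edgeIntegral_eq_zero
        (Submodule.sub_mem _ (τ.1.interp_mem _) (σ.1.interp_mem _)) d _
        (hval _ (Or.inl rfl)) (hval _ (Or.inr rfl))).le)
  rw [Finset.sum_singleton, Finset.sum_empty, mul_zero] at h
  exact le_antisymm h (M.penalty_self_nonneg hκ _)

variable (hχ_nonneg : ∀ z ∈ M.nodes, ∀ τ : M.fine, ∀ x ∈ τ.1.carrier, 0 ≤ eval x (χ z τ))

include hχ_nonneg

lemma sBubble_le (K : M.coarse) (μ : M.Fun) : M.sBubble κ χ K μ ≤ M.sLoc κ χ K μ μ := by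
  unfold sBubble sLoc
  refine Finset.sum_le_sum fun τ _ => ?_
  split_ifs
  · refine τ.1.integral_mono' fun x hx => ?_
    have hB := bubble_mem_Icc hκ hχ hχ_nonneg hx
    have hk := M.eval_kTilde_nonneg hκ χ τ x
    simp only [map_mul, map_pow]
    calc _ ≤ eval x (M.kTilde κ χ τ) * 1 * eval x (μ τ) ^ 2 := by
          gcongr
          exact hB.2
      _ = _ := by ring
  · exact le_rfl

lemma aLoc_bubble_mul_le (K : M.coarse) (ν : M.Fun) :
    M.aLoc κ K (M.bubble χ * ν) (M.bubble χ * ν) ≤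
      2 * M.aLoc κ K ν ν + 8 * M.sLoc κ χ K ν ν := by
  unfold aLoc sLoc
  rw [Finset.mul_sum, Finset.mul_sum, ← Finset.sum_add_distrib]
  refine Finset.sum_le_sum fun τ _ => ?_
  split_ifs
  · exact energy_bubble_mul_le hκ hχ hχ_nonneg τ (ν τ)
  · simp

end

section

variable (hκ : ∀ τ, 0 < κ τ) (hCI : M.IsInterpConst κ χ CI) {K : M.coarse} {u : M.Fun}
  (hu : ∀ τ, u τ ∈ restrictDegree (Fin 2) ℝ 5)
  (hz : ∀ τ, ∀ x ∈ τ.1.carrier ∩ frontier M.Ω, eval x (u τ) = 0)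

include hκ hCI hu hz

lemma aLoc_Ih_le :
    M.aLoc κ K (M.Ih u) (M.Ih u) ≤ 2 * (1 + CI ^ 2) * M.aLoc κ K u u := by
  unfold aLoc
  rw [Finset.mul_sum]
  refine Finset.sum_le_sum fun τ _ => ?_
  split_ifs
  · exact interp_energy_le hκ hCI τ (hu τ) (hz τ)
  · simp

lemma sLoc_sub_Ih_le :
    M.sLoc κ χ K (u - M.Ih u) (u - M.Ih u) ≤
      37 / 2 * (CI ^ 2 * M.ΘSup χ Set.univ * M.h ^ 2) * M.aLoc κ K u u := by
  unfold aLoc sLoc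
  rw [Finset.mul_sum]
  refine Finset.sum_le_sum fun τ _ => ?_
  split_ifs
  · exact interp_error_s_le hκ hCI τ (Set.mem_univ _) (hu τ) (hz τ)
  · simp

end

section Coercivity

variable (hκ : ∀ τ, 0 < κ τ) (hχ : M.IsMsBasis κ χ)
  (hχ_nonneg : ∀ z ∈ M.nodes, ∀ τ : M.fine, ∀ x ∈ τ.1.carrier, 0 ≤ eval x (χ z τ))
  (hφ : M.IsEigensystem κ χ lam φ)
  (hL : ∀ K, 1 ≤ L K ∧ L K < Module.finrank ℝ (M.VhLoc K))
  (hCπ : M.IsBubbleConst κ χ φ L Cπ)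

include hφ hL in
lemma eq_zero_of_sLoc_self {v : M.Fun} (hv : v ∈ M.Vh) {K : M.coarse}
    (h : M.sLoc κ χ K v v = 0) {τ : M.fine} (hτ : M.parent τ = K) : v τ = 0 := by
  have h0 := eq_zero_of_sLoc_eq_zero hφ (finrank_pos hL K) (M.cut_mem_VhOn hv {K}) (by
    rw [sLoc_cut, sLoc_comm, sLoc_cut, h])
  rw [← cut_singleton hτ v, h0]
  rfl

include hκ hχ hχ_nonneg hφ hL hCπ

/-- Because 0 ≤ B ≤ 1, the bubble weight only decreases the norm; the normalized first eigenfunction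
shows that the constant is at least 1. -/
lemma one_le_bubbleConst (K : M.coarse) : 1 ≤ Cπ := by
  have h1 : 1 ∈ Finset.Icc 1 (L K) := Finset.mem_Icc.2 ⟨le_rfl, (hL K).1⟩
  have hφ1 := ((hφ K 1 (mem_Icc_of_le hL h1)).2.2 1 (mem_Icc_of_le hL h1)).1
  rw [if_pos rfl] at hφ1
  have h2 := hCπ.1 K (φ K 1) (Submodule.subset_span ⟨K, 1, h1, rfl⟩)
  have h3 := sBubble_le hκ hχ hχ_nonneg K (φ K 1)
  rw [hφ1] at h2 h3
  by_contra! hlt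
  rcases le_or_gt (M.sBubble κ χ K (φ K 1)) 0 with h | h
  · have hn : 0 ≤ M.sBubble κ χ K (φ K 1) := by
      unfold sBubble
      refine Finset.sum_nonneg fun τ _ => ?_
      split_ifs
      · refine τ.1.integral_nonneg' fun x hx => ?_
        rw [map_mul, map_mul, map_pow]
        exact mul_nonneg (mul_nonneg (M.eval_kTilde_nonneg hκ χ τ x)
          (bubble_mem_Icc hκ hχ hχ_nonneg hx).1) (sq_nonneg _)
      · exact le_rfl
    rw [le_antisymm h hn, mul_zero] at h2
    exact absurd h2 (by norm_num)
  · nlinarith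

variable (hCI : M.IsInterpConst κ χ CI) (hsmall : M.FineSmall χ lam L CI Cπ)

include hCI hsmall

/-- The smallness criterion in squared form, with 16 = `CT` ^ 2. -/
lemma sq_mul_lt_one (K : M.coarse) :
    Cπ ^ 2 * (16 + M.lamMax lam L) ^ 2 * (CI ^ 2 * M.ΘSup χ Set.univ * M.h ^ 2) < 1 := by
  have hC := one_le_bubbleConst hκ hχ hχ_nonneg hφ hL hCπ K
  have hl := lamMax_nonneg hκ hφ hL K
  have hT := ΘSup_nonneg (χ := χ) Set.univ
  have hh := M.h_nonneg
  have hI := hCI.1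
  unfold FineSmall at hsmall
  rw [CT_eq K] at hsmall
  have h0 : 0 ≤ Cπ * CI * (4 ^ 2 + M.lamMax lam L) * √(M.ΘSup χ Set.univ) * M.h := by positivity
  calc _ = (Cπ * CI * (4 ^ 2 + M.lamMax lam L) * √(M.ΘSup χ Set.univ) * M.h) ^ 2 := by
        rw [mul_pow, mul_pow _ (√(M.ΘSup χ Set.univ)), Real.sq_sqrt hT]
        ring
    _ < 1 := pow_lt_one₀ h0 hsmall two_ne_zero

/-- The interpolated bubble functions induce a coercive form on the auxiliary space. -/
lemma sLoc_le_sLoc_Ih_bubble_mul {ν : M.Fun} (hν : ν ∈ M.Vaux φ L) (K : M.coarse) :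
    M.sLoc κ χ K ν ν ≤ 25 / 3 * Cπ * M.sLoc κ χ K (M.Ih (M.bubble χ * ν)) ν := by
  have hC := one_le_bubbleConst hκ hχ hχ_nonneg hφ hL hCπ K
  have hl := lamMax_nonneg hκ hφ hL K
  have hsq := sq_mul_lt_one hκ hχ hχ_nonneg hφ hL hCπ hCI hsmall K
  have hνV := Vaux_le_Vh hφ hL hν
  have hu : ∀ τ, (M.bubble χ * ν) τ ∈ restrictDegree (Fin 2) ℝ 5 :=
    (M.mul_continuous (bubble_mem_broken hχ) hνV.1).1
  have hz : ∀ τ, ∀ x ∈ τ.1.carrier ∩ frontier M.Ω, eval x ((M.bubble χ * ν) τ) = 0 :=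
    fun τ x hx => by rw [Pi.mul_apply, map_mul, hνV.2.1 τ x hx, mul_zero]
  have hT := ΘSup_nonneg (χ := χ) Set.univ
  have herr := sLoc_sub_Ih_le hκ hCI (K := K) hu hz
  have hen := aLoc_bubble_mul_le hκ hχ hχ_nonneg K ν
  have hlam := aLoc_le_lamMax hφ hL hν K
  have hσ0 := M.sLoc_self_nonneg hκ χ K ν
  -- I_h(Bν) is Bν minus the interpolation error: Bν gives the bubble-weighted norm, and the error
  -- pairing is small by Cauchy–Schwarz.
  have hsub : M.sLoc κ χ K (M.Ih (M.bubble χ * ν)) ν = M.sBubble κ χ K ν -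
      M.sLoc κ χ K (M.bubble χ * ν - M.Ih (M.bubble χ * ν)) ν := by
    have := LinearMap.map_sub₂ (M.sLocForm κ χ K) (M.bubble χ * ν) (M.Ih (M.bubble χ * ν)) ν
    rw [sLocForm_apply, sLocForm_apply, sLocForm_apply, sLoc_bubble_mul] at this
    linarith
  have hcs := form_cauchySchwarz (M.sLocForm κ χ K) (M.sLoc_comm κ χ K)
    (fun v => M.sLoc_self_nonneg hκ χ K v) (M.bubble χ * ν - M.Ih (M.bubble χ * ν)) ν
  simp only [sLocForm_apply] at hcs
  have hθ : 0 ≤ CI ^ 2 * M.ΘSup χ Set.univ * M.h ^ 2 := by positivity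
  rw [hsub]
  refine le_of_small_error hC hθ hσ0 hsq (herr.trans ?_) hcs (hCπ.1 K ν hν)
  exact mul_le_mul_of_nonneg_left (by linarith) (by positivity)

/-- The correction of the moments with respect to the auxiliary space. -/
lemma exists_corrector (i : M.coarse) : ∃ c : M.Fun →ₗ[ℝ] M.Fun, ∀ v,
    c v ∈ M.Vh ∧ M.penalty κ (c v) (c v) = 0 ∧
    (∀ K, ∀ l ∈ Finset.Icc 1 (L K), M.s κ χ (c v) (φ K l) = M.s κ χ v (φ K l)) ∧
    ∑ K, M.aLoc κ K (c v) (c v) ≤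
      (2 * Cπ * (1 + CI ^ 2) * (16 + M.lamMax lam L)) ^ 2 * M.s κ χ v v ∧
    ((∀ K, ∀ l ∈ Finset.Icc 1 (L K), M.s κ χ v (φ K l) = 0) → c v = 0) ∧
    ∀ S, v ∈ M.VhOn S → c v ∈ M.VhOn S := by
  have hC := one_le_bubbleConst hκ hχ hχ_nonneg hφ hL hCπ i
  have hl := lamMax_nonneg hκ hφ hL i
  have hcoer := @sLoc_le_sLoc_Ih_bubble_mul M κ χ lam φ L CI Cπ hκ hχ hχ_nonneg hφ hL hCπ hCI hsmall
  have hcoer' : ∀ ν ∈ M.Vaux φ L,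
      M.s κ χ ν ν ≤ 25 / 3 * Cπ * M.s κ χ (M.Ih (M.bubble χ * ν)) ν := fun ν hν => by
    unfold s
    rw [Finset.mul_sum]
    exact Finset.sum_le_sum fun K _ => hcoer hν K
  have hzero : ∀ ν ∈ M.Vaux φ L, M.s κ χ (M.Ih (M.bubble χ * ν)) ν = 0 → ν = 0 := fun ν hν h0 => by
    have h1 := hcoer' ν hν
    rw [h0, mul_zero] at h1
    have h2 := (Finset.sum_eq_zero_iff_of_nonneg fun K _ => M.sLoc_self_nonneg hκ χ K ν).1
      (le_antisymm h1 (M.s_self_nonneg hκ χ ν))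
    exact funext fun τ => eq_zero_of_sLoc_self hφ hL (Vaux_le_Vh hφ hL hν)
      (h2 (M.parent τ) (Finset.mem_univ _)) rfl
  have := finiteDimensional_Vaux hφ hL
  let J : M.Fun →ₗ[ℝ] M.Fun := M.Ih ∘ₗ LinearMap.mulLeft ℝ (M.bubble χ)
  -- The form (ν, μ) ↦ s(I_h(Bν), μ) need not be symmetric, but coercivity makes it nondegenerate on
  -- the finite-dimensional auxiliary space. So `P v` is the unique auxiliary function reproducing
  -- the moments of `v`.
  obtain ⟨P, hPmem, hP⟩ := exists_linear_representative (M.Vaux φ L) (M.sForm κ χ ∘ₗ J)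
    (fun ν hν h0 => hzero ν hν (by simpa [J] using h0 ν hν)) (M.sForm κ χ)
  replace hP : ∀ v, ∀ μ ∈ M.Vaux φ L,
      M.s κ χ (M.Ih (M.bubble χ * P v)) μ = M.s κ χ v μ := fun v μ hμ => by
    simpa [J] using hP v μ hμ
  have hmem : ∀ v, M.Ih (M.bubble χ * P v) ∈ M.Vh := fun v =>
    M.Ih_mul_mem (bubble_mem_broken hχ) (Vaux_le_Vh hφ hL (hPmem v))
  refine ⟨J ∘ₗ P, fun v => ?_⟩
  change M.Ih (M.bubble χ * P v) ∈ M.Vh ∧ M.penalty κ (M.Ih (M.bubble χ * P v))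
    (M.Ih (M.bubble χ * P v)) = 0 ∧
    (∀ K, ∀ l ∈ Finset.Icc 1 (L K), M.s κ χ (M.Ih (M.bubble χ * P v)) (φ K l) =
      M.s κ χ v (φ K l)) ∧
    ∑ K, M.aLoc κ K (M.Ih (M.bubble χ * P v)) (M.Ih (M.bubble χ * P v)) ≤
      (2 * Cπ * (1 + CI ^ 2) * (16 + M.lamMax lam L)) ^ 2 * M.s κ χ v v ∧
    ((∀ K, ∀ l ∈ Finset.Icc 1 (L K), M.s κ χ v (φ K l) = 0) →
      M.Ih (M.bubble χ * P v) = 0) ∧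
    ∀ S, v ∈ M.VhOn S → M.Ih (M.bubble χ * P v) ∈ M.VhOn S
  set ν := P v with hν
  have hνm := hPmem v
  have hνV : ν ∈ M.Vh := Vaux_le_Vh hφ hL hνm
  refine ⟨hmem v, penalty_Ih_bubble_mul hκ hχ hνV, fun K l hl =>
    hP v _ (Submodule.subset_span ⟨K, l, hl, rfl⟩), ?_, fun h => ?_, fun S hS => ?_⟩
  · have hcs := form_cauchySchwarz (M.sForm κ χ) (fun v w => by
      rw [sForm_apply, sForm_apply, s_comm]) (fun v => by
      rw [sForm_apply]; exact M.s_self_nonneg hκ χ v) v ν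
    simp only [sForm_apply] at hcs
    have h1 := hcoer' ν hνm
    rw [hP v ν hνm] at h1
    have hsv := M.s_self_nonneg hκ χ v
    have hsν := M.s_self_nonneg hκ χ ν
    have h2 := le_sq_mul_of_le_mul hsv hsν h1 hcs
    have hu : ∀ τ, (M.bubble χ * ν) τ ∈ restrictDegree (Fin 2) ℝ 5 :=
      (M.mul_continuous (bubble_mem_broken hχ) hνV.1).1
    have hz : ∀ τ, ∀ x ∈ τ.1.carrier ∩ frontier M.Ω, eval x ((M.bubble χ * ν) τ) = 0 :=
      fun τ x hx => by rw [Pi.mul_apply, map_mul, hνV.2.1 τ x hx, mul_zero]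
    refine le_trans ?_ (corrector_bound hCI.1 hl hsv h2)
    unfold s
    rw [Finset.mul_sum, Finset.mul_sum]
    refine Finset.sum_le_sum fun K _ => (aLoc_Ih_le hκ hCI hu hz).trans ?_
    refine mul_le_mul_of_nonneg_left ?_ (by positivity)
    have h3 := aLoc_bubble_mul_le hκ hχ hχ_nonneg K ν
    have h4 := aLoc_le_lamMax hφ hL hνm K
    linarith
  -- If all moments of `v` vanish, testing with `ν` itself and coercivity give ν = 0.
  · have hker : M.Vaux φ L ≤ LinearMap.ker (M.sForm κ χ v) := by
      refine Submodule.span_le.2 ?_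
      rintro w ⟨K, l, hl, rfl⟩
      change M.sForm κ χ v (φ K l) = 0
      rw [sForm_apply, h K l hl]
    have h0 : M.s κ χ v ν = 0 := by
      have : M.sForm κ χ v ν = 0 := hker hνm
      rwa [sForm_apply] at this
    rw [hzero ν hνm (by rw [hP v ν hνm, h0]), mul_zero, map_zero]
  · refine ⟨(hmem v).1, (hmem v).2.1, fun τ hτ => ?_⟩
    -- The restriction of `ν` to a block is again an auxiliary function. Testing with it on a block
    -- where `v` vanishes and using blockwise coercivity gives ν = 0 there.
    have h0 := hP v _ (cut_mem_Vaux hφ hL hνm (M.parent τ))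
    have hv0 : M.sLoc κ χ (M.parent τ) v ν = 0 := by
      rw [sLoc_comm]
      exact sLoc_eq_zero_right fun σ hσ => hS.2.2 σ (by rwa [hσ])
    rw [s_cut_right, s_cut_right, hv0] at h0
    have h1 := hcoer hνm (M.parent τ)
    rw [h0, mul_zero] at h1
    have h2 := eq_zero_of_sLoc_self hφ hL hνV
      (le_antisymm h1 (M.sLoc_self_nonneg hκ χ _ ν)) rfl
    rw [M.Ih_apply, Pi.mul_apply, h2, mul_zero, map_zero]

end Coercivity

end Mesh

end CEM

/-! ### Overlap of the node patches, growth of supports, and the space `auxOrtho`. -/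

namespace CEM

open MvPolynomial

/-- Cauchy–Schwarz over the at most |t| terms that may be nonzero. -/
lemma sq_sum_le_of_support {ι : Type*} (s t : Finset ι) (f : ι → ℝ)
    (h : ∀ z ∈ s, z ∉ t → f z = 0) : (∑ z ∈ s, f z) ^ 2 ≤ t.card * ∑ z ∈ s, f z ^ 2 := by
  classical
  have h1 : ∑ z ∈ s, f z = ∑ z ∈ s ∩ t, f z :=
    (Finset.sum_subset Finset.inter_subset_left fun z hz hzt =>
      h z hz fun hz' => hzt (Finset.mem_inter.2 ⟨hz, hz'⟩)).symm
  rw [h1]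
  calc (∑ z ∈ s ∩ t, f z) ^ 2 ≤ (s ∩ t).card * ∑ z ∈ s ∩ t, f z ^ 2 := sq_sum_le_card_mul_sum_sq
    _ ≤ _ := by
      gcongr
      · exact Finset.inter_subset_right
      · exact Finset.inter_subset_left

namespace Mesh

variable {M : Mesh} {κ : M.fine → ℝ} {χ : Pt → M.Fun} {lam : M.coarse → ℕ → ℝ}
  {φ : M.coarse → ℕ → M.Fun} {L : M.coarse → ℕ} {γ C0 CI Cπ : ℝ}

section Overlap

variable (hκ : ∀ τ, 0 < κ τ) {f : Pt → M.Fun} (hf : ∀ z ∈ M.nodes, f z ∈ M.VhOn (M.star z))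

include hκ hf

lemma sum_aLoc_overlap_le : ∑ K, M.aLoc κ K (∑ z ∈ M.nodes, f z) (∑ z ∈ M.nodes, f z) ≤
    8 * ∑ z ∈ M.nodes, ∑ K, M.aLoc κ K (f z) (f z) := by
  simp only [sum_aLoc]
  rw [Finset.sum_comm, Finset.mul_sum]
  refine Finset.sum_le_sum fun τ _ => ?_
  rw [← Finset.mul_sum, mul_left_comm]
  refine mul_le_mul_of_nonneg_left ?_ (hκ τ).le
  rw [← τ.1.integral_sum', ← τ.1.integral_C_mul, Finset.sum_apply]
  refine τ.1.integral_mono' fun x _ => ?_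
  rw [map_mul, eval_C, map_sum]
  simp only [Rect.eval_gradDot_self, map_sum]
  rw [Finset.sum_add_distrib, mul_add]
  have h : ∀ d, (∑ z ∈ M.nodes, eval x (pderiv d (f z τ))) ^ 2 ≤
      8 * ∑ z ∈ M.nodes, eval x (pderiv d (f z τ)) ^ 2 := fun d => by
    refine (sq_sum_le_of_support _ (M.parent τ).1.vertices _ fun z hz hzt => by
      rw [(hf z hz).2.2 τ hzt, map_zero, map_zero]).trans ?_
    rw [(M.parent τ).1.card_vertices]
    refine mul_le_mul_of_nonneg_right (by norm_num) (Finset.sum_nonneg fun _ _ => sq_nonneg _)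
  exact add_le_add (h 0) (h 1)

/-- A jump sees the patches of the vertices of two coarse blocks, so at most 4 + 4 functions; the
energy term has only 4, and 8 serves for both. -/
lemma penalty_overlap_le : M.penalty κ (∑ z ∈ M.nodes, f z) (∑ z ∈ M.nodes, f z) ≤
    8 * ∑ z ∈ M.nodes, M.penalty κ (f z) (f z) := by
  classical
  have hV : ∀ z ∈ M.nodes, f z ∈ M.Vh := fun z hz => M.VhOn_le_Vh _ (hf z hz)
  have h := M.sum_penalty_le hκ {()} M.nodes (v := fun _ => ∑ z ∈ M.nodes, f z) (w := f)
    (fun _ _ => Submodule.sum_mem _ hV) hV 8 (fun d τ σ _ _ => by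
      rw [Finset.sum_singleton]
      simp only [← Rect.edgeHom_apply]
      rw [← map_sum, ← smul_eq_mul, ← map_smul]
      simp only [Rect.edgeHom_apply]
      refine τ.1.edgeIntegral_mono d _ fun t _ => ?_
      simp only [smul_eval, map_pow, map_sub, map_sum, Finset.sum_apply]
      rw [← Finset.sum_sub_distrib]
      refine (sq_sum_le_of_support _
        ((M.parent τ).1.vertices ∪ (M.parent σ).1.vertices) _ fun z hz hzt => by
          rw [Finset.mem_union, not_or] at hzt
          rw [(hf z hz).2.2 τ hzt.1, (hf z hz).2.2 σ hzt.2, sub_self]).trans ?_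
      have hc : (((M.parent τ).1.vertices ∪ (M.parent σ).1.vertices).card : ℝ) ≤ 8 := by
        have := Finset.card_union_le (M.parent τ).1.vertices (M.parent σ).1.vertices
        rw [(M.parent τ).1.card_vertices, (M.parent σ).1.card_vertices] at this
        exact_mod_cast this
      exact mul_le_mul_of_nonneg_right hc (Finset.sum_nonneg fun _ _ => sq_nonneg _))
  rwa [Finset.sum_singleton] at h

lemma normDGsq_overlap_le (hγ : 0 < γ) : M.normDGsq κ γ (∑ z ∈ M.nodes, f z) ≤
    8 * ∑ z ∈ M.nodes, M.normDGsq κ γ (f z) := by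
  unfold normDGsq
  rw [Finset.sum_add_distrib, ← Finset.mul_sum, mul_add, mul_left_comm]
  exact add_le_add (sum_aLoc_overlap_le hκ hf) (mul_le_mul_of_nonneg_left
    (penalty_overlap_le hκ hf) (div_nonneg hγ.le M.h_nonneg))

end Overlap

lemma mem_oversample_succ {i K : M.coarse} {k : ℕ} (h : K ∈ M.oversample i k) :
    K ∈ M.oversample i (k + 1) :=
  ⟨K, h, by rw [Set.inter_self]; exact ⟨_, Set.left_mem_Icc.2 K.1.lo_le_hi⟩⟩

lemma oversample_mono (i : M.coarse) : Monotone (M.oversample i) :=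
  monotone_nat_of_le_succ fun _ _ => mem_oversample_succ

/-- A node patch either does not touch an oversampled domain, or is contained in the one with
two more layers. -/
lemma aDG_eq_zero_or_star_subset (κ : M.fine → ℝ) (γ : ℝ) {i : M.coarse} {k : ℕ} {v : M.Fun}
    (hv : v ∈ M.VhOn (M.oversample i k)) (z : Pt) :
    (∀ w ∈ M.VhOn (M.star z), M.aDG κ γ v w = 0) ∨ M.star z ⊆ M.oversample i (k + 2) := by
  by_cases h : ∃ K ∈ M.star z, ∃ K' ∈ M.oversample i k, (K.1.carrier ∩ K'.1.carrier).Nonempty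
  · obtain ⟨K, hK, K', hK', hne⟩ := h
    -- The first layer reaches the touching block `K` of the patch; the second reaches all blocks
    -- that share the vertex `z` with `K`.
    exact Or.inr fun K'' hK'' => ⟨K, ⟨K', hK', hne⟩, z, K''.1.vertices_subset hK'',
      K.1.vertices_subset hK⟩
  · refine Or.inl fun w hw => M.aDG_eq_zero_of_not_touching κ γ fun τ σ hne => ?_
    by_contra! hcon
    refine h ⟨M.parent σ, ?_, M.parent τ, ?_, by rwa [Set.inter_comm]⟩
    · by_contra hσ
      exact hcon.2 (hw.2.2 σ hσ)
    · by_contra hτ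
      exact hcon.1 (hv.2.2 τ hτ)

/-- The functions without component in the auxiliary space. -/
def auxOrtho (κ : M.fine → ℝ) (χ : Pt → M.Fun) (φ : M.coarse → ℕ → M.Fun) (L : M.coarse → ℕ) :
    Submodule ℝ M.Fun where
  carrier := {w | w ∈ M.Vh ∧ ∀ K, ∀ l ∈ Finset.Icc 1 (L K), M.s κ χ w (φ K l) = 0}
  add_mem' := fun {v w} hv hw => ⟨Submodule.add_mem _ hv.1 hw.1, fun K l hl => by
    rw [← sForm_apply, map_add, LinearMap.add_apply, sForm_apply, sForm_apply, hv.2 K l hl,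
      hw.2 K l hl, add_zero]⟩
  zero_mem' := ⟨Submodule.zero_mem _, fun K l _ => by
    rw [← sForm_apply, map_zero, LinearMap.zero_apply]⟩
  smul_mem' := fun c v hv => ⟨Submodule.smul_mem _ c hv.1, fun K l hl => by
    rw [← sForm_apply, map_smul, LinearMap.smul_apply, sForm_apply, hv.2 K l hl, smul_zero]⟩

lemma s_sub_left (v w u : M.Fun) : M.s κ χ (v - w) u = M.s κ χ v u - M.s κ χ w u := by
  simp only [← sForm_apply, map_sub, LinearMap.sub_apply]

lemma sub_mem_auxOrtho {i : M.coarse} {j : ℕ} {v w : M.Fun} (hv : v ∈ M.Vh) (hw : w ∈ M.Vh)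
    (hv' : M.IsPhiOrthogonal κ χ φ L i j v) (hw' : M.IsPhiOrthogonal κ χ φ L i j w) :
    v - w ∈ M.auxOrtho κ χ φ L := by
  refine ⟨Submodule.sub_mem _ hv hw, fun K l hl => ?_⟩
  rw [s_sub_left]
  by_cases h : K = i ∧ l = j
  · rw [(hv' K l hl).1 h, (hw' K l hl).1 h, sub_self]
  · rw [(hv' K l hl).2 h, (hw' K l hl).2 h, sub_self]

lemma IsPhiOrthogonal.sub {i : M.coarse} {j : ℕ} {v w : M.Fun}
    (hv : M.IsPhiOrthogonal κ χ φ L i j v) (hw : w ∈ M.auxOrtho κ χ φ L) :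
    M.IsPhiOrthogonal κ χ φ L i j (v - w) := fun K l hl => by
  rw [s_sub_left, hw.2 K l hl, sub_zero]
  exact hv K l hl

lemma normDGsq_sub_le (hκ : ∀ τ, 0 < κ τ) (hγ : 0 < γ) (v w : M.Fun) :
    M.normDGsq κ γ (v - w) ≤ 2 * M.normDGsq κ γ v + 2 * M.normDGsq κ γ w := by
  have h := M.normDGsq_nonneg hκ hγ (v + w)
  simp only [← dgForm_self, map_add, map_sub, LinearMap.add_apply, LinearMap.sub_apply] at *
  linarith

section Gap

variable (hκ : ∀ τ, 0 < κ τ) (hφ : M.IsEigensystem κ χ lam φ)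
  (hL : ∀ K, 1 ≤ L K ∧ L K < Module.finrank ℝ (M.VhLoc K))

include hκ hφ hL

lemma s_le_of_mem_auxOrtho {w : M.Fun} (hw : w ∈ M.auxOrtho κ χ φ L) (i : M.coarse) :
    M.s κ χ w w ≤ (M.Λ lam L)⁻¹ * ∑ K, M.aLoc κ K w w := by
  have hΛ := Λ_pos hκ hφ hL i
  rw [inv_mul_eq_div, le_div_iff₀' hΛ, s, Finset.mul_sum]
  exact Finset.sum_le_sum fun K _ => Λ_mul_sLoc_le hφ hL hw.1 K (hw.2 K)

/-- Zero DG norm means zero energy; the spectral gap then forces `s` to vanish, and `s` is definite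
on each block. -/
lemma normDGsq_pos_of_mem_auxOrtho (hγ : 0 < γ) {w : M.Fun} (hw : w ∈ M.auxOrtho κ χ φ L)
    (hw0 : w ≠ 0) : 0 < M.normDGsq κ γ w := by
  refine (M.normDGsq_nonneg hκ hγ w).lt_of_ne fun h => hw0 (funext fun τ => ?_)
  have hp := mul_nonneg (div_nonneg hγ.le M.h_nonneg) (M.penalty_self_nonneg hκ w)
  have ha : ∀ K ∈ Finset.univ, 0 ≤ M.aLoc κ K w w := fun K _ => M.aLoc_self_nonneg hκ K w
  have hs := s_le_of_mem_auxOrtho hκ hφ hL hw (M.parent τ)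
  unfold normDGsq at h
  rw [(by linarith [Finset.sum_nonneg ha] : ∑ K, M.aLoc κ K w w = 0), mul_zero] at hs
  have h0 := (Finset.sum_eq_zero_iff_of_nonneg fun K _ => M.sLoc_self_nonneg hκ χ K w).1
    (le_antisymm hs (M.s_self_nonneg hκ χ w))
  exact eq_zero_of_sLoc_self hφ hL hw.1 (h0 (M.parent τ) (Finset.mem_univ _)) rfl

omit hκ hφ in
lemma finiteDimensional_auxOrtho : FiniteDimensional ℝ (M.auxOrtho κ χ φ L) :=
  have := finiteDimensional_Vh (M := M) hL
  Submodule.finiteDimensional_of_le (fun _ hw => hw.1 : M.auxOrtho κ χ φ L ≤ M.Vh)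

end Gap

end Mesh

end CEM

/-! ### Numerical bounds, stable decomposition, and exponential decay. -/

namespace CEM

open MvPolynomial

/-- For w ∈ `auxOrtho`: A is the energy, P the scaled penalty, S = s(w,w) and r = Λ⁻¹. J and S' are
the total DG energy and total `s`-norm of the uncorrected pieces, and G is the corrector constant.
The correction costs 2GS' with S' ≤ (12/5)(1 + r)A; the remaining G/5 and the lower bound on G
absorb 2J. -/
lemma decomposition_bound {A S P J S' G I θ r : ℝ} (hA : 0 ≤ A) (hP : 0 ≤ P) (hr : 0 ≤ r)
    (hS : S ≤ r * A) (hθ : 256 * θ ≤ 1) (hθ0 : 0 ≤ θ) (hG : 2048 * (1 + I ^ 2) ≤ G)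
    (hJ : J ≤ 4 * (1 + I ^ 2) * (A + S) + 3 * P) (hS' : S' ≤ 2 * S + 74 * θ * (A + S)) :
    2 * J + 2 * (G * S') ≤ 5 * G * (1 + r) * (A + P) := by
  have hG0 : 0 ≤ G := le_trans (by positivity) hG
  have hAr : A + S ≤ (1 + r) * A := by linarith
  have hrA : 0 ≤ (1 + r) * A := by positivity
  have h1 : J ≤ G / 512 * ((1 + r) * A) + 3 * P := by
    have : 4 * (1 + I ^ 2) * (A + S) ≤ G / 512 * ((1 + r) * A) := by
      calc _ ≤ 4 * (1 + I ^ 2) * ((1 + r) * A) := by gcongr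
        _ ≤ _ := mul_le_mul_of_nonneg_right (by linarith) hrA
    linarith
  have h2 : S' ≤ 12 / 5 * ((1 + r) * A) := by
    have h3 : 74 * θ * (A + S) ≤ 74 * θ * ((1 + r) * A) := by gcongr
    have h4 : θ * ((1 + r) * A) ≤ 1 / 256 * ((1 + r) * A) :=
      mul_le_mul_of_nonneg_right (by linarith) hrA
    linarith
  have h5 : G * S' ≤ G * (12 / 5 * ((1 + r) * A)) := by gcongr
  have h6 : 6 * P ≤ 5 * G * (1 + r) * P := by
    refine mul_le_mul_of_nonneg_right ?_ hP
    nlinarith [mul_nonneg hG0 hr, sq_nonneg I]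
  have h7 : 0 ≤ G * ((1 + r) * A) := by positivity
  nlinarith

/-- The admissibility of the rate in the theorem for the constants 5D(1 + r)C² and 8C² of the
Schwarz method, with r = Λ⁻¹ and q = Λ^{-1/2}. After 1 + r ≤ (1 + q)² and C⁴ ≤ D²/4 everything
collapses to 360/D. -/
lemma schwarz_contrast_bound {D r q C : ℝ} (hD : 4096 ≤ D) (hq : 0 ≤ q)
    (hqr : q ^ 2 = r) (hC : 2 * C ^ 2 ≤ D) :
    5 * D * (1 + r) * C ^ 2 * (8 * C ^ 2) * (1 + 6 * (D ^ 2)⁻¹ * (1 + q)⁻¹ - 1) ^ 2 ≤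
      (1 + 6 * (D ^ 2)⁻¹ * (1 + q)⁻¹ + 1) ^ 2 := by
  have hD0 : 0 < D := by linarith
  have h1 : 1 + r ≤ (1 + q) ^ 2 := by nlinarith
  have h2 : C ^ 2 * C ^ 2 ≤ D / 2 * (D / 2) :=
    mul_self_le_mul_self (sq_nonneg C) (by linarith)
  calc 5 * D * (1 + r) * C ^ 2 * (8 * C ^ 2) * (1 + 6 * (D ^ 2)⁻¹ * (1 + q)⁻¹ - 1) ^ 2
      = 40 * D * (1 + r) * (C ^ 2 * C ^ 2) * (6 * (D ^ 2)⁻¹ * (1 + q)⁻¹) ^ 2 := by ring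
    _ ≤ 40 * D * (1 + q) ^ 2 * (D / 2 * (D / 2)) * (6 * (D ^ 2)⁻¹ * (1 + q)⁻¹) ^ 2 := by gcongr
    _ = 360 / D := by
        have : 1 + q ≠ 0 := by positivity
        field_simp
        ring
    _ ≤ 1 := by rw [div_le_one hD0]; linarith
    _ ≤ _ := by
        have : 0 ≤ 6 * (D ^ 2)⁻¹ * (1 + q)⁻¹ := by positivity
        nlinarith

/-- Two layers per iteration allow ⌊m/2⌋ iterations, and 2⌊m/2⌋ ≥ m - 1 explains the exponent 1 - m.
-/
lemma decay_bound {D r y a C : ℝ} (hD : 4096 ≤ D) (hr : 0 ≤ r) (hy : 1 ≤ y)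
    (hC : 2 * C ^ 2 ≤ D) (ha : a ≤ C ^ 2 * D) (m : ℕ) :
    4 * (y ^ (2 * (m / 2)))⁻¹ * a ≤ 40 * D ^ 3 * (1 + r) * y ^ (1 - (m : ℤ)) := by
  have hD0 : 0 < D := by linarith
  have h1 : (y ^ (2 * (m / 2)))⁻¹ ≤ y ^ (1 - (m : ℤ)) := by
    rw [← zpow_natCast, ← zpow_neg]
    refine zpow_le_zpow_right₀ hy ?_
    push_cast
    omega
  have h2 : 4 * a ≤ 40 * D ^ 3 * (1 + r) := by
    calc 4 * a ≤ 4 * (C ^ 2 * D) := by linarith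
      _ ≤ 4 * (D * D) := by gcongr; nlinarith [sq_nonneg C]
      _ ≤ 40 * D ^ 3 * 1 := by nlinarith [mul_pos hD0 hD0]
      _ ≤ _ := by gcongr; linarith
  have h3 : 0 ≤ (y ^ (2 * (m / 2)))⁻¹ := by positivity
  calc 4 * (y ^ (2 * (m / 2)))⁻¹ * a = 4 * a * (y ^ (2 * (m / 2)))⁻¹ := by ring
    _ ≤ 40 * D ^ 3 * (1 + r) * (y ^ (2 * (m / 2)))⁻¹ := by gcongr
    _ ≤ _ := by gcongr

namespace Mesh

variable {M : Mesh} {κ : M.fine → ℝ} {χ : Pt → M.Fun} {lam : M.coarse → ℕ → ℝ}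
  {φ : M.coarse → ℕ → M.Fun} {L : M.coarse → ℕ} {γ C0 CI Cπ : ℝ}

section

variable (hκ : ∀ τ, 0 < κ τ) (hγ : 0 < γ) (hC0 : M.IsNormEquivConst κ γ C0)

include hC0 in
lemma normEquiv_of_mem_Vh {w : M.Fun} (hw : w ∈ M.Vh) :
    M.aDG κ γ w w ≤ C0 ^ 2 * M.normDGsq κ γ w ∧ M.normDGsq κ γ w ≤ C0 ^ 2 * M.aDG κ γ w w :=
  hC0.2 w (M.broken_mono (by norm_num) hw.1)

include hκ hγ hC0 in
lemma aDG_self_nonneg {w : M.Fun} (hw : w ∈ M.Vh) : 0 ≤ M.aDG κ γ w w := by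
  have h1 := (normEquiv_of_mem_Vh hC0 hw).2
  have h2 := M.normDGsq_nonneg hκ hγ w
  have h3 : 0 < C0 ^ 2 := by have := hC0.1; positivity
  exact nonneg_of_mul_nonneg_right (h2.trans h1) h3

lemma aDG_add_self (v w : M.Fun) : M.aDG κ γ (v + w) (v + w) =
    M.aDG κ γ v v + 2 * M.aDG κ γ v w + M.aDG κ γ w w := by
  simp only [← aForm_apply, map_add, LinearMap.add_apply]
  rw [aForm_apply, aForm_apply, aForm_apply, aForm_apply, M.aDG_comm κ γ w v]
  ring

include hκ hγ hC0 in
/-- The Euler-Lagrange equation of the minimization problem. -/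
lemma IsCEMBasis.orthogonal {i : M.coarse} {j : ℕ} {ψ w : M.Fun}
    (hψ : M.IsCEMBasis κ γ χ φ L M.Vh i j ψ) (hw : w ∈ M.auxOrtho κ χ φ L) :
    M.aDG κ γ ψ w = 0 := by
  have h : ∀ t : ℝ, 0 ≤ 2 * t * M.aDG κ γ ψ w + t ^ 2 * M.aDG κ γ w w := fun t => by
    have htw := Submodule.smul_mem _ (-t) hw
    have := hψ.2.2 (ψ - (-t) • w) (Submodule.sub_mem _ hψ.1 htw.1) (hψ.2.1.sub htw)
    rw [neg_smul, sub_neg_eq_add, aDG_add_self] at this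
    have e1 : M.aDG κ γ ψ (t • w) = t * M.aDG κ γ ψ w := by
      rw [← aForm_apply, map_smul, aForm_apply, smul_eq_mul]
    have e2 : M.aDG κ γ (t • w) (t • w) = t ^ 2 * M.aDG κ γ w w := by
      rw [← aForm_apply, map_smul, map_smul, LinearMap.smul_apply, aForm_apply, smul_eq_mul,
        smul_eq_mul]
      ring
    rw [e1, e2] at this
    linarith
  have hA := aDG_self_nonneg hκ hγ hC0 hw.1
  -- Nearly the minimizer of the quadratic in t; the added 1 keeps the denominator positive when w
  -- has zero energy.
  have h1 := h (-M.aDG κ γ ψ w / (M.aDG κ γ w w + 1))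
  have hA1 : 0 < M.aDG κ γ w w + 1 := by linarith
  have h2 : 2 * (-M.aDG κ γ ψ w / (M.aDG κ γ w w + 1)) * M.aDG κ γ ψ w +
      (-M.aDG κ γ ψ w / (M.aDG κ γ w w + 1)) ^ 2 * M.aDG κ γ w w =
      -(M.aDG κ γ ψ w / (M.aDG κ γ w w + 1)) ^ 2 * (M.aDG κ γ w w + 2) := by
    field_simp
    ring
  rw [h2] at h1
  have h3 : (M.aDG κ γ ψ w / (M.aDG κ γ w w + 1)) ^ 2 = 0 :=
    le_antisymm (by nlinarith [sq_nonneg (M.aDG κ γ ψ w / (M.aDG κ γ w w + 1))]) (sq_nonneg _)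
  have h4 := (pow_eq_zero_iff two_ne_zero).1 h3
  rcases div_eq_zero_iff.1 h4 with h5 | h5
  · exact h5
  · exact absurd h5 hA1.ne'

end

section Decay

variable (hκ : ∀ τ, 0 < κ τ) (hγ : 0 < γ) (hχ : M.IsMsBasis κ χ)
  (hχ_nonneg : ∀ z ∈ M.nodes, ∀ τ : M.fine, ∀ x ∈ τ.1.carrier, 0 ≤ eval x (χ z τ))
  (hφ : M.IsEigensystem κ χ lam φ)
  (hL : ∀ K, 1 ≤ L K ∧ L K < Module.finrank ℝ (M.VhLoc K))
  (hC0 : M.IsNormEquivConst κ γ C0) (hCπ : M.IsBubbleConst κ χ φ L Cπ)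
  (hCI : M.IsInterpConst κ χ CI) (hsmall : M.FineSmall χ lam L CI Cπ)

include hκ hχ hχ_nonneg hφ hL hCπ hCI

/-- From Cπ ≥ 1 and λ_max ≥ 0 the right side is at least 1024 (1 + CI²)², and 1 + CI² ≥ 2. Together
with `corrector_const_le_D` this gives D ≥ 4096. -/
lemma le_corrector_const (i : M.coarse) :
    2048 * (1 + CI ^ 2) ≤ (2 * Cπ * (1 + CI ^ 2) * (16 + M.lamMax lam L)) ^ 2 := by
  have hC := one_le_bubbleConst hκ hχ hχ_nonneg hφ hL hCπ i
  have hl := lamMax_nonneg hκ hφ hL i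
  have h5 : 2 ≤ 1 + CI ^ 2 := by nlinarith [hCI.1]
  calc 2048 * (1 + CI ^ 2) ≤ (2 * 1 * (1 + CI ^ 2) * (16 + 0)) ^ 2 := by nlinarith
    _ ≤ _ := by gcongr

include hsmall

/-- The denominator in `D` lies in (0, 1]: its local supremum of Θ is at most the global one, for
which smallness is assumed. -/
lemma corrector_const_le_D (i : M.coarse) :
    (2 * Cπ * (1 + CI ^ 2) * (16 + M.lamMax lam L)) ^ 2 ≤ M.D χ lam L C0 CI Cπ i := by
  have hC := one_le_bubbleConst hκ hχ hχ_nonneg hφ hL hCπ i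
  have hl := lamMax_nonneg hκ hφ hL i
  have hI := hCI.1
  have hh := M.h_nonneg
  refine le_trans ?_ (le_max_left _ _)
  unfold FineSmall at hsmall
  rw [CT_eq i] at hsmall ⊢
  norm_num only at hsmall ⊢
  have h1 : Cπ * CI * (16 + M.lamMax lam L) * √(M.ΘSup χ {i}) * M.h ≤
      Cπ * CI * (16 + M.lamMax lam L) * √(M.ΘSup χ Set.univ) * M.h := by
    have := Real.sqrt_le_sqrt (M.ΘSup_le_univ (χ := χ) {i})
    gcongr
  have h2 : 0 ≤ Cπ * CI * (16 + M.lamMax lam L) * √(M.ΘSup χ {i}) * M.h := by positivity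
  refine pow_le_pow_left₀ (by positivity) (le_div_self (by positivity) ?_ ?_) 2 <;> linarith

include hγ

/-- The stable decomposition of a function without component in the auxiliary space into
functions of the same kind that are supported in the node patches. -/
lemma exists_decomposition (i : M.coarse) {w : M.Fun} (hw : w ∈ M.auxOrtho κ χ φ L) :
    ∃ f : Pt → M.Fun, (∀ z ∈ M.nodes, f z ∈ M.auxOrtho κ χ φ L ∧ f z ∈ M.VhOn (M.star z)) ∧
      ∑ z ∈ M.nodes, f z = w ∧
      ∑ z ∈ M.nodes, M.normDGsq κ γ (f z) ≤
        5 * (2 * Cπ * (1 + CI ^ 2) * (16 + M.lamMax lam L)) ^ 2 * (1 + (M.Λ lam L)⁻¹) *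
          M.normDGsq κ γ w := by
  obtain ⟨c, hc⟩ := exists_corrector hκ hχ hχ_nonneg hφ hL hCπ hCI hsmall i
  have hJ := fun z hz => Ih_msBasis_mul_mem hχ hκ (z := z) hz hw.1
  have hsum := sum_Ih_msBasis_mul hκ hχ hw.1.1
  refine ⟨fun z => M.Ih (χ z * w) - c (M.Ih (χ z * w)), fun z hz => ⟨⟨?_, ?_⟩, ?_⟩, ?_, ?_⟩
  · exact Submodule.sub_mem _ (M.VhOn_le_Vh _ (hJ z hz)) (hc _).1
  · intro K l hl
    rw [s_sub_left, (hc _).2.2.1 K l hl, sub_self]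
  · exact Submodule.sub_mem _ (hJ z hz) ((hc _).2.2.2.2.2 _ (hJ z hz))
  -- By linearity the corrections add up to `c w`, and this vanishes because `w` has no moments.
  · rw [Finset.sum_sub_distrib, ← map_sum c, hsum, (hc w).2.2.2.2.1 hw.2, sub_zero]
  · have hG := le_corrector_const hκ hχ hχ_nonneg hφ hL hCπ hCI i
    have hθ := sq_mul_lt_one hκ hχ hχ_nonneg hφ hL hCπ hCI hsmall i
    have hC := one_le_bubbleConst hκ hχ hχ_nonneg hφ hL hCπ i
    have hl := lamMax_nonneg hκ hφ hL i
    have hT := ΘSup_nonneg (χ := χ) Set.univ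
    have hθ0 : 0 ≤ CI ^ 2 * M.ΘSup χ Set.univ * M.h ^ 2 := by positivity
    have hg : 0 ≤ γ / M.h := div_nonneg hγ.le M.h_nonneg
    have hE := sum_energy_Ih_le hκ hχ hχ_nonneg hCI hw.1
    have hS := sum_s_Ih_le hκ hχ hχ_nonneg hCI hw.1
    have hP := mul_le_mul_of_nonneg_left (sum_penalty_Ih_le hκ hχ hχ_nonneg hw.1) hg
    have hθ' : 256 * (CI ^ 2 * M.ΘSup χ Set.univ * M.h ^ 2) ≤ 1 := by
      refine le_trans (mul_le_mul_of_nonneg_right ?_ hθ0) hθ.le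
      calc (256 : ℝ) = 1 ^ 2 * (16 + 0) ^ 2 := by norm_num
        _ ≤ _ := by gcongr
    refine le_trans ?_ (decomposition_bound (Finset.sum_nonneg fun K _ => M.aLoc_self_nonneg hκ K w)
      (mul_nonneg hg (M.penalty_self_nonneg hκ w)) (inv_nonneg.2 (Λ_pos hκ hφ hL i).le)
      (s_le_of_mem_auxOrtho hκ hφ hL hw i) hθ' hθ0 hG
      (J := ∑ z ∈ M.nodes, M.normDGsq κ γ (M.Ih (χ z * w))) ?_ hS)
    · rw [Finset.mul_sum, Finset.mul_sum, Finset.mul_sum, ← Finset.sum_add_distrib]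
      refine Finset.sum_le_sum fun z _ => (normDGsq_sub_le hκ hγ _ _).trans ?_
      have h1 := (hc (M.Ih (χ z * w))).2.2.2.1
      -- The corrector has no jumps, so its DG norm is pure energy, which is bounded by `s` of the
      -- piece.
      have h2 : M.normDGsq κ γ (c (M.Ih (χ z * w))) =
          ∑ K, M.aLoc κ K (c (M.Ih (χ z * w))) (c (M.Ih (χ z * w))) := by
        rw [normDGsq, (hc _).2.1, mul_zero, add_zero]
      rw [h2]
      linarith
    · unfold normDGsq
      rw [Finset.sum_add_distrib, ← Finset.mul_sum]
      linarith

include hC0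

/-- Exponential decay: a function which is energy orthogonal to everything away from one block is
well approximated by functions with local support. -/
lemma exists_local_approximation (i : M.coarse) {u v : M.Fun} (hu : u ∈ M.auxOrtho κ χ φ L)
    (hv : v ∈ M.VhOn {i}) (huv : ∀ w ∈ M.auxOrtho κ χ φ L, M.aDG κ γ u w = M.aDG κ γ v w)
    {y : ℝ} (hy : 1 < y)
    (hy' : 5 * M.D χ lam L C0 CI Cπ i * (1 + (M.Λ lam L)⁻¹) * C0 ^ 2 * (8 * C0 ^ 2) *
      (y - 1) ^ 2 ≤ (y + 1) ^ 2) (n : ℕ) :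
    ∃ x ∈ M.auxOrtho κ χ φ L, x ∈ M.VhOn (M.oversample i (2 * n)) ∧
      M.aDG κ γ (u - x) (u - x) ≤ 4 * (y ^ (2 * n))⁻¹ * M.aDG κ γ u u := by
  have hΛ := Λ_pos hκ hφ hL i
  have hC00 := hC0.1
  have hGD := corrector_const_le_D (C0 := C0) hκ hχ hχ_nonneg hφ hL hCπ hCI hsmall i
  have hD : 0 < M.D χ lam L C0 CI Cπ i :=
    lt_of_lt_of_le (by positivity) ((le_corrector_const hκ hχ hχ_nonneg hφ hL hCπ hCI i).trans hGD)
  have := finiteDimensional_auxOrtho (κ := κ) (χ := χ) (φ := φ) hL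
  let W := M.auxOrtho κ χ φ L
  have hdpos : ∀ w : W, w ≠ 0 → 0 < M.normDGsq κ γ w := fun w hw =>
    normDGsq_pos_of_mem_auxOrtho hκ hφ hL hγ w.2 fun h => hw (Subtype.ext h)
  -- Only the functional `aDG a ·` on `W` has to be local. In the iteration `b` is `a` itself; for
  -- the first step `a` is the nonlocal `u` and `b` is the local `v`.
  have hloc : ∀ (z : M.nodes) (k : ℕ) (a : W),
      (∃ b ∈ M.VhOn (M.oversample i k), ∀ w ∈ W, M.aDG κ γ a w = M.aDG κ γ b w) →
      (∀ w ∈ (M.VhOn (M.star z)).comap W.subtype, M.aDG κ γ a w = 0) ∨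
      (M.VhOn (M.star z)).comap W.subtype ≤ (M.VhOn (M.oversample i (k + 2))).comap W.subtype := by
    rintro z k a ⟨b, hb, hab⟩
    rcases aDG_eq_zero_or_star_subset κ γ hb z with h | h
    · exact Or.inl fun w hw => (hab w w.2).trans (h w hw)
    · exact Or.inr fun w hw => M.VhOn_mono h hw
  obtain ⟨x, hx, hx'⟩ := exists_localized_approximation (V := W) (ι := M.nodes)
    ((M.aForm κ γ).compl₁₂ W.subtype W.subtype) ((M.dgForm κ γ).compl₁₂ W.subtype W.subtype)
    (fun x y => by simpa using M.aDG_comm κ γ x y)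
    (fun w hw => by
      have h1 := hdpos w hw
      have h2 := (normEquiv_of_mem_Vh hC0 w.2.1).2
      have h3 : 0 < C0 ^ 2 := by positivity
      simpa using pos_of_mul_pos_right (h1.trans_le h2) h3.le)
    (fun x y => by simpa using M.dgForm_comm κ γ x y)
    (fun w hw => by simpa [dgForm_self] using hdpos w hw)
    (fun z => (M.VhOn (M.star z)).comap W.subtype)
    (C := 5 * M.D χ lam L C0 CI Cπ i * (1 + (M.Λ lam L)⁻¹) * C0 ^ 2) (N := 8 * C0 ^ 2)
    (by positivity) hy
    (fun w => by
      obtain ⟨f, hf, hfs, hfd⟩ := exists_decomposition (γ := γ) hκ hγ hχ hχ_nonneg hφ hL hCπ hCI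
        hsmall i w.2
      refine ⟨fun z => ⟨f z, (hf z z.2).1⟩, fun z => (hf z z.2).2, Subtype.ext ?_, ?_⟩
      · rw [AddSubmonoidClass.coe_finsetSum, Finset.sum_coe_sort M.nodes f, hfs]
      · simp only [LinearMap.compl₁₂_apply, Submodule.subtype_apply, dgForm_self, aForm_apply]
        rw [Finset.sum_coe_sort M.nodes fun z => M.normDGsq κ γ (f z)]
        refine hfd.trans ?_
        have h1 := (normEquiv_of_mem_Vh hC0 w.2.1).2
        have h2 := M.normDGsq_nonneg hκ hγ w
        rw [mul_assoc _ (C0 ^ 2)]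
        gcongr)
    (fun f hf => by
      classical
      simp only [LinearMap.compl₁₂_apply, Submodule.subtype_apply, dgForm_self, aForm_apply]
      let g : Pt → M.Fun := fun z => if h : z ∈ M.nodes then f ⟨z, h⟩ else 0
      have hg : ∀ z : M.nodes, g z = f z := fun z => dif_pos z.2
      have h1 : ((∑ z, f z : W) : M.Fun) = ∑ z ∈ M.nodes, g z := by
        rw [AddSubmonoidClass.coe_finsetSum, ← Finset.sum_coe_sort M.nodes g]
        exact Finset.sum_congr rfl fun z _ => (hg z).symm
      have h2 : ∑ z, M.normDGsq κ γ (f z) = ∑ z ∈ M.nodes, M.normDGsq κ γ (g z) := by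
        rw [← Finset.sum_coe_sort M.nodes fun z => M.normDGsq κ γ (g z)]
        exact Finset.sum_congr rfl fun z _ => by rw [hg z]
      have h3 := normDGsq_overlap_le hκ (f := g) (fun z hz => by
        rw [hg ⟨z, hz⟩]; exact hf ⟨z, hz⟩) hγ
      have h4 := (normEquiv_of_mem_Vh hC0 (∑ z, f z : W).2.1).1
      rw [h1] at h4 ⊢
      rw [h2]
      refine h4.trans ?_
      calc _ ≤ C0 ^ 2 * (8 * ∑ z ∈ M.nodes, M.normDGsq κ γ (g z)) := by gcongr
        _ = _ := by ring)
    hy' (fun k => (M.VhOn (M.oversample i (2 * k))).comap W.subtype)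
    (fun k l hkl w hw => M.VhOn_mono (oversample_mono i (by omega)) hw)
    (fun k x hx z => (hloc z (2 * k) x ⟨x, hx, fun _ _ => rfl⟩).imp
      (fun h w hw => (M.aForm_apply κ γ x w).trans (h w hw)) id)
    ⟨u, hu⟩
    (fun z => (hloc z 0 ⟨u, hu⟩ ⟨v, hv, huv⟩).imp
      (fun h w hw => (M.aForm_apply κ γ u w).trans (h w hw)) id) n
  refine ⟨x, x.2, hx, ?_⟩
  rw [← aForm_apply, ← aForm_apply]
  exact hx'

end Decay

end Mesh

end CEM

/-! ### The localization error of the basis functions. -/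

theorem lemma3 (M : CEM.Mesh) (κ : M.fine → ℝ) (hκ : ∀ τ, 0 < κ τ) (γ : ℝ) (hγ : 0 < γ)
    (χ : CEM.Pt → M.Fun) (hχ : M.IsMsBasis κ χ)
    (hχ_nonneg : ∀ z ∈ M.nodes, ∀ τ : M.fine, ∀ x ∈ τ.1.carrier,
      0 ≤ MvPolynomial.eval x (χ z τ))
    (lam : M.coarse → ℕ → ℝ) (φ : M.coarse → ℕ → M.Fun) (hφ : M.IsEigensystem κ χ lam φ)
    (L : M.coarse → ℕ) (hL : ∀ K, 1 ≤ L K ∧ L K < Module.finrank ℝ (M.VhLoc K))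
    (C0 CI Cπ : ℝ) (hC0 : M.IsNormEquivConst κ γ C0) (hCI : M.IsInterpConst κ χ CI)
    (hCπ : M.IsBubbleConst κ χ φ L Cπ) (hsmall : M.FineSmall χ lam L CI Cπ)
    (m : ℕ) (hm : 2 < m) (i : M.coarse) (j : ℕ) (hj : j ∈ Finset.Icc 1 (L i))
    (ψ ψms : M.Fun) (hψ : M.IsCEMBasis κ γ χ φ L M.Vh i j ψ)
    (hψms : M.IsCEMBasis κ γ χ φ L (M.VhOn (M.oversample i m)) i j ψms) :
    M.aDG κ γ (ψ - ψms) (ψ - ψms) ≤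
      CEM.E (M.D χ lam L C0 CI Cπ i) (M.Λ lam L) m * M.sLoc κ χ i (φ i j) (φ i j) := by
  open CEM CEM.Mesh in
  have hΛ := Λ_pos hκ hφ hL i
  have hG := le_corrector_const hκ hχ hχ_nonneg hφ hL hCπ hCI i
  have hGD := corrector_const_le_D (C0 := C0) hκ hχ hχ_nonneg hφ hL hCπ hCI hsmall i
  have hCI2 : 2 ≤ 1 + CI ^ 2 := by nlinarith [hCI.1]
  have hCD : 2 * C0 ^ 2 ≤ M.D χ lam L C0 CI Cπ i := by
    have h : C0 ^ 2 * (1 + CI ^ 2) ≤ M.D χ lam L C0 CI Cπ i := le_max_right _ _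
    nlinarith [sq_nonneg C0]
  have hφj := hφ i j (mem_Icc_of_le hL hj)
  have hφs : M.sLoc κ χ i (φ i j) (φ i j) = 1 := by
    rw [(hφj.2.2 j (mem_Icc_of_le hL hj)).1, if_pos rfl]
  obtain ⟨c, hc⟩ := exists_corrector hκ hχ hχ_nonneg hφ hL hCπ hCI hsmall i
  obtain ⟨hv1, hv2, hv3, hv4, -, hv6⟩ := hc (φ i j)
  -- The corrected eigenfunction: supported in block `i`, with the constraints of ψ and with energy
  -- bounded through `D`.
  generalize c (φ i j) = v at hv1 hv2 hv3 hv4 hv6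
  have hvi : v ∈ M.VhOn {i} := hv6 _ hφj.1
  have hvo : M.IsPhiOrthogonal κ χ φ L i j v := fun K l hl => by
    rw [hv3 K l hl]
    exact isPhiOrthogonal_phi hφ hL hj K l hl
  have hav : M.aDG κ γ v v ≤ C0 ^ 2 * M.D χ lam L C0 CI Cπ i := by
    refine (normEquiv_of_mem_Vh hC0 hv1).1.trans (mul_le_mul_of_nonneg_left ?_ (sq_nonneg _))
    rw [s_phi hφ hL hj, hφs, mul_one] at hv4
    rw [normDGsq, hv2, mul_zero, add_zero]
    exact hv4.trans hGD
  have hu := sub_mem_auxOrtho hv1 hψ.1 hvo hψ.2.1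
  have horth := fun w hw => hψ.orthogonal (w := w) hκ hγ hC0 hw
  -- ψ and v - ψ are energy orthogonal, so a(v,v) = a(ψ,ψ) + a(v - ψ, v - ψ).
  have hau : M.aDG κ γ (v - ψ) (v - ψ) ≤ M.aDG κ γ v v := by
    have h := aDG_add_self (κ := κ) (γ := γ) ψ (v - ψ)
    rw [add_sub_cancel, horth _ hu] at h
    linarith [aDG_self_nonneg hκ hγ hC0 hψ.1]
  have hD : 4096 ≤ M.D χ lam L C0 CI Cπ i := by linarith
  have hy : 1 < 1 + 6 * (M.D χ lam L C0 CI Cπ i ^ 2)⁻¹ * (1 + (√(M.Λ lam L))⁻¹)⁻¹ := by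
    have : 0 < M.D χ lam L C0 CI Cπ i := by linarith
    have := Real.sqrt_nonneg (M.Λ lam L)
    have : 0 < 6 * (M.D χ lam L C0 CI Cπ i ^ 2)⁻¹ * (1 + (√(M.Λ lam L))⁻¹)⁻¹ := by positivity
    linarith
  obtain ⟨x, hxW, hxs, hx⟩ := exists_local_approximation hκ hγ hχ hχ_nonneg hφ hL hC0 hCπ hCI
    hsmall i hu hvi (fun w hw => by
      rw [← aForm_apply, map_sub, LinearMap.sub_apply, aForm_apply, aForm_apply, horth w hw,
        sub_zero]) hy
    (schwarz_contrast_bound hD (inv_nonneg.2 (Real.sqrt_nonneg _))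
      (by rw [inv_pow, Real.sq_sqrt hΛ.le]) hCD) (m / 2)
  -- The competitor v - x satisfies the constraints and lives in 2⌊m/2⌋ ≤ m layers.
  have hmin := hψms.2.2 (v - x)
    (Submodule.sub_mem _ (M.VhOn_mono (oversample_mono i (Nat.zero_le m)) hvi)
      (M.VhOn_mono (oversample_mono i (by omega)) hxs)) (hvo.sub hxW)
  -- Pythagoras: among functions with the constraints of ψ, energy exceeds that of ψ exactly by the
  -- squared distance to ψ. Comparing energies of ψms and v - x thus compares their distances to ψ.
  have hsplit : ∀ w, w - ψ ∈ M.auxOrtho κ χ φ L →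
      M.aDG κ γ w w = M.aDG κ γ ψ ψ + M.aDG κ γ (w - ψ) (w - ψ) := fun w hw => by
    have h := aDG_add_self (κ := κ) (γ := γ) ψ (w - ψ)
    rw [add_sub_cancel, horth _ hw] at h
    linarith
  have hneg : M.aDG κ γ (ψ - ψms) (ψ - ψms) = M.aDG κ γ (ψms - ψ) (ψms - ψ) := by
    rw [← neg_sub ψms ψ]
    simp only [← aForm_apply, map_neg, LinearMap.neg_apply, neg_neg]
  rw [hsplit ψms (sub_mem_auxOrtho (M.VhOn_le_Vh _ hψms.1) hψ.1 hψms.2.1 hψ.2.1),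
    hsplit (v - x) (by rw [sub_right_comm]; exact Submodule.sub_mem _ hu hxW),
    sub_right_comm] at hmin
  rw [hφs, mul_one, hneg]
  exact le_trans (by linarith) (hx.trans
    (decay_bound hD (inv_nonneg.2 hΛ.le) hy.le hCD (hau.trans hav) m))
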